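/- Let $\rho:\mathfrak g\to\mathrm{gl}(V)$ be a finite-dimensional complex representation of a finite-dimensional complex Lie algebra. For $x\in V$ let $R_x:\mathfrak g\to V$, $R_x(\xi)=\rho(\xi)x$, and let $r=\max_{x}\mathrm{rk}\,R_x$. A point $a\in V$ is regular if $\dim\mathrm{Ker}\,R_a\le\dim\mathrm{Ker}\,R_x$ for all $x\in V$. Notation for pencils. For $x,a\in V$ consider the pencil $R_x+\lambda R_a=R_{x+\lambda a}$ and its Jordan--Kronecker canonical form, made of Jordan blocks with eigenvalues in $\mathbb C\cup\{\infty\}$, horizontal Kronecker blocks of size $\varepsilon\times(\varepsilon+1)$ and vertical Kronecker blocks of size $(\eta+1)\times\eta$ ($\varepsilon,\eta\ge 0$). Put $\mathsf k_{\mathrm{vert}}(x,a)=\sum(\eta_j+1)$, the sum being over all vertical blocks. The algebraic type of the pencil consists of the number of distinct eigenvalues, the number and sizes of the Jordan blocks for each eigenvalue, and the collections of the $\varepsilon_i$ and of the $\eta_j$. A pair $(x,a)$ is generic if it lies in a Zariski open subset of $V\times V$ on which the algebraic type is constant; $\mathsf k_{\mathrm{vert}}(\rho)$ is the value of $\mathsf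 k_{\mathrm{vert}}(x,a)$ for generic $(x,a)$, i.e. its value on a nonempty Zariski open subset of $V\times V$. The set $\mathsf{Sing}_1$. Let $p_1,\dots,p_N\in\mathbb C[V]$ be the $r\times r$ minors of the matrix of $R_x$ (in some bases) that do not vanish identically, let $\mathsf p_\rho$ be their greatest common divisor, and $p_i=\mathsf p_\rho h_i$. Then $\mathsf{Sing}_1=\{x\in V: h_1(x)=\dots=h_N(x)=0\}$. Formal invariants. Let $a\in V$ be regular. A formal invariant at $a$ is a formal power series $G=\sum_{j\ge0}\lambda^jg_j$, with $g_j\in\mathbb C[V]$ homogeneous of degree $j$, such that $(R_a+\lambda R_x)^*\sum_{j\ge 0}\lambda^j\,dg_j(x)=0$ for all $x\in V$. A complete set of formal invariants at $a$ is a finite family $G_\alpha=\sum_j\lambda^jg_{\alpha,j}$ of formal invariants at $a$ whose linear terms $g_{\alpha,1}$ form a basis of $\mathrm{Ker}\,R_a^*\subset V^*$. For a complete set, let $\mathcal F_a\subset\mathbb C[V]$ be the subalgebra generated by all the components $g_{\alpha,j}$. Proposition. Let $a\in V$ be regular. Then a complete set of formal invariants at $a$ exists, and for every such set, with $\mathcal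 F_a$ the algebra that it generates, the following hold. 1. For every $x\in V$, $\dim\mathrm{span}\{dg(x): g\in\mathcal F_a\}=\mathsf k_{\mathrm{vert}}(x,a)$. 2. If $x\in V$ is such that the line $\{x+\lambda a:\lambda\in\mathbb C\}$ does not intersect $\mathsf{Sing}_1$ (in particular, if $(x,a)$ is a generic pair: for such a pair the line never meets $\mathsf{Sing}_1$), then $\dim\mathrm{span}\{dg(x): g\in\mathcal F_a\}=\mathsf k_{\mathrm{vert}}(\rho)$. 3. $\mathrm{trdeg}\,\mathcal F_a=\mathsf k_{\mathrm{vert}}(\rho)$. -/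

import Mathlib

attribute [local instance 100] LieRing.ofAssociativeRing

noncomputable section

namespace JordanKronecker

section Pencils

variable {K : Type*} [Field K]

/-- The blocks of the Jordan–Kronecker canonical form of a pencil `A + μ B`.
`jordan e n` is the Jordan block of size `n + 1` with eigenvalue `e ∈ K ∪ {∞}`;
`hor ε` is the horizontal Kronecker block of size `ε × (ε + 1)`;
`vert η` is the vertical Kronecker block of size `(η + 1) × η`.
The zero block with `g` rows and `h` columns is made of `g` blocks `vert 0` and `h` blocks
`hor 0`. -/
inductive Block (K : Type*) where
  | jordan (e : OnePoint K) (n : ℕ)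
  | hor (ε : ℕ)
  | vert (η : ℕ)

/-- Number of rows of a block. -/
def Block.rows : Block K → ℕ
  | .jordan _ n => n + 1
  | .hor ε => ε
  | .vert η => η + 1

/-- Number of columns of a block. -/
def Block.cols : Block K → ℕ
  | .jordan _ n => n + 1
  | .hor ε => ε + 1
  | .vert η => η

/-- The matrix with `d` on the main diagonal and `s` on the diagonal just above it. -/
def upperBand (m n : ℕ) (d s : K) : Matrix (Fin m) (Fin n) K :=
  Matrix.of fun i j =>
    if (j : ℕ) = i then d else if (j : ℕ) = i + 1 then s else 0

/-- The constant term `A` of the block `A + μ B`. -/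
def Block.matA : (β : Block K) → Matrix (Fin β.rows) (Fin β.cols) K
  | .jordan (some e) n => upperBand (n + 1) (n + 1) e 1
  | .jordan none n => upperBand (n + 1) (n + 1) 1 0
  | .hor ε => upperBand ε (ε + 1) 1 0
  | .vert η => (upperBand η (η + 1) 1 0).transpose

/-- The coefficient `B` of `μ` in the block `A + μ B`. -/
def Block.matB : (β : Block K) → Matrix (Fin β.rows) (Fin β.cols) K
  | .jordan (some _) n => upperBand (n + 1) (n + 1) 1 0
  | .jordan none n => upperBand (n + 1) (n + 1) 0 1
  | .hor ε => upperBand ε (ε + 1) 0 1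
  | .vert η => (upperBand η (η + 1) 0 1).transpose

variable {U V : Type*} [AddCommGroup U] [Module K U] [AddCommGroup V] [Module K V]

/-- A Jordan–Kronecker canonical form of the pencil `A + μ B` of linear maps `U → V`: bases of `U`
and `V` in which `A` and `B` are block diagonal with blocks from the above list. -/
structure CanonicalForm (A B : U →ₗ[K] V) where
  /-- the number of blocks -/
  num : ℕ
  /-- the blocks -/
  block : Fin num → Block K
  /-- the basis of the source -/
  basisU : Module.Basis (Σ i, Fin (block i).cols) K U
  /-- the basis of the target -/
  basisV : Module.Basis (Σ i, Fin (block i).rows) K V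
  matA_eq : LinearMap.toMatrix basisU basisV A = Matrix.blockDiagonal' fun i => (block i).matA
  matB_eq : LinearMap.toMatrix basisU basisV B = Matrix.blockDiagonal' fun i => (block i).matB

/-- The minimal row index carried by a block, if the block is vertical. -/
def Block.rowIndex : Block K → Option ℕ
  | .vert η => some η
  | _ => none

/-- The minimal column index carried by a block, if the block is horizontal. -/
def Block.colIndex : Block K → Option ℕ
  | .hor ε => some ε
  | _ => none

/-- The eigenvalue (possibly `∞`) of a block, if it is a Jordan block. -/
def Block.eigenvalue : Block K → Option (OnePoint K)
  | .jordan e _ => some e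
  | _ => none

open Classical in
/-- The size of a block, if it is a Jordan block with eigenvalue `e`. -/
def Block.jordanSize (e : OnePoint K) : Block K → Option ℕ
  | .jordan e' n => if e' = e then some (n + 1) else none
  | _ => none

namespace CanonicalForm

variable {A B : U →ₗ[K] V}

/-- The minimal row indices `η₁, …, η_q`: the numbers of columns of the vertical blocks. -/
def rowIndices (F : CanonicalForm A B) : Multiset ℕ :=
  Finset.univ.val.filterMap fun i => (F.block i).rowIndex

/-- The minimal column indices `ε₁, …, ε_p`: the numbers of rows of the horizontal blocks. -/
def colIndices (F : CanonicalForm A B) : Multiset ℕ :=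
  Finset.univ.val.filterMap fun i => (F.block i).colIndex

/-- The sizes of the Jordan blocks with eigenvalue `e`. -/
def jordanSizes (F : CanonicalForm A B) (e : OnePoint K) : Multiset ℕ :=
  Finset.univ.val.filterMap fun i => (F.block i).jordanSize e

open Classical in
/-- The set of distinct eigenvalues of the Jordan blocks. -/
def eigenvalues (F : CanonicalForm A B) : Finset (OnePoint K) :=
  (Finset.univ.val.filterMap fun i => (F.block i).eigenvalue).toFinset

end CanonicalForm

/-- The discrete invariants of a pencil. The eigenvalues themselves are forgotten: `jordan`
has one entry for each distinct eigenvalue, namely the sizes of its Jordan blocks. -/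
structure AlgebraicType where
  /-- for each distinct eigenvalue, the sizes of its Jordan blocks -/
  jordan : Multiset (Multiset ℕ)
  /-- minimal row indices -/
  rowIndices : Multiset ℕ
  /-- minimal column indices -/
  colIndices : Multiset ℕ

/-- The algebraic type read off from a canonical form. -/
def CanonicalForm.algebraicType {A B : U →ₗ[K] V} (F : CanonicalForm A B) : AlgebraicType where
  jordan := F.eigenvalues.val.map F.jordanSizes
  rowIndices := F.rowIndices
  colIndices := F.colIndices

/-- The pencil `A + μ B` has algebraic type `t`. -/
def HasType (A B : U →ₗ[K] V) (t : AlgebraicType) : Prop :=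
  ∃ F : CanonicalForm A B, F.algebraicType = t

/-- The total Kronecker `v`-index `∑ (η_j + 1)` read off from a canonical form. -/
def CanonicalForm.kVert {A B : U →ₗ[K] V} (F : CanonicalForm A B) : ℕ :=
  (F.rowIndices.map fun η => η + 1).sum

/-- The total Kronecker `v`-index of the pencil `A + μ B`: the value of `∑ (η_j + 1)` for its
canonical form (this set has exactly one element when the field is algebraically closed and the
spaces are finite-dimensional). -/
def kVert (A B : U →ₗ[K] V) : ℕ :=
  sInf {k | ∃ F : CanonicalForm A B, F.kVert = k}

end Pencils

section Representations

variable {𝔤 V ι κ : Type*} [LieRing 𝔤] [LieAlgebra ℂ 𝔤] [AddCommGroup V] [Module ℂ V]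
variable [Fintype ι]

/-- The operator `R_x : 𝔤 → V`, `R_x ξ = ρ(ξ) x`. -/
def R (ρ : 𝔤 →ₗ⁅ℂ⁆ Module.End ℂ V) (x : V) : 𝔤 →ₗ[ℂ] V :=
  (LinearMap.applyₗ x).comp (ρ : 𝔤 →ₗ[ℂ] Module.End ℂ V)

/-- `a` is regular: its stabiliser `Ker R_a` has the smallest dimension. -/
def IsRegularPoint (ρ : 𝔤 →ₗ⁅ℂ⁆ Module.End ℂ V) (a : V) : Prop :=
  ∀ x : V, Module.finrank ℂ (LinearMap.ker (R ρ a)) ≤ Module.finrank ℂ (LinearMap.ker (R ρ x))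

/-- The value at `x` of a polynomial on `V`, written in the linear coordinates of the basis `b`.
Thus `MvPolynomial ι ℂ` is the algebra `ℂ[V]`. -/
def evalAt (b : Module.Basis ι ℂ V) (x : V) (g : MvPolynomial ι ℂ) : ℂ :=
  MvPolynomial.eval (fun i => b.repr x i) g

/-- The differential `dg(x) ∈ V*` of a polynomial `g` on `V`. -/
def differential (b : Module.Basis ι ℂ V) (g : MvPolynomial ι ℂ) (x : V) : Module.Dual ℂ V :=
  ∑ i, evalAt b x (MvPolynomial.pderiv i g) • b.coord i

/-- A formal power series `G = ∑ μ^j g_j` in a formal variable `μ`, with `g_j` a homogeneous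
polynomial of degree `j` on `V`, is a formal invariant of `ρ` at `a` if it satisfies
`(R_a + μ R_x)^* ∑ μ^j dg_j(x) = 0` for all `x`, written out coefficient by coefficient. -/
structure IsFormalInvariant (ρ : 𝔤 →ₗ⁅ℂ⁆ Module.End ℂ V) (b : Module.Basis ι ℂ V) (a : V)
    (G : PowerSeries (MvPolynomial ι ℂ)) : Prop where
  homogeneous : ∀ j, (PowerSeries.coeff j G).IsHomogeneous j
  coeff_zero : ∀ x, (R ρ a).dualMap (differential b (PowerSeries.coeff 0 G) x) = 0
  coeff_succ : ∀ x j,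
    (R ρ a).dualMap (differential b (PowerSeries.coeff (j + 1) G) x) +
      (R ρ x).dualMap (differential b (PowerSeries.coeff j G) x) = 0

/-- `G₁, …, G_q` is a complete set of formal invariants at `a`: the linear terms `g_{α,1}` form a
basis of `Ker R_a^* ⊆ V*`. A linear form is identified with its differential at `0`. -/
structure IsCompleteSet (ρ : 𝔤 →ₗ⁅ℂ⁆ Module.End ℂ V) (b : Module.Basis ι ℂ V) (a : V)
    {q : ℕ} (G : Fin q → PowerSeries (MvPolynomial ι ℂ)) : Prop where
  formalInvariant : ∀ α, IsFormalInvariant ρ b a (G α)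
  linearIndependent :
    LinearIndependent ℂ fun α => differential b (PowerSeries.coeff 1 (G α)) 0
  span_eq :
    Submodule.span ℂ (Set.range fun α => differential b (PowerSeries.coeff 1 (G α)) 0) =
      LinearMap.ker (R ρ a).dualMap

/-- The algebra generated by the homogeneous components `g_{α,j}` of the series `G_α`. For a
complete set of formal invariants at `a` this is the algebra `ℱ_a`. -/
def componentAlgebra {q : ℕ} (G : Fin q → PowerSeries (MvPolynomial ι ℂ)) :
    Subalgebra ℂ (MvPolynomial ι ℂ) :=
  Algebra.adjoin ℂ {g | ∃ α j, g = PowerSeries.coeff j (G α)}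

/-- The span in `V*` of the differentials at `x` of the elements of a subalgebra of `ℂ[V]`. -/
def spanDifferentials (b : Module.Basis ι ℂ V) (F : Subalgebra ℂ (MvPolynomial ι ℂ)) (x : V) :
    Submodule ℂ (Module.Dual ℂ V) :=
  Submodule.span ℂ {φ | ∃ g ∈ F, φ = differential b g x}

/-- The dimension of a regular orbit, `max_x rk R_x`. -/
def regularRank (ρ : 𝔤 →ₗ⁅ℂ⁆ Module.End ℂ V) : ℕ :=
  sSup (Set.range fun x : V => Module.finrank ℂ (LinearMap.range (R ρ x)))

/-- The matrix of `R_x` in the bases `c` of `𝔤` and `b` of `V`; its entries are linear forms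
in `x`. -/
def genericMatrix (ρ : 𝔤 →ₗ⁅ℂ⁆ Module.End ℂ V) (b : Module.Basis ι ℂ V)
    (c : Module.Basis κ ℂ 𝔤) : Matrix ι κ (MvPolynomial ι ℂ) :=
  Matrix.of fun i j => ∑ k, MvPolynomial.C (b.repr (ρ (c j) (b k)) i) * MvPolynomial.X k

/-- The not identically vanishing minors of size `r × r`, `r = max_x rk R_x`, of the matrix of
`R_x`, as polynomials in `x`. -/
def maximalMinors (ρ : 𝔤 →ₗ⁅ℂ⁆ Module.End ℂ V) (b : Module.Basis ι ℂ V)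
    (c : Module.Basis κ ℂ 𝔤) : Set (MvPolynomial ι ℂ) :=
  {p | p ≠ 0 ∧ ∃ (f : Fin (regularRank ρ) ↪ ι) (g : Fin (regularRank ρ) ↪ κ),
    p = ((genericMatrix ρ b c).submatrix f g).det}

/-- `p` is a fundamental semi-invariant of `ρ`: a greatest common divisor of the minors. -/
def IsFundamentalSemiInvariant (ρ : 𝔤 →ₗ⁅ℂ⁆ Module.End ℂ V) (b : Module.Basis ι ℂ V)
    (c : Module.Basis κ ℂ 𝔤) (p : MvPolynomial ι ℂ) : Prop :=
  (∀ m ∈ maximalMinors ρ b c, p ∣ m) ∧ ∀ d, (∀ m ∈ maximalMinors ρ b c, d ∣ m) → d ∣ p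

/-- The set `Sing₁` of common zeros of the quotients of the minors by their greatest common
divisor. -/
def singOne (ρ : 𝔤 →ₗ⁅ℂ⁆ Module.End ℂ V) (b : Module.Basis ι ℂ V)
    (c : Module.Basis κ ℂ 𝔤) : Set V :=
  {x | ∀ p h, IsFundamentalSemiInvariant ρ b c p → p * h ∈ maximalMinors ρ b c →
    evalAt b x h = 0}

/-- Zariski open subsets of `V × V`. -/
def IsZariskiOpen (b : Module.Basis ι ℂ V) (W : Set (V × V)) : Prop :=
  ∃ S : Set (MvPolynomial (ι ⊕ ι) ℂ), W = {p | ∃ f ∈ S,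
    MvPolynomial.eval (Sum.elim (fun i => b.repr p.1 i) (fun i => b.repr p.2 i)) f ≠ 0}

/-- `(x, a)` is a generic pair: it lies in a Zariski open set of pairs whose pencils
`R_x + μ R_a` all have one and the same algebraic type. -/
def IsGenericPair (ρ : 𝔤 →ₗ⁅ℂ⁆ Module.End ℂ V) (b : Module.Basis ι ℂ V) (x a : V) : Prop :=
  ∃ W, IsZariskiOpen b W ∧ (x, a) ∈ W ∧
    ∃ t : AlgebraicType, ∀ p ∈ W, HasType (R ρ p.1) (R ρ p.2) t

/-- The total Kronecker `v`-index of `ρ`: the value of the `v`-index of the pencil `R_x + μ R_a`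
for generic `(x, a)`, that is, on a nonempty Zariski open subset of `V × V` (nonempty Zariski open
subsets intersect, so there is at most one such value). -/
def kVertRep (ρ : 𝔤 →ₗ⁅ℂ⁆ Module.End ℂ V) (b : Module.Basis ι ℂ V) : ℕ :=
  sInf {k | ∃ W, IsZariskiOpen b W ∧ W.Nonempty ∧ ∀ p ∈ W, kVert (R ρ p.1) (R ρ p.2) = k}

end Representations

end JordanKronecker

end

/-! Fix a regular point `a` and any `x`, and put `A = R_x`, `B = R_a`. The proof rests on one
invariant of a pencil: the span of all members of chains `B u₀ = 0`, `B u_{i+1} = A u_i`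
(`chainSpan`). Since `B` has maximal rank in the pencil, every kernel vector of `B` starts an
infinite chain, and the same holds for the dual pencil (`hasKerChains_of_finrank_le`). This rules
out Jordan blocks at infinity. The canonical form, whose existence is proved here under this
condition, then shows that the chain span of the pencil is spanned by the horizontal blocks and that
of the dual pencil by the vertical ones. So the latter has dimension `kVert`
(`kVert_eq_finrank_chainSpan`).

Item 1: the equations of a formal invariant say that the differentials of its components form, up to
sign, a chain of the dual pencil. As the linear terms span `Ker R_a^*`, these differentials span the
whole chain span (`IsCompleteSet.spanDifferentials_eq`).

Existence: the next component must have prescribed derivatives along the directions `ρ(ξ)a`. The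
prescription is consistent on `Ker R_a` because kernel vectors extend to chains, and it is closed
because `ρ` respects brackets. The polynomial Poincaré lemma then gives the component
(`AreConsecutive.exists_next`).

Item 2: counting block sizes gives `k_vert + k_hor + J + r = dim 𝔤 + dim V`, where `J` is the total
size of the Jordan blocks, equal to the degree of the greatest common divisor of the maximal minors
of the pencil. On the line `x + ta` the fundamental semi-invariant keeps its full degree, because
some minor does not vanish at `a`. Hence `J ≥ deg p`, with equality exactly when the line misses
`Sing₁` (`totalDegree_le_and_iff`). The indices `k_vert` and `k_hor` are lower semicontinuous in the
pair, so their generic values are maxima. The quotients `h_i` are coprime, so by Gauss's lemma some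
line in direction `a` misses `Sing₁`. Thus the sum of the generic values is the bound, and it is
attained exactly on lines missing `Sing₁`, where each index must take its generic value.

Item 3: in characteristic zero the transcendence degree is the maximal dimension of the span of
differentials (`trdeg_eq_of_isGreatest`). -/

noncomputable section

namespace JordanKronecker

/-! ### Chains of a pencil, their dimension count, and chains from maximal rank -/

section Chains

variable {K : Type*} [Field K]
variable {U V : Type*} [AddCommGroup U] [Module K U] [AddCommGroup V] [Module K V]

/-- The vectors `u_n` ending a chain `u₀, …, u_n` with `B u₀ = 0` and `B u_{i+1} = A u_i`. -/
def kerChain (A B : U →ₗ[K] V) : ℕ → Submodule K U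
  | 0 => LinearMap.ker B
  | n + 1 => ((kerChain A B n).map A).comap B

/-- The span of all members of chains `B u₀ = 0`, `B u_{i+1} = A u_i`. -/
def chainSpan (A B : U →ₗ[K] V) : Submodule K U := ⨆ n, kerChain A B n

/-- Every vector of `ker B` starts an infinite chain. -/
def HasKerChains (A B : U →ₗ[K] V) : Prop :=
  ∀ u, B u = 0 → ∃ w : ℕ → U, w 0 = u ∧ ∀ n, B (w (n + 1)) = A (w n)

variable {A B : U →ₗ[K] V}

theorem mem_kerChain_zero {u : U} : u ∈ kerChain A B 0 ↔ B u = 0 := Iff.rfl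

theorem mem_kerChain_succ {n : ℕ} {u : U} :
    u ∈ kerChain A B (n + 1) ↔ ∃ v ∈ kerChain A B n, A v = B u := Iff.rfl

theorem kerChain_mono : Monotone (kerChain A B) := by
  refine monotone_nat_of_le_succ fun n => ?_
  induction n with
  | zero =>
    intro u hu
    exact mem_kerChain_succ.2 ⟨0, zero_mem _, by rw [map_zero, mem_kerChain_zero.1 hu]⟩
  | succ n ih => exact Submodule.comap_mono (Submodule.map_mono ih)

theorem kerChain_le_chainSpan (n : ℕ) : kerChain A B n ≤ chainSpan A B :=
  le_iSup (kerChain A B) n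

theorem mem_chainSpan {u : U} : u ∈ chainSpan A B ↔ ∃ n, u ∈ kerChain A B n :=
  Submodule.mem_iSup_of_directed _ kerChain_mono.directed_le

theorem chainSpan_le {N : Submodule K U} (h0 : ∀ u, B u = 0 → u ∈ N)
    (h1 : ∀ u, ∀ v ∈ N, B u = A v → u ∈ N) : chainSpan A B ≤ N := by
  refine iSup_le fun n => ?_
  induction n with
  | zero => exact h0
  | succ n ih =>
    intro u hu
    obtain ⟨v, hv, h⟩ := mem_kerChain_succ.1 hu
    exact h1 u v (ih hv) h.symm

theorem mem_chainSpan_of_ker {u : U} (h : B u = 0) : u ∈ chainSpan A B :=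
  mem_chainSpan.2 ⟨0, h⟩

theorem mem_chainSpan_of_eq {u v : U} (hv : v ∈ chainSpan A B) (h : B u = A v) :
    u ∈ chainSpan A B := by
  obtain ⟨n, hn⟩ := mem_chainSpan.1 hv
  exact mem_chainSpan.2 ⟨n + 1, mem_kerChain_succ.2 ⟨v, hn, h.symm⟩⟩

/-- Members of infinite chains span a space `S` with `A S ⊆ B S`. It contains `ker B` and is closed
under solving `B u = A v`, so it contains the chain span. Hence no finite chain gets stuck. -/
theorem HasKerChains.exists_eq (h : HasKerChains A B) {u : U} (hu : u ∈ chainSpan A B) :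
    ∃ v, B v = A u := by
  let S : Submodule K U := Submodule.span K
    {u | ∃ w : ℕ → U, (∀ n, B (w (n + 1)) = A (w n)) ∧ ∃ n, u = w n}
  have hS : ∀ u ∈ S, ∃ v ∈ S, B v = A u := by
    intro u hu
    induction hu using Submodule.span_induction with
    | mem x hx =>
      obtain ⟨w, hw, n, rfl⟩ := hx
      exact ⟨w (n + 1), Submodule.subset_span ⟨w, hw, n + 1, rfl⟩, hw n⟩
    | zero => exact ⟨0, zero_mem _, by simp⟩
    | add x y _ _ hx hy =>
      obtain ⟨v, hv, hv'⟩ := hx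
      obtain ⟨v', hv2, hv2'⟩ := hy
      exact ⟨v + v', add_mem hv hv2, by simp [hv', hv2']⟩
    | smul c x _ hx =>
      obtain ⟨v, hv, hv'⟩ := hx
      exact ⟨c • v, Submodule.smul_mem _ c hv, by simp [hv']⟩
  have hker : ∀ u, B u = 0 → u ∈ S := by
    intro u hu
    obtain ⟨w, h0, hw⟩ := h u hu
    exact Submodule.subset_span ⟨w, hw, 0, h0.symm⟩
  have hle : chainSpan A B ≤ S := by
    refine chainSpan_le hker fun u v hv huv => ?_
    obtain ⟨v', hv', h'⟩ := hS v hv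
    have : u - v' ∈ S := hker _ (by simp [huv, h'])
    simpa using add_mem this hv'
  obtain ⟨v, -, hv⟩ := hS u (hle hu)
  exact ⟨v, hv⟩

theorem hasKerChains_of_surjective (h : Function.Surjective B) : HasKerChains A B := by
  intro u _
  choose s hs using h
  refine ⟨fun n => Nat.rec u (fun _ w => s (A w)) n, rfl, fun n => hs _⟩

/-- The polynomial kernel map `u ↦ (B u_i - A u_{i-1})_i` on polynomials of degree `< n`. -/
def toeplitz (n : ℕ) : (U →ₗ[K] V) × (U →ₗ[K] V) →ₗ[K] (Fin n → U) →ₗ[K] (Fin (n + 1) → V) where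
  toFun p :=
    -- Padding by zero at the end for `B` and at the start for `A` encodes that a polynomial of
    -- degree `< n` has no coefficients outside `0, …, n - 1`.
    { toFun := fun u i => p.2 (Fin.snoc (α := fun _ => U) u 0 i)
        - p.1 (Fin.cons (α := fun _ => U) 0 u i)
      map_add' := fun u v => by
        ext i
        have h1 : Fin.snoc (α := fun _ => U) (u + v) 0 i
            = Fin.snoc (α := fun _ => U) u 0 i + Fin.snoc (α := fun _ => U) v 0 i := by
          refine Fin.lastCases ?_ (fun j => ?_) i <;> simp
        have h2 : Fin.cons (α := fun _ => U) 0 (u + v) i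
            = Fin.cons (α := fun _ => U) 0 u i + Fin.cons (α := fun _ => U) 0 v i := by
          refine Fin.cases ?_ (fun j => ?_) i <;> simp
        simp only [h1, h2, map_add, Pi.add_apply]
        abel
      map_smul' := fun c u => by
        ext i
        have h1 : Fin.snoc (α := fun _ => U) (c • u) 0 i
            = c • Fin.snoc (α := fun _ => U) u 0 i := by
          refine Fin.lastCases ?_ (fun j => ?_) i <;> simp
        have h2 : Fin.cons (α := fun _ => U) 0 (c • u) i
            = c • Fin.cons (α := fun _ => U) 0 u i := by
          refine Fin.cases ?_ (fun j => ?_) i <;> simp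
        simp only [h1, h2, map_smul, Pi.smul_apply, RingHom.id_apply, smul_sub] }
  map_add' p q := by
    refine LinearMap.ext fun u => funext fun i => ?_
    simp only [Prod.snd_add, Prod.fst_add, LinearMap.add_apply, LinearMap.coe_mk, AddHom.coe_mk,
      Pi.add_apply]
    abel
  map_smul' c p := by
    refine LinearMap.ext fun u => funext fun i => ?_
    simp [smul_sub]

theorem toeplitz_apply (n : ℕ) (u : Fin n → U) (i : Fin (n + 1)) :
    toeplitz n (A, B) u i = B (Fin.snoc (α := fun _ => U) u 0 i)
        - A (Fin.cons (α := fun _ => U) 0 u i) := rfl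

theorem mem_ker_toeplitz {n : ℕ} {u : Fin n → U} :
    u ∈ LinearMap.ker (toeplitz n (A, B)) ↔
      ∀ i : Fin (n + 1), B (Fin.snoc (α := fun _ => U) u 0 i)
        = A (Fin.cons (α := fun _ => U) 0 u i) := by
  rw [LinearMap.mem_ker, funext_iff]
  simp only [toeplitz_apply, Pi.zero_apply, sub_eq_zero]

theorem mem_ker_toeplitz_succ {n : ℕ} {u : Fin (n + 1) → U} :
    u ∈ LinearMap.ker (toeplitz (n + 1) (A, B)) ↔
      (B (u 0) = 0 ∧ ∀ i : Fin n, B (u i.succ) = A (u i.castSucc)) ∧ A (u (Fin.last n)) = 0 := by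
  rw [mem_ker_toeplitz, Fin.forall_fin_succ, Fin.forall_fin_succ']
  have e0 : (0 : Fin (n + 2)) = Fin.castSucc 0 := rfl
  have e1 : (Fin.last n).succ = Fin.last (n + 1) := rfl
  simp only [Fin.cons_zero, map_zero, Fin.cons_succ]
  simp only [e1, Fin.snoc_last, map_zero, Fin.succ_castSucc, Fin.snoc_castSucc]
  rw [e0, Fin.snoc_castSucc, and_assoc, @eq_comm _ 0 (A _)]

theorem mem_kerChain_iff {n : ℕ} {v : U} :
    v ∈ kerChain A B n ↔ ∃ u : Fin (n + 1) → U, (B (u 0) = 0 ∧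
      ∀ i : Fin n, B (u i.succ) = A (u i.castSucc)) ∧ u (Fin.last n) = v := by
  induction n generalizing v with
  | zero =>
    constructor
    · intro h
      exact ⟨fun _ => v, ⟨h, fun i => i.elim0⟩, rfl⟩
    · rintro ⟨u, ⟨h, -⟩, rfl⟩
      exact h
  | succ n ih =>
    rw [mem_kerChain_succ]
    constructor
    · rintro ⟨w, hw, h⟩
      obtain ⟨u, ⟨h0, h1⟩, rfl⟩ := ih.1 hw
      refine ⟨Fin.snoc (α := fun _ => U) u v, ⟨?_, ?_⟩, by simp⟩
      · have e0 : (0 : Fin (n + 2)) = Fin.castSucc 0 := rfl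
        rw [e0, Fin.snoc_castSucc]
        exact h0
      · intro i
        refine Fin.lastCases ?_ (fun j => ?_) i
        · rw [Fin.succ_last, Fin.snoc_last, Fin.snoc_castSucc, h]
        · rw [Fin.succ_castSucc, Fin.snoc_castSucc, Fin.snoc_castSucc, h1]
    · rintro ⟨u, ⟨h0, h1⟩, rfl⟩
      refine ⟨u (Fin.last n).castSucc, ih.2 ⟨fun i => u i.castSucc, ⟨h0, fun i => ?_⟩, rfl⟩, ?_⟩
      · exact h1 i.castSucc
      · rw [← Fin.succ_last, h1]

variable [FiniteDimensional K U]

/-- Project a polynomial kernel vector to its top coefficient. That coefficient ends a chain and is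
killed by `A`; if it vanishes, the degree drops by one. -/
theorem finrank_ker_toeplitz_succ (n : ℕ) :
    Module.finrank K (LinearMap.ker (toeplitz (n + 1) (A, B))) =
      Module.finrank K (LinearMap.ker (toeplitz n (A, B))) +
      Module.finrank K ↥(kerChain A B n ⊓ LinearMap.ker A) := by
  let f : LinearMap.ker (toeplitz (n + 1) (A, B)) →ₗ[K] U :=
    (LinearMap.proj (Fin.last n)).comp (Submodule.subtype _)
  have hr : LinearMap.range f = kerChain A B n ⊓ LinearMap.ker A := by
    ext v
    rw [Submodule.mem_inf, mem_kerChain_iff]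
    constructor
    · rintro ⟨⟨u, hu⟩, rfl⟩
      rw [mem_ker_toeplitz_succ] at hu
      exact ⟨⟨u, hu.1, rfl⟩, hu.2⟩
    · rintro ⟨⟨u, hu, rfl⟩, h⟩
      exact ⟨⟨u, mem_ker_toeplitz_succ.2 ⟨hu, h⟩⟩, rfl⟩
  have hk : Module.finrank K (LinearMap.ker f) =
      Module.finrank K (LinearMap.ker (toeplitz n (A, B))) := by
    let g : LinearMap.ker f →ₗ[K] LinearMap.ker (toeplitz n (A, B)) :=
      LinearMap.codRestrict _ ((LinearMap.funLeft K U Fin.castSucc).comp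
        ((Submodule.subtype _).comp (Submodule.subtype _))) (by
          rintro ⟨⟨u, hu⟩, hl⟩
          have hl' : u (Fin.last n) = 0 := hl
          rw [mem_ker_toeplitz] at hu ⊢
          intro i
          have := hu i.castSucc
          have e1 : Fin.snoc (α := fun _ => U) u 0 i.castSucc =
              Fin.snoc (α := fun _ => U) (fun j : Fin n => u j.castSucc) 0 i := by
            refine Fin.lastCases ?_ (fun j => ?_) i
            · simp [hl']
            · simp
          have e2 : Fin.cons (α := fun _ => U) 0 u i.castSucc =
              Fin.cons (α := fun _ => U) 0 (fun j : Fin n => u j.castSucc) i := by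
            refine Fin.cases ?_ (fun j => ?_) i
            · rfl
            · rw [← Fin.succ_castSucc]
              simp
          rw [e1, e2] at this
          exact this)
    refine (LinearEquiv.ofBijective g ⟨?_, ?_⟩).finrank_eq
    · rintro ⟨⟨u, hu⟩, hl⟩ ⟨⟨u', hu'⟩, hl'⟩ h
      have hl1 : u (Fin.last n) = 0 := hl
      have hl2 : u' (Fin.last n) = 0 := hl'
      have h1 : ∀ i : Fin n, u i.castSucc = u' i.castSucc := fun i =>
        congrFun (congrArg Subtype.val h) i
      have : u = u' := by
        ext i
        exact Fin.lastCases (by rw [hl1, hl2]) h1 i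
      subst this
      rfl
    · rintro ⟨u, hu⟩
      have hmem : Fin.snoc (α := fun _ => U) u 0 ∈ LinearMap.ker (toeplitz (n + 1) (A, B)) := by
        rw [mem_ker_toeplitz] at hu ⊢
        intro i
        refine Fin.lastCases ?_ (fun j => ?_) i
        · rw [← Fin.succ_last]
          rw [Fin.cons_succ]
          simp
        · rw [Fin.snoc_castSucc, hu j]
          congr 1
          refine Fin.cases ?_ (fun j => ?_) j
          · rfl
          · rw [← Fin.succ_castSucc]
            simp
      refine ⟨⟨⟨Fin.snoc (α := fun _ => U) u 0, hmem⟩, ?_⟩, ?_⟩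
      · change Fin.snoc (α := fun _ => U) u 0 (Fin.last n) = 0
        simp
      · ext i
        change Fin.snoc (α := fun _ => U) u 0 i.castSucc = u i
        simp
  rw [← hr, ← hk, ← f.finrank_range_add_finrank_ker, add_comm]

/-- Infinite chains give `B (kerChain (n + 1)) = A (kerChain n)`, so `kerChain` grows by `dim ker B`
minus what the kernel of `toeplitz` gains. The identity converts semicontinuity of the rank of
`toeplitz`, which depends linearly on the pencil, into semicontinuity of the dimension of the chain
span. -/
theorem HasKerChains.finrank_kerChain_add (h : HasKerChains A B) (n : ℕ) :
    Module.finrank K (kerChain A B n) + Module.finrank K (LinearMap.ker (toeplitz n (A, B))) =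
      (n + 1) * Module.finrank K (LinearMap.ker B) := by
  induction n with
  | zero =>
    have : Module.finrank K (LinearMap.ker (toeplitz 0 (A, B))) = 0 :=
      Module.finrank_zero_of_subsingleton
    rw [this, zero_add, one_mul, add_zero]
    rfl
  | succ n ih =>
    rw [finrank_ker_toeplitz_succ]
    let f := B.domRestrict (kerChain A B (n + 1))
    have hf := f.finrank_range_add_finrank_ker
    let g := A.domRestrict (kerChain A B n)
    have hg := g.finrank_range_add_finrank_ker
    have hr : LinearMap.range f = LinearMap.range g := by
      rw [LinearMap.range_domRestrict, LinearMap.range_domRestrict]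
      change ((((kerChain A B n).map A).comap B).map B) = _
      rw [Submodule.map_comap_eq, inf_eq_right]
      rintro _ ⟨u, hu, rfl⟩
      exact h.exists_eq (kerChain_le_chainSpan n hu)
    have hkf : Module.finrank K (LinearMap.ker f) = Module.finrank K (LinearMap.ker B) := by
      have : LinearMap.ker f = (LinearMap.ker B).comap (kerChain A B (n + 1)).subtype := by
        rfl
      rw [this]
      exact (Submodule.comapSubtypeEquivOfLe (kerChain_mono (Nat.zero_le (n + 1)))).finrank_eq
    have hkg : Module.finrank K (LinearMap.ker g) =
        Module.finrank K ↥(kerChain A B n ⊓ LinearMap.ker A) := by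
      have : LinearMap.ker g = (LinearMap.ker A).comap (kerChain A B n).subtype := by
        rfl
      rw [this, ← Submodule.finrank_map_subtype_eq, Submodule.map_comap_subtype]
    rw [hr] at hf
    rw [add_mul] at ih ⊢
    rw [add_mul]
    omega

/-- A subspace containing all resolvent vectors `(1 - c T)⁻¹ u` contains the cyclic space of
`u`. -/
theorem pow_apply_mem_of_resolvent [Infinite K] (T : Module.End K U) (W : Submodule K U) (u : U)
    (h : ∀ c : K, c ≠ 0 → Function.Injective (fun w => w - c • T w) →
      ∀ (v : U) (d : K), v - c • T v = d • u → v ∈ W) (n : ℕ) : (T ^ n) u ∈ W := by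
  let bas := Module.finBasis K U
  let M := LinearMap.toMatrix bas bas T
  have hM : ∀ (c : Fin (Module.finrank K U) → K),
      T (∑ i, c i • bas i) = ∑ i, (∑ j, M i j * c j) • bas i := by
    intro c
    refine bas.ext_elem fun i => ?_
    have h1 := congrFun (LinearMap.toMatrix_mulVec_repr bas bas T (∑ i, c i • bas i)) i
    rw [← h1, bas.repr_sum_self, bas.repr_sum_self]
    rfl
  -- `Z = 1 - X T`, and `Q` collects the coefficients of `adj(Z) u`. From `Z · adj(Z) u = det(Z) u`
  -- one reads off `Q 0 = u` and `T (Q n) = Q (n + 1)` modulo `u`.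
  let Z : Matrix (Fin (Module.finrank K U)) (Fin (Module.finrank K U)) (Polynomial K) :=
    1 - (Polynomial.X : Polynomial K) • M.map Polynomial.C
  let q : Fin (Module.finrank K U) → Polynomial K :=
    Z.adjugate.mulVec fun i => Polynomial.C (bas.repr u i)
  let Q : ℕ → U := fun n => ∑ i, (q i).coeff n • bas i
  have hZq : ∀ i, q i - Polynomial.X * ∑ j, Polynomial.C (M i j) * q j
      = Z.det * Polynomial.C (bas.repr u i) := by
    intro i
    have : (Z.mulVec q) i = Z.det * Polynomial.C (bas.repr u i) := by
      simp only [q, Matrix.mulVec_mulVec, Matrix.mul_adjugate, Matrix.smul_mulVec,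
        Matrix.one_mulVec, Pi.smul_apply, smul_eq_mul]
    rw [← this]
    simp only [Z, Matrix.sub_mulVec, Matrix.one_mulVec, Pi.sub_apply, Matrix.smul_mulVec,
      Pi.smul_apply, smul_eq_mul]
    rfl
  have hev : ∀ c, (Polynomial.evalRingHom c).mapMatrix Z = 1 - c • M := by
    intro c
    ext i j
    by_cases hij : i = j
    · subst hij
      simp [Z]
      exact mul_comm _ _
    · simp [Z, hij]
      exact mul_comm _ _
  have hd0 : Z.det.coeff 0 = 1 := by
    rw [Polynomial.coeff_zero_eq_eval_zero, ← Polynomial.coe_evalRingHom, RingHom.map_det, hev,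
      zero_smul, sub_zero, Matrix.det_one]
  have hd : Z.det ≠ 0 := by
    intro h0
    rw [h0] at hd0
    simp at hd0
  have hQ0 : Q 0 = u := by
    conv_rhs => rw [← bas.sum_repr u]
    refine Finset.sum_congr rfl fun i _ => ?_
    have := congrArg (fun p => Polynomial.coeff p 0) (hZq i)
    simp only [Polynomial.coeff_sub, Polynomial.mul_coeff_zero, Polynomial.coeff_X_zero, zero_mul,
      sub_zero, hd0, one_mul, Polynomial.coeff_C_zero] at this
    rw [this]
  have hQs : ∀ n, T (Q n) = Q (n + 1) - Z.det.coeff (n + 1) • u := by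
    intro n
    simp only [Q]
    rw [hM, ← bas.sum_repr u, Finset.smul_sum, ← Finset.sum_sub_distrib]
    refine Finset.sum_congr rfl fun i _ => ?_
    have := congrArg (fun p => Polynomial.coeff p (n + 1)) (hZq i)
    simp only [Polynomial.coeff_sub, Polynomial.coeff_X_mul, Polynomial.finsetSum_coeff,
      Polynomial.coeff_C_mul, Polynomial.coeff_mul_C] at this
    rw [smul_smul, ← sub_smul, ← this]
    congr 1
    ring
  -- A functional killing `W` kills `adj(Z(c)) u` for all `c ≠ 0` with `det Z(c) ≠ 0`. The resulting
  -- polynomial in `c`, times `X · det Z`, vanishes identically, so all its coefficients `φ (Q n)`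
  -- are zero.
  have hQW : ∀ n, Q n ∈ W := by
    intro n
    by_contra hn
    obtain ⟨φ, hφ, hW⟩ := Submodule.exists_le_ker_of_notMem hn
    let P : Polynomial K := ∑ i, q i * Polynomial.C (φ (bas i))
    have hP : ∀ n, P.coeff n = φ (Q n) := by
      intro n
      simp [P, Q, map_sum]
    have hP0 : Polynomial.X * Z.det * P = 0 := by
      refine Polynomial.funext fun c => ?_
      rw [Polynomial.eval_mul, Polynomial.eval_mul, Polynomial.eval_X, Polynomial.eval_zero]
      by_cases hc : c = 0
      · rw [hc, zero_mul, zero_mul]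
      by_cases hdc : Z.det.eval c = 0
      · rw [hdc, mul_zero, zero_mul]
      have hdet : (1 - c • M).det ≠ 0 := by
        rwa [← hev, ← RingHom.map_det, Polynomial.coe_evalRingHom]
      have hMT : 1 - c • M = LinearMap.toMatrix bas bas (1 - c • T) := by
        rw [map_sub, map_smul, LinearMap.toMatrix_one]
      have hinj : Function.Injective (fun w => w - c • T w) := by
        have : IsUnit (1 - c • T) := by
          rw [LinearMap.isUnit_iff_isUnit_det, ← LinearMap.det_toMatrix bas, ← hMT]
          exact hdet.isUnit
        exact ((Module.End.isUnit_iff _).1 this).injective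
      let v : U := ∑ i, (q i).eval c • bas i
      have hv : v - c • T v = Z.det.eval c • u := by
        simp only [v]
        rw [hM, ← bas.sum_repr u, Finset.smul_sum, Finset.smul_sum, ← Finset.sum_sub_distrib]
        refine Finset.sum_congr rfl fun i _ => ?_
        have := congrArg (Polynomial.eval c) (hZq i)
        simp only [Polynomial.eval_sub, Polynomial.eval_mul, Polynomial.eval_X,
          Polynomial.eval_finsetSum, Polynomial.eval_C] at this
        rw [smul_smul, smul_smul, ← sub_smul, ← this]
      have hPv : P.eval c = φ v := by
        simp [P, v, map_sum, Polynomial.eval_finsetSum]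
      rw [hPv, LinearMap.mem_ker.1 (hW (h c hc hinj v _ hv)), mul_zero]
    have : P = 0 := by
      rcases mul_eq_zero.1 hP0 with h0 | h0
      · exact absurd h0 (mul_ne_zero Polynomial.X_ne_zero hd)
      · exact h0
    apply hφ
    rw [← hP, this, Polynomial.coeff_zero]
  suffices hS : ∀ n, (T ^ n) u ∈ Submodule.span K (Set.range Q) from
    (Submodule.span_le.2 (by rintro _ ⟨n, rfl⟩; exact hQW n)) (hS n)
  have hT : ∀ v ∈ Submodule.span K (Set.range Q), T v ∈ Submodule.span K (Set.range Q) := by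
    intro v hv
    induction hv using Submodule.span_induction with
    | mem x hx =>
      obtain ⟨n, rfl⟩ := hx
      rw [hQs, ← hQ0]
      exact sub_mem (Submodule.subset_span ⟨_, rfl⟩)
        (Submodule.smul_mem _ _ (Submodule.subset_span ⟨_, rfl⟩))
    | zero => simp
    | add x y _ _ hx hy => rw [map_add]; exact add_mem hx hy
    | smul c x _ hx => rw [map_smul]; exact Submodule.smul_mem _ _ hx
  intro n
  induction n with
  | zero => exact Submodule.subset_span ⟨0, hQ0⟩
  | succ n ih =>
    rw [pow_succ']
    exact hT _ ih

/-- If `B` has the maximal rank in the pencil, then kernel vectors of `B` extend to chains. -/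
theorem hasKerChains_of_finrank_le [Infinite K]
    (h : ∀ c : K, Module.finrank K (LinearMap.range (B - c • A)) ≤
      Module.finrank K (LinearMap.range B)) : HasKerChains A B := by
  intro u hu
  obtain ⟨g, hg⟩ := B.rangeRestrict.exists_rightInverse_of_surjective B.range_rangeRestrict
  obtain ⟨π, hπ⟩ := (LinearMap.range B).subtype.exists_leftInverse_of_injective
    (Submodule.ker_subtype _)
  -- A generalised inverse, `B s B = B`. The chain will be `u, T u, T² u, …` with `T = s A`; what
  -- has to be proved is `A = B T` on these vectors.
  let s : V →ₗ[K] U := g.comp π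
  have hs : ∀ w, B (s (B w)) = B w := by
    intro w
    have h1 : π (B w) = B.rangeRestrict w := LinearMap.congr_fun hπ (B.rangeRestrict w)
    have h2 := congrArg Subtype.val (LinearMap.congr_fun hg (B.rangeRestrict w))
    change B (g (π (B w))) = B w
    rw [h1]
    exact h2
  let T : Module.End K U := s.comp A
  have key : ∀ n, (T ^ n) u ∈ LinearMap.ker (A - B.comp T) := by
    refine pow_apply_mem_of_resolvent T _ u fun c hc hinj v d hv => ?_
    -- On the range of `B - cA` the map `B s` already reaches all of `range B`, so maximality of the
    -- rank of `B` makes it injective there. Applied to a resolvent vector `v` of `u ∈ ker B` this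
    -- forces `(B - cA) v = 0`.
    let p : LinearMap.range (B - c • A) →ₗ[K] V := (B.comp s).domRestrict _
    have hsurj : Function.Surjective (fun w => w - c • T w) :=
      LinearMap.injective_iff_surjective (f := LinearMap.id - c • T).1 hinj
    have hr : LinearMap.range B ≤ LinearMap.range p := by
      rintro _ ⟨w, rfl⟩
      obtain ⟨w', rfl⟩ := hsurj w
      refine ⟨⟨(B - c • A) w', ⟨w', rfl⟩⟩, ?_⟩
      change B (s ((B - c • A) w')) = B (w' - c • T w')
      simp [T, hs]
    have hpi : LinearMap.ker p = ⊥ := by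
      have h1 := p.finrank_range_add_finrank_ker
      have h2 := Submodule.finrank_mono hr
      have h3 := h c
      exact Submodule.finrank_eq_zero.1 (by omega)
    have hmem : (⟨(B - c • A) v, ⟨v, rfl⟩⟩ : LinearMap.range (B - c • A)) ∈ LinearMap.ker p := by
      change B (s ((B - c • A) v)) = 0
      have : B (v - c • T v) = 0 := by rw [hv, map_smul, hu, smul_zero]
      simpa [T, hs] using this
    rw [hpi, Submodule.mem_bot] at hmem
    have h0 : B v - c • A v = 0 := congrArg Subtype.val hmem
    have h1 : B v - c • B (T v) = 0 := by
      have : B (v - c • T v) = 0 := by rw [hv, map_smul, hu, smul_zero]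
      simpa using this
    have h2 : c • (A v - B (T v)) = 0 := by
      rw [smul_sub, ← sub_eq_zero.1 h0, ← sub_eq_zero.1 h1, sub_self]
    exact (smul_eq_zero.1 h2).resolve_left hc
  refine ⟨fun n => (T ^ n) u, rfl, fun n => ?_⟩
  have := key n
  rw [LinearMap.mem_ker, LinearMap.sub_apply, sub_eq_zero] at this
  rw [this]
  simp only [pow_succ']
  rfl

end Chains


/-! ### Polynomial kernel vectors and their dual vectors -/

section FiniteChains

variable {K : Type*} [Field K]
variable {U V : Type*} [AddCommGroup U] [Module K U] [AddCommGroup V] [Module K V]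

/-- A polynomial kernel vector of degree at most `n` of the pencil, as the sequence of its
coefficients. -/
structure IsFinChain (A B : U →ₗ[K] V) (n : ℕ) (w : ℕ → U) : Prop where
  zero : B (w 0) = 0
  succ : ∀ i, B (w (i + 1)) = A (w i)
  eq_zero : ∀ i, n < i → w i = 0

variable {A B : U →ₗ[K] V}

/-- On the chain span, `A` has image inside that of `B`, hence a kernel at least as large, and `B`
has a nonzero kernel there. A chain ending in a nonzero vector of `ker A` can be continued by zero.
-/
theorem HasKerChains.exists_isFinChain [FiniteDimensional K U] (h : HasKerChains A B)
    (hB : ¬ Function.Injective B) : ∃ n w, IsFinChain A B n w ∧ w ≠ 0 := by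
  obtain ⟨u, hu, hu0⟩ : ∃ u, B u = 0 ∧ u ≠ 0 := by
    by_contra! hcon
    exact hB ((injective_iff_map_eq_zero B).2 hcon)
  have hle : (chainSpan A B).map A ≤ (chainSpan A B).map B := by
    rintro _ ⟨v, hv, rfl⟩
    obtain ⟨v', hv'⟩ := h.exists_eq hv
    exact ⟨v', mem_chainSpan_of_eq hv hv', hv'⟩
  have h1 := (B.domRestrict (chainSpan A B)).finrank_range_add_finrank_ker
  have h2 := (A.domRestrict (chainSpan A B)).finrank_range_add_finrank_ker
  rw [LinearMap.range_domRestrict] at h1 h2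
  have h3 := Submodule.finrank_mono hle
  have h4 : 0 < Module.finrank K (LinearMap.ker (B.domRestrict (chainSpan A B))) := by
    rw [Module.finrank_pos_iff_exists_ne_zero]
    refine ⟨⟨⟨u, mem_chainSpan_of_ker hu⟩, hu⟩, fun h0 => hu0 ?_⟩
    exact congrArg (fun z => ((z : LinearMap.ker (B.domRestrict (chainSpan A B))).1 : U)) h0
  have h5 : 0 < Module.finrank K (LinearMap.ker (A.domRestrict (chainSpan A B))) := by omega
  rw [Module.finrank_pos_iff_exists_ne_zero] at h5
  obtain ⟨⟨⟨v, hv⟩, hAv⟩, hv0⟩ := h5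
  have hAv' : A v = 0 := hAv
  have hv0' : v ≠ 0 := by
    rintro rfl
    exact hv0 rfl
  obtain ⟨n, hn⟩ := mem_chainSpan.1 hv
  obtain ⟨c, ⟨hc0, hc1⟩, hcn⟩ := mem_kerChain_iff.1 hn
  refine ⟨n, fun i => if hi : i < n + 1 then c ⟨i, hi⟩ else 0, ⟨?_, fun i => ?_, fun i hi => ?_⟩,
    fun h0 => hv0' ?_⟩
  · simpa using hc0
  · rcases lt_trichotomy i n with hi | rfl | hi
    · have h1 := hc1 ⟨i, hi⟩
      rw [dif_pos (by omega), dif_pos (by omega)]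
      exact h1
    · rw [dif_neg (by omega), dif_pos (by omega), map_zero]
      exact (hAv' ▸ congrArg A hcn).symm
    · rw [dif_neg (by omega), dif_neg (by omega), map_zero, map_zero]
  · rw [dif_neg (by omega)]
  · rw [← hcn]
    have := congrFun h0 n
    rwa [dif_pos (Nat.lt_succ_self n)] at this

/-- A polynomial kernel vector of minimal degree generates a direct summand: there are dual
vectors. -/
theorem exists_dual_of_isFinChain_minimal {n : ℕ} {w : ℕ → U} (hw : IsFinChain A B n w)
    (hw0 : w ≠ 0) (hmin : ∀ m < n, ∀ z, IsFinChain A B m z → z = 0) :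
    ∃ (x : ℕ → Module.Dual K U) (y : ℕ → Module.Dual K V),
      (∀ i < n, (∀ u, y i (A u) = x i u) ∧ ∀ u, y i (B u) = x (i + 1) u) ∧
      ∀ i ≤ n, ∀ j ≤ n, x i (w j) = if i = j then 1 else 0 := by
  classical
  -- A vanishing first coefficient would allow division by the variable, contradicting minimality of
  -- the degree.
  have hw00 : w 0 ≠ 0 := by
    intro h0
    rcases n with _ | n
    · apply hw0
      ext i
      rcases i with _ | i
      · exact h0
      · exact hw.eq_zero _ (by omega)
    · have : (fun i => w (i + 1)) = 0 := by
        refine hmin n (by omega) _ ⟨?_, fun i => hw.succ (i + 1), fun i hi => hw.eq_zero _ (by omega)⟩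
        rw [hw.succ, h0, map_zero]
      apply hw0
      ext i
      rcases i with _ | i
      · exact h0
      · exact congrFun this i
  -- A functional on pairs of sequences is a family `(x_i, y_i)`. It annihilates `Rel` when `y_i ∘ A
  -- = x_i` for `i < n` and `y_i ∘ B = x_{i+1}`, so constructing the dual vectors becomes separating
  -- one vector from `Rel`.
  let Rel : Submodule K ((ℕ → U) × (ℕ → V)) :=
    { carrier := {s | ∃ z z' : ℕ → U, (∀ i, n ≤ i → z i = 0) ∧ s.1 0 = z 0 ∧
        (∀ i, s.1 (i + 1) = z (i + 1) + z' i) ∧ ∀ i, s.2 i = - (A (z i) + B (z' i))}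
      add_mem' := by
        rintro s t ⟨z, z', h1, h2, h3, h4⟩ ⟨y, y', g1, g2, g3, g4⟩
        refine ⟨z + y, z' + y', fun i hi => ?_, ?_, fun i => ?_, fun i => ?_⟩
        · simp [h1 i hi, g1 i hi]
        · simp [h2, g2]
        · simp only [Prod.fst_add, Pi.add_apply, h3, g3]; abel
        · simp only [Prod.snd_add, Pi.add_apply, h4, g4, map_add]; abel
      zero_mem' := ⟨0, 0, by simp, by simp, by simp, by simp⟩
      smul_mem' := by
        rintro c s ⟨z, z', h1, h2, h3, h4⟩
        refine ⟨c • z, c • z', fun i hi => ?_, ?_, fun i => ?_, fun i => ?_⟩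
        · simp [h1 i hi]
        · simp [h2]
        · simp [h3]
        · simp [h4] }
  -- Membership would produce a polynomial kernel vector of degree `< n` with the nonzero first
  -- coefficient `w 0`.
  have hnot : ((Pi.single 0 (w 0), 0) : (ℕ → U) × (ℕ → V)) ∉ Rel := by
    rintro ⟨z, z', h1, h2, h3, h4⟩
    have hz0 : z 0 = w 0 := by simpa using h2.symm
    have hz' : ∀ i, z' i = - z (i + 1) := by
      intro i
      have := h3 i
      simp only [Pi.single_apply, Nat.succ_ne_zero, if_false] at this
      exact eq_neg_of_add_eq_zero_right this.symm
    have hz : IsFinChain A B (n - 1) z := by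
      refine ⟨by rw [hz0, hw.zero], fun i => ?_, fun i hi => h1 i (by omega)⟩
      have := h4 i
      rw [hz', map_neg] at this
      simp only [Pi.zero_apply] at this
      rw [eq_comm, neg_eq_zero, ← sub_eq_add_neg, sub_eq_zero] at this
      exact this.symm
    rcases Nat.eq_zero_or_pos n with rfl | hn
    · exact hw00 (hz0 ▸ h1 0 le_rfl)
    · exact hw00 (hz0 ▸ congrFun (hmin (n - 1) (by omega) z hz) 0)
  obtain ⟨φ, hφ, hker⟩ := Submodule.exists_le_ker_of_notMem hnot
  set d := φ (Pi.single 0 (w 0), 0) with hd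
  let x : ℕ → Module.Dual K U := fun i =>
    d⁻¹ • φ.comp ((LinearMap.inl K _ _).comp (LinearMap.single K (fun _ => U) i))
  let y : ℕ → Module.Dual K V := fun i =>
    d⁻¹ • φ.comp ((LinearMap.inr K _ _).comp (LinearMap.single K (fun _ => V) i))
  have hx : ∀ i u, x i u = d⁻¹ * φ (Pi.single i u, 0) := fun _ _ => rfl
  have hy : ∀ i u, y i u = d⁻¹ * φ (0, Pi.single i u) := fun _ _ => rfl
  have hxy : ∀ i < n, (∀ u, y i (A u) = x i u) ∧ ∀ u, y i (B u) = x (i + 1) u := by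
    intro i hi
    constructor
    · intro u
      have hmem : ((Pi.single i u, - Pi.single i (A u)) : (ℕ → U) × (ℕ → V)) ∈ Rel := by
        refine ⟨Pi.single i u, 0, fun j hj => ?_, rfl, fun j => by simp, fun j => ?_⟩
        · rw [Pi.single_apply, if_neg (by omega)]
        · by_cases hj : j = i
          · subst hj; simp
          · simp [hj]
      have h0 := hker hmem
      rw [LinearMap.mem_ker] at h0
      have e : ((Pi.single i u, - Pi.single i (A u)) : (ℕ → U) × (ℕ → V)) =
        (Pi.single i u, 0) - (0, Pi.single i (A u)) := by simp
      rw [e, map_sub, sub_eq_zero] at h0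
      rw [hx, hy, h0]
    · intro u
      have hmem : ((Pi.single (i + 1) u, - Pi.single i (B u)) : (ℕ → U) × (ℕ → V)) ∈ Rel := by
        refine ⟨0, Pi.single i u, fun j hj => rfl, by simp, fun j => ?_, fun j => ?_⟩
        · simp [Pi.single_apply]
        · by_cases hj : j = i
          · subst hj; simp
          · simp [hj]
      have h0 := hker hmem
      rw [LinearMap.mem_ker] at h0
      have e : ((Pi.single (i + 1) u, - Pi.single i (B u)) : (ℕ → U) × (ℕ → V)) =
        (Pi.single (i + 1) u, 0) - (0, Pi.single i (B u)) := by simp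
      rw [e, map_sub, sub_eq_zero] at h0
      rw [hx, hy, h0]
  refine ⟨x, y, hxy, ?_⟩
  -- The numbers `x i (w j)` depend only on `i - j`. The ends of the chain make them vanish off the
  -- diagonal, and dividing by `d` normalises the diagonal.
  have hstep : ∀ k i j, i + k ≤ n → x (i + k) (w (j + k)) = x i (w j) := by
    intro k
    induction k with
    | zero => intros; rfl
    | succ k ih =>
      intro i j hi
      rw [← ih i j (by omega), ← add_assoc, ← add_assoc, ← (hxy (i + k) (by omega)).2, hw.succ,
        (hxy (i + k) (by omega)).1]
  have h0 : ∀ i, 0 < i → i ≤ n → x i (w 0) = 0 := by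
    intro i hi hin
    obtain ⟨i, rfl⟩ : ∃ k, i = k + 1 := ⟨i - 1, by omega⟩
    rw [← (hxy i (by omega)).2, hw.zero, map_zero]
  have hn : ∀ i < n, x i (w n) = 0 := by
    intro i hi
    rw [← (hxy i hi).1, ← hw.succ, hw.eq_zero _ (Nat.lt_succ_self n), map_zero, map_zero]
  intro i hi j hj
  rcases lt_trichotomy i j with h | rfl | h
  · rw [if_neg (by omega), ← hn (i + (n - j)) (by omega)]
    have := hstep (n - j) i j (by omega)
    rw [← this]
    congr 2
    omega
  · have := hstep i 0 0 (by omega)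
    rw [zero_add] at this
    rw [if_pos rfl, this, hx, ← hd, inv_mul_cancel₀ hφ]
  · rw [if_neg (by omega), ← h0 (i - j) (by omega) (by omega)]
    have := hstep j (i - j) 0 (by omega)
    rw [← this]
    congr 2 <;> omega

end FiniteChains

/-! ### Sums against band matrices -/

section Bands

variable {K : Type*} [Field K] {M : Type*} [AddCommGroup M] [Module K M]

theorem sum_upperBand_row {m n : ℕ} (d s : K) (k : Fin m) (x : ℕ → M) :
    ∑ j : Fin n, upperBand m n d s k j • x j =
      (if (k : ℕ) < n then d • x k else 0) + if (k : ℕ) + 1 < n then s • x (k + 1) else 0 := by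
  have : ∀ j : Fin n, upperBand m n d s k j • x j =
      (if (j : ℕ) = k then d • x k else 0) + if (j : ℕ) = k + 1 then s • x (k + 1) else 0 := by
    intro j
    simp only [upperBand, Matrix.of_apply]
    split_ifs with h1 h2 h2
    · omega
    · simp [h1]
    · simp [h2]
    · simp
  rw [Finset.sum_congr rfl fun j _ => this j, Finset.sum_add_distrib,
    Fin.sum_univ_eq_sum_range (fun j => if j = (k : ℕ) then d • x k else 0) n,
    Fin.sum_univ_eq_sum_range (fun j => if j = (k : ℕ) + 1 then s • x (k + 1) else 0) n]
  simp

theorem sum_upperBand_col {m n : ℕ} (d s : K) (j : Fin n) (f : ℕ → M) :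
    ∑ k : Fin m, upperBand m n d s k j • f k =
      (if (j : ℕ) < m then d • f j else 0) +
        if 0 < (j : ℕ) ∧ (j : ℕ) - 1 < m then s • f (j - 1) else 0 := by
  have : ∀ k : Fin m, upperBand m n d s k j • f k =
      (if (k : ℕ) = j then d • f j else 0) +
        if (k : ℕ) = j - 1 then (if 0 < (j : ℕ) then s • f (j - 1) else 0) else 0 := by
    intro k
    rw [upperBand, Matrix.of_apply]
    by_cases h1 : (j : ℕ) = k
    · rw [if_pos h1, if_pos h1.symm, h1]
      by_cases h2 : (k : ℕ) = 0
      · rw [h2]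
        simp
      · rw [if_neg (by omega), add_zero]
    · rw [if_neg h1, if_neg (Ne.symm h1), zero_add]
      by_cases h2 : (j : ℕ) = k + 1
      · rw [if_pos h2, if_pos (by omega), if_pos (by omega), h2, Nat.add_sub_cancel]
      · rw [if_neg h2, zero_smul]
        by_cases h3 : (k : ℕ) = j - 1
        · rw [if_pos h3, if_neg (by omega)]
        · rw [if_neg h3]
  rw [Finset.sum_congr rfl fun j _ => this j, Finset.sum_add_distrib,
    Fin.sum_univ_eq_sum_range (fun k => if k = (j : ℕ) then d • f j else 0) m,
    Fin.sum_univ_eq_sum_range (fun k => if k = (j : ℕ) - 1 then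
      (if 0 < (j : ℕ) then s • f (j - 1) else 0) else 0) m]
  simp only [Finset.sum_ite_eq', Finset.mem_range]
  congr 1
  split_ifs <;> first | rfl | omega

end Bands

/-! ### Splitting a block off a pencil -/

section Splitting

variable {K : Type*} [Field K]
variable {U V : Type*} [AddCommGroup U] [Module K U] [AddCommGroup V] [Module K V]

/-- A block form of the pencil `A + μ B`, with blocks indexed by any finite type. -/
def HasBlockForm (A B : U →ₗ[K] V) : Prop :=
  ∃ (ι : Type) (_ : Fintype ι) (block : ι → Block K)
    (bU : Module.Basis (Σ i, Fin (block i).cols) K U)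
    (bV : Module.Basis (Σ i, Fin (block i).rows) K V),
    (∀ i j, A (bU ⟨i, j⟩) = ∑ k, (block i).matA k j • bV ⟨i, k⟩) ∧
    (∀ i j, B (bU ⟨i, j⟩) = ∑ k, (block i).matB k j • bV ⟨i, k⟩)

/-- Vectors and covectors exhibiting a block as a direct summand of a pencil. -/
structure SplitBlock (A B : U →ₗ[K] V) where
  block : Block K
  e : Fin block.cols → U
  x : Fin block.cols → Module.Dual K U
  f : Fin block.rows → V
  y : Fin block.rows → Module.Dual K V
  map_A : ∀ j, A (e j) = ∑ k, block.matA k j • f k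
  map_B : ∀ j, B (e j) = ∑ k, block.matB k j • f k
  comp_A : ∀ k u, y k (A u) = ∑ j, block.matA k j • x j u
  comp_B : ∀ k u, y k (B u) = ∑ j, block.matB k j • x j u
  det_x : IsUnit (Matrix.of fun i j => x i (e j)).det
  det_y : IsUnit (Matrix.of fun i j => y i (f j)).det

theorem linearIndependent_of_isUnit_det {ι : Type*} [Fintype ι] [DecidableEq ι] {e : ι → U}
    {x : ι → Module.Dual K U} (h : IsUnit (Matrix.of fun i j => x i (e j)).det) :
    LinearIndependent K e := by
  rw [Fintype.linearIndependent_iff]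
  intro c hc
  have : (Matrix.of fun i j => x i (e j)).mulVec c = 0 := by
    ext i
    have := congrArg (x i) hc
    simpa [Matrix.mulVec, dotProduct, mul_comm] using this
  exact congrFun (Matrix.eq_zero_of_mulVec_eq_zero h.ne_zero this)

/-- An invertible pairing between vectors and covectors splits the space: the inverse of its matrix
gives the coefficients of the projection to the span. -/
theorem isCompl_of_isUnit_det {ι : Type*} [Fintype ι] [DecidableEq ι] {e : ι → U}
    {x : ι → Module.Dual K U} (h : IsUnit (Matrix.of fun i j => x i (e j)).det) :
    IsCompl (Submodule.span K (Set.range e)) (LinearMap.ker (LinearMap.pi x)) := by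
  have hx : ∀ (c : ι → K), LinearMap.pi x (∑ j, c j • e j)
      = (Matrix.of fun i j => x i (e j)).mulVec c := by
    intro c
    ext i
    simp [Matrix.mulVec, dotProduct, mul_comm]
  constructor
  · rw [Submodule.disjoint_def]
    intro u hu hu'
    obtain ⟨c, rfl⟩ := (Submodule.mem_span_range_iff_exists_fun K).1 hu
    rw [LinearMap.mem_ker, hx] at hu'
    rw [Matrix.eq_zero_of_mulVec_eq_zero h.ne_zero hu']
    simp
  · rw [codisjoint_iff, eq_top_iff]
    intro u _
    rw [Submodule.mem_sup]
    let c := (Matrix.of fun i j => x i (e j))⁻¹.mulVec (LinearMap.pi x u)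
    refine ⟨∑ j, c j • e j, (Submodule.mem_span_range_iff_exists_fun K).2 ⟨c, rfl⟩,
      u - ∑ j, c j • e j, ?_, by abel⟩
    rw [LinearMap.mem_ker, map_sub, hx, Matrix.mulVec_mulVec, Matrix.mul_nonsing_inv _ h,
      Matrix.one_mulVec, sub_self]

/-- The equivalence splitting off the `none` part of a sigma type over an `Option`. -/
def sigmaOption {ι : Type*} (p : Option ι → Type*) :
    (p none ⊕ Σ i, p (some i)) ≃ Σ o, p o where
  toFun := Sum.elim (fun j => ⟨none, j⟩) fun q => ⟨some q.1, q.2⟩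
  invFun q := match q with
    | ⟨none, j⟩ => Sum.inl j
    | ⟨some i, j⟩ => Sum.inr ⟨i, j⟩
  left_inv := by rintro (j | ⟨i, j⟩) <;> rfl
  right_inv := by rintro ⟨(_ | i), j⟩ <;> rfl

namespace SplitBlock

variable {A B : U →ₗ[K] V} (S : SplitBlock A B)

/-- The complement in the source. -/
def compU : Submodule K U := LinearMap.ker (LinearMap.pi S.x)

/-- The complement in the target. -/
def compV : Submodule K V := LinearMap.ker (LinearMap.pi S.y)

theorem mem_compU {u : U} : u ∈ S.compU ↔ ∀ i, S.x i u = 0 := by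
  rw [compU, LinearMap.mem_ker, funext_iff]; rfl

theorem mem_compV {v : V} : v ∈ S.compV ↔ ∀ i, S.y i v = 0 := by
  rw [compV, LinearMap.mem_ker, funext_iff]; rfl

theorem map_A_mem : ∀ u ∈ S.compU, A u ∈ S.compV := by
  intro u hu
  rw [mem_compU] at hu
  rw [mem_compV]
  intro k
  rw [S.comp_A, Finset.sum_eq_zero fun j _ => by rw [hu, smul_zero]]

theorem map_B_mem : ∀ u ∈ S.compU, B u ∈ S.compV := by
  intro u hu
  rw [mem_compU] at hu
  rw [mem_compV]
  intro k
  rw [S.comp_B, Finset.sum_eq_zero fun j _ => by rw [hu, smul_zero]]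

/-- The restriction of `A` to the complement. -/
def restrictA : S.compU →ₗ[K] S.compV := A.restrict S.map_A_mem

/-- The restriction of `B` to the complement. -/
def restrictB : S.compU →ₗ[K] S.compV := B.restrict S.map_B_mem

theorem isComplU : IsCompl (Submodule.span K (Set.range S.e)) S.compU :=
  isCompl_of_isUnit_det S.det_x

theorem isComplV : IsCompl (Submodule.span K (Set.range S.f)) S.compV :=
  isCompl_of_isUnit_det S.det_y

theorem finrank_add_cols [FiniteDimensional K U] :
    S.block.cols + Module.finrank K S.compU = Module.finrank K U := by
  rw [← Submodule.finrank_add_eq_of_isCompl S.isComplU,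
    finrank_span_eq_card (linearIndependent_of_isUnit_det S.det_x), Fintype.card_fin]

theorem finrank_add_rows [FiniteDimensional K V] :
    S.block.rows + Module.finrank K S.compV = Module.finrank K V := by
  rw [← Submodule.finrank_add_eq_of_isCompl S.isComplV,
    finrank_span_eq_card (linearIndependent_of_isUnit_det S.det_y), Fintype.card_fin]

theorem map_span {C : U →ₗ[K] V} {M : Matrix (Fin S.block.rows) (Fin S.block.cols) K}
    (h : ∀ j, C (S.e j) = ∑ k, M k j • S.f k) :
    ∀ u ∈ Submodule.span K (Set.range S.e), C u ∈ Submodule.span K (Set.range S.f) := by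
  intro u hu
  induction hu using Submodule.span_induction with
  | mem x hx =>
    obtain ⟨j, rfl⟩ := hx
    rw [h]
    exact Submodule.sum_mem _ fun k _ => Submodule.smul_mem _ _ (Submodule.subset_span ⟨k, rfl⟩)
  | zero => simp
  | add x y _ _ hx hy => rw [map_add]; exact add_mem hx hy
  | smul c x _ hx => rw [map_smul]; exact Submodule.smul_mem _ _ hx

/-- The projection of the source to the complement. -/
def projU : U →ₗ[K] S.compU := S.compU.projectionOnto _ S.isComplU.symm

/-- The projection of the target to the complement. -/
def projV : V →ₗ[K] S.compV := S.compV.projectionOnto _ S.isComplV.symm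

theorem projV_apply {C : U →ₗ[K] V} {M : Matrix (Fin S.block.rows) (Fin S.block.cols) K}
    (h : ∀ j, C (S.e j) = ∑ k, M k j • S.f k) (h' : ∀ u ∈ S.compU, C u ∈ S.compV) (u : U) :
    S.projV (C u) = C.restrict h' (S.projU u) := by
  have hu : u ∈ Submodule.span K (Set.range S.e) ⊔ S.compU :=
    S.isComplU.sup_eq_top ▸ Submodule.mem_top
  obtain ⟨p, hp, w, hw, rfl⟩ := Submodule.mem_sup.1 hu
  rw [map_add, map_add, map_add, projU, projV,
    (Submodule.projectionOnto_apply_eq_zero_iff S.isComplU.symm).2 hp,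
    (Submodule.projectionOnto_apply_eq_zero_iff S.isComplV.symm).2 (S.map_span h p hp),
    zero_add, zero_add, Submodule.projectionOnto_apply_of_mem_left _ hw,
    Submodule.projectionOnto_apply_of_mem_left _ (h' w hw)]
  rfl

/-- The projections to the complements intertwine the pencil with its restriction, so they carry
chains to chains. This keeps the induction over blocks running. -/
theorem hasKerChains (h : HasKerChains A B) : HasKerChains S.restrictA S.restrictB := by
  intro u hu
  obtain ⟨w, h0, hw⟩ := h u (congrArg Subtype.val hu)
  refine ⟨fun n => S.projU (w n), ?_, fun n => ?_⟩
  · change S.projU (w 0) = u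
    rw [h0]
    exact Submodule.projectionOnto_apply_left _ u
  · change B.restrict S.map_B_mem _ = A.restrict S.map_A_mem _
    rw [← S.projV_apply S.map_B, ← S.projV_apply S.map_A, hw]

/-- The basis adapted to a split block. -/
def basis {W : Submodule K U} {ι : Type*} (N : Option ι → ℕ) {e : Fin (N none) → U}
    (he : LinearIndependent K e) (hc : IsCompl (Submodule.span K (Set.range e)) W)
    (b : Module.Basis (Σ i, Fin (N (some i))) K W) :
    Module.Basis (Σ o, Fin (N o)) K U :=
  (((Module.Basis.span he).prod b).map (Submodule.prodEquivOfIsCompl _ _ hc)).reindex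
    (sigmaOption fun o => Fin (N o))

theorem basis_none {W : Submodule K U} {ι : Type*} (N : Option ι → ℕ) {e : Fin (N none) → U}
    (he : LinearIndependent K e) (hc : IsCompl (Submodule.span K (Set.range e)) W)
    (b : Module.Basis (Σ i, Fin (N (some i))) K W) (j : Fin (N none)) :
    basis N he hc b ⟨none, j⟩ = e j := by
  have : (sigmaOption fun o => Fin (N o)).symm ⟨none, j⟩ = Sum.inl j := rfl
  simp [basis, this, Module.Basis.span_apply]

theorem basis_some {W : Submodule K U} {ι : Type*} (N : Option ι → ℕ) {e : Fin (N none) → U}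
    (he : LinearIndependent K e) (hc : IsCompl (Submodule.span K (Set.range e)) W)
    (b : Module.Basis (Σ i, Fin (N (some i))) K W) (i : ι) (j : Fin (N (some i))) :
    basis N he hc b ⟨some i, j⟩ = b ⟨i, j⟩ := by
  have : (sigmaOption fun o => Fin (N o)).symm ⟨some i, j⟩ = Sum.inr ⟨i, j⟩ := rfl
  simp [basis, this]

theorem exists_basis_aux {W : Submodule K U} {ι : Type*} (N : Option ι → ℕ)
    {e : Fin (N none) → U}
    (he : LinearIndependent K e) (hc : IsCompl (Submodule.span K (Set.range e)) W)
    (b : Module.Basis (Σ i, Fin (N (some i))) K W) :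
    ∃ b' : Module.Basis (Σ o : Option ι, Fin (N o)) K U,
      (∀ j : Fin (N none), b' ⟨none, j⟩ = e j) ∧
      ∀ i (j : Fin (N (some i))), b' ⟨some i, j⟩ = b ⟨i, j⟩ :=
  ⟨basis N he hc b, basis_none _ he hc b, basis_some _ he hc b⟩

theorem exists_basis {W : Submodule K U} {ι : Type*} (c : Block K → ℕ) (β : Block K)
    (block : ι → Block K) {e : Fin (c β) → U}
    (he : LinearIndependent K e) (hc : IsCompl (Submodule.span K (Set.range e)) W)
    (b : Module.Basis (Σ i, Fin (c (block i))) K W) :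
    ∃ b' : Module.Basis (Σ o : Option ι, Fin (c (o.elim β block))) K U,
      (∀ j : Fin (c β), b' ⟨none, j⟩ = e j) ∧
      ∀ i (j : Fin (c (block i))), b' ⟨some i, j⟩ = b ⟨i, j⟩ :=
  exists_basis_aux (fun o => c (o.elim β block)) (e := e) he hc b

theorem map_option {β : Block K} {ι : Type*} {block : ι → Block K} {e : Fin β.cols → U}
    {f : Fin β.rows → V} {W : Submodule K U} {W' : Submodule K V}
    {bU : Module.Basis (Σ i, Fin (block i).cols) K W}
    {bV : Module.Basis (Σ i, Fin (block i).rows) K W'}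
    {bU' : Module.Basis (Σ o : Option ι, Fin (o.elim β block).cols) K U}
    {bV' : Module.Basis (Σ o : Option ι, Fin (o.elim β block).rows) K V}
    (hUn : ∀ j : Fin β.cols, bU' ⟨none, j⟩ = e j)
    (hUs : ∀ i (j : Fin (block i).cols), bU' ⟨some i, j⟩ = bU ⟨i, j⟩)
    (hVn : ∀ j : Fin β.rows, bV' ⟨none, j⟩ = f j)
    (hVs : ∀ i (j : Fin (block i).rows), bV' ⟨some i, j⟩ = bV ⟨i, j⟩)
    {C : U →ₗ[K] V} (M : ∀ β : Block K, Matrix (Fin β.rows) (Fin β.cols) K)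
    (hn : ∀ j, C (e j) = ∑ k, M β k j • f k)
    (hs : ∀ i j, C (bU ⟨i, j⟩) = ∑ k, M (block i) k j • (bV ⟨i, k⟩ : V)) (o : Option ι)
    (j : Fin (o.elim β block).cols) :
    C (bU' ⟨o, j⟩) = ∑ k, M (o.elim β block) k j • bV' ⟨o, k⟩ := by
  rcases o with _ | i
  · have h1 : ∑ k, M β k j • bV' ⟨none, k⟩ = ∑ k, M β k j • f k :=
      Finset.sum_congr rfl fun k _ => by rw [hVn]
    exact (congrArg C (hUn j)).trans ((hn j).trans h1.symm)
  · have h1 : ∑ k, M (block i) k j • bV' ⟨some i, k⟩ = ∑ k, M (block i) k j • (bV ⟨i, k⟩ : V) :=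
      Finset.sum_congr rfl fun k _ => by rw [hVs]
    exact (congrArg C (hUs i j)).trans ((hs i j).trans h1.symm)

theorem hasBlockForm (h : HasBlockForm S.restrictA S.restrictB) : HasBlockForm A B := by
  obtain ⟨ι, hι, block, bU, bV, hA, hB⟩ := h
  obtain ⟨bU', hUn, hUs⟩ := exists_basis Block.cols S.block block
    (linearIndependent_of_isUnit_det S.det_x) S.isComplU bU
  obtain ⟨bV', hVn, hVs⟩ := exists_basis Block.rows S.block block
    (linearIndependent_of_isUnit_det S.det_y) S.isComplV bV
  refine ⟨Option ι, inferInstance, fun o => o.elim S.block block, bU', bV',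
    map_option hUn hUs hVn hVs _ S.map_A fun i j => ?_,
    map_option hUn hUs hVn hVs _ S.map_B fun i j => ?_⟩
  · have := congrArg (Submodule.subtype _) (hA i j)
    rw [map_sum] at this
    exact this
  · have := congrArg (Submodule.subtype _) (hB i j)
    rw [map_sum] at this
    exact this

end SplitBlock

variable {A B : U →ₗ[K] V}

theorem HasBlockForm.nonempty_canonicalForm (h : HasBlockForm A B) :
    Nonempty (CanonicalForm A B) := by
  classical
  obtain ⟨ι, _, block, bU, bV, hA, hB⟩ := h
  let φ := (Fintype.equivFin ι).symm
  let bU' := bU.reindex (Equiv.sigmaCongrLeft (β := fun i => Fin (block i).cols) φ).symm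
  let bV' := bV.reindex (Equiv.sigmaCongrLeft (β := fun i => Fin (block i).rows) φ).symm
  have key : ∀ (C : U →ₗ[K] V) (M : ∀ β : Block K, Matrix (Fin β.rows) (Fin β.cols) K),
      (∀ i j, C (bU ⟨i, j⟩) = ∑ k, M (block i) k j • bV ⟨i, k⟩) →
      LinearMap.toMatrix bU' bV' C = Matrix.blockDiagonal' fun i => M (block (φ i)) := by
    intro C M hC
    ext ⟨i, k⟩ ⟨i', j⟩
    have h1 : C (bU' ⟨i', j⟩) = ∑ k, M (block (φ i')) k j • bV' ⟨i', k⟩ := by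
      have e1 : bU' ⟨i', j⟩ = bU ⟨φ i', j⟩ := by simp [bU']
      have e2 : ∀ k, bV' ⟨i', k⟩ = bV ⟨φ i', k⟩ := fun k => by simp [bV']
      simp only [e1, e2, hC]
    rw [LinearMap.toMatrix_apply, h1]
    simp only [map_sum, map_smul, Module.Basis.repr_self, Finsupp.coe_finsetSum, Finsupp.coe_smul,
      Finset.sum_apply, Pi.smul_apply, smul_eq_mul, Finsupp.single_apply]
    by_cases hi : i = i'
    · subst hi
      simp [Matrix.blockDiagonal'_apply]
    · rw [Matrix.blockDiagonal'_apply_ne _ _ _ hi]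
      refine Finset.sum_eq_zero fun l _ => ?_
      rw [if_neg, mul_zero]
      intro h
      exact hi (congrArg Sigma.fst h).symm
  exact ⟨⟨_, fun i => block (φ i), bU', bV', key A _ hA, key B _ hB⟩⟩

end Splitting


/-! ### Existence of the canonical form -/

section Existence

variable {K : Type*} [Field K]
variable {U V : Type*} [AddCommGroup U] [Module K U] [AddCommGroup V] [Module K V]
variable {A B : U →ₗ[K] V}

theorem isUnit_det_of_dual {n : ℕ} {e : ℕ → U} {x : ℕ → Module.Dual K U}
    (h : ∀ i < n, ∀ j < n, x i (e j) = if i = j then 1 else 0) :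
    IsUnit (Matrix.of fun i j : Fin n => x i (e j)).det := by
  have : (Matrix.of fun i j : Fin n => x i (e j)) = 1 := by
    ext i j
    rw [Matrix.of_apply, h i i.2 j j.2, Matrix.one_apply]
    simp only [Fin.ext_iff]
  rw [this, Matrix.det_one]
  exact isUnit_one

/-- A polynomial kernel vector of minimal degree `n`, together with its dual vectors, is a
horizontal block with `n` rows. Minimality is what makes it a direct summand. -/
theorem exists_splitBlock_hor (h : ∃ n w, IsFinChain A B n w ∧ w ≠ 0) :
    Nonempty (SplitBlock A B) := by
  classical
  obtain ⟨w, hw, hw0⟩ := Nat.find_spec h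
  set n := Nat.find h with hn
  obtain ⟨x, y, hxy, hd⟩ := exists_dual_of_isFinChain_minimal hw hw0 fun m hm z hz => by
    by_contra hz0
    exact Nat.find_min h hm ⟨z, hz, hz0⟩
  have hA : A (w n) = 0 := by rw [← hw.succ, hw.eq_zero _ (Nat.lt_succ_self n), map_zero]
  refine ⟨{ block := .hor n, e := fun j => w j, x := fun j => x j, f := fun i => A (w i),
            y := fun i => y i, map_A := fun j => ?_, map_B := fun j => ?_, comp_A := fun k u => ?_,
            comp_B := fun k u => ?_, det_x := ?_, det_y := ?_ }⟩
  · refine Eq.trans ?_ (sum_upperBand_col (m := n) (n := n + 1) (1 : K) 0 j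
      fun i => A (w i)).symm
    have hj : (j : ℕ) < n + 1 := j.2
    by_cases h1 : (j : ℕ) < n
    · simp [h1]
    · have : (j : ℕ) = n := by omega
      simp [this, hA]
  · refine Eq.trans ?_ (sum_upperBand_col (m := n) (n := n + 1) (0 : K) 1 j
      fun i => A (w i)).symm
    have hj : (j : ℕ) < n + 1 := j.2
    rcases Nat.eq_zero_or_pos (j : ℕ) with h1 | h1
    · simp [h1, hw.zero]
    · obtain ⟨i, hi⟩ : ∃ i, (j : ℕ) = i + 1 := ⟨j - 1, by omega⟩
      rw [hi, hw.succ, if_pos (⟨by omega, by omega⟩ : 0 < i + 1 ∧ i + 1 - 1 < n)]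
      simp
  · refine Eq.trans ?_ (congrArg (fun φ : Module.Dual K U => φ u)
      (sum_upperBand_row (m := n) (n := n + 1) (1 : K) 0 k fun i => x i).symm) |>.trans ?_
    · have hk : (k : ℕ) < n := k.2
      simp only [if_pos (show (k : ℕ) < n + 1 by omega), if_pos (show (k : ℕ) + 1 < n + 1 by omega),
        one_smul, zero_smul, add_zero]
      exact (hxy k hk).1 u
    · simp only [LinearMap.sum_apply, LinearMap.smul_apply]
      rfl
  · refine Eq.trans ?_ (congrArg (fun φ : Module.Dual K U => φ u)
      (sum_upperBand_row (m := n) (n := n + 1) (0 : K) 1 k fun i => x i).symm) |>.trans ?_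
    · have hk : (k : ℕ) < n := k.2
      simp only [if_pos (show (k : ℕ) < n + 1 by omega), if_pos (show (k : ℕ) + 1 < n + 1 by omega),
        one_smul, zero_smul, zero_add]
      exact (hxy k hk).2 u
    · simp only [LinearMap.sum_apply, LinearMap.smul_apply]
      rfl
  · exact isUnit_det_of_dual (n := n + 1) fun i hi j hj => hd i (by omega) j (by omega)
  · refine isUnit_det_of_dual (n := n) (e := fun i => A (w i)) (x := y) fun i hi j hj => ?_
    rw [(hxy i hi).1, hd i hi.le j hj.le]

/-- The horizontal case for the dual pencil, carried back by biduality: the chain now supplies the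
covectors and its dual vectors supply the vectors. -/
theorem exists_splitBlock_vert [FiniteDimensional K U] [FiniteDimensional K V]
    (h : ∃ n w, IsFinChain A.dualMap B.dualMap n w ∧ w ≠ 0) :
    Nonempty (SplitBlock A B) := by
  classical
  obtain ⟨w, hw, hw0⟩ := Nat.find_spec h
  set n := Nat.find h with hn
  obtain ⟨X, Y, hXY, hd⟩ := exists_dual_of_isFinChain_minimal hw hw0 fun m hm z hz => by
    by_contra hz0
    exact Nat.find_min h hm ⟨z, hz, hz0⟩
  let f : ℕ → V := fun i => (Module.evalEquiv K V).symm (X i)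
  let e : ℕ → U := fun i => (Module.evalEquiv K U).symm (Y i)
  have hf : ∀ i (φ : Module.Dual K V), φ (f i) = X i φ := fun i φ =>
    Module.apply_evalEquiv_symm_apply K V φ (X i)
  have he : ∀ i (φ : Module.Dual K U), φ (e i) = Y i φ := fun i φ =>
    Module.apply_evalEquiv_symm_apply K U φ (Y i)
  have hAe : ∀ i < n, A (e i) = f i := fun i hi =>
    (Module.forall_dual_apply_eq_zero_iff K _).1 (fun φ => by
      rw [map_sub, sub_eq_zero, hf, ← (hXY i hi).1 φ, ← he]; rfl) |> sub_eq_zero.1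
  have hBe : ∀ i < n, B (e i) = f (i + 1) := fun i hi =>
    (Module.forall_dual_apply_eq_zero_iff K _).1 (fun φ => by
      rw [map_sub, sub_eq_zero, hf, ← (hXY i hi).2 φ, ← he]; rfl) |> sub_eq_zero.1
  have hA : A.dualMap (w n) = 0 := by
    rw [← hw.succ, hw.eq_zero _ (Nat.lt_succ_self n), map_zero]
  refine ⟨{ block := .vert n, e := fun j => e j, x := fun j => A.dualMap (w j), f := fun i => f i,
            y := fun i => w i, map_A := fun j => ?_, map_B := fun j => ?_, comp_A := fun k u => ?_,
            comp_B := fun k u => ?_, det_x := ?_, det_y := ?_ }⟩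
  · refine Eq.trans ?_ (sum_upperBand_row (m := n) (n := n + 1) (1 : K) 0 j f).symm
    have hj : (j : ℕ) < n := j.2
    rw [if_pos (by omega), if_pos (by omega), one_smul, zero_smul, add_zero, hAe _ hj]
  · refine Eq.trans ?_ (sum_upperBand_row (m := n) (n := n + 1) (0 : K) 1 j f).symm
    have hj : (j : ℕ) < n := j.2
    rw [if_pos (by omega), if_pos (by omega), one_smul, zero_smul, zero_add, hBe _ hj]
  · refine Eq.trans ?_ (congrArg (fun φ : Module.Dual K U => φ u)
      (sum_upperBand_col (m := n) (n := n + 1) (1 : K) 0 k fun i => A.dualMap (w i)).symm)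
        |>.trans ?_
    · have hk : (k : ℕ) < n + 1 := k.2
      by_cases h1 : (k : ℕ) < n
      · simp only [h1, if_true, one_smul, zero_smul, ite_self, add_zero]
        rfl
      · have : (k : ℕ) = n := by omega
        simp only [this, lt_irrefl, if_false, zero_smul, ite_self, add_zero]
        exact LinearMap.congr_fun hA u
    · simp only [LinearMap.sum_apply, LinearMap.smul_apply]
      rfl
  · refine Eq.trans ?_ (congrArg (fun φ : Module.Dual K U => φ u)
      (sum_upperBand_col (m := n) (n := n + 1) (0 : K) 1 k fun i => A.dualMap (w i)).symm)
        |>.trans ?_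
    · have hk : (k : ℕ) < n + 1 := k.2
      rcases Nat.eq_zero_or_pos (k : ℕ) with h1 | h1
      · simp only [h1, lt_irrefl, false_and, if_false, zero_smul, ite_self, add_zero]
        exact LinearMap.congr_fun hw.zero u
      · obtain ⟨i, hi⟩ : ∃ i, (k : ℕ) = i + 1 := ⟨k - 1, by omega⟩
        rw [hi, if_pos (⟨by omega, by omega⟩ : 0 < i + 1 ∧ i + 1 - 1 < n)]
        simp only [one_smul, zero_smul, ite_self, zero_add, Nat.add_sub_cancel]
        exact LinearMap.congr_fun (hw.succ i) u
    · simp only [LinearMap.sum_apply, LinearMap.smul_apply]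
      rfl
  · refine isUnit_det_of_dual (n := n) (e := e) (x := fun i => A.dualMap (w i)) fun i hi j hj => ?_
    rw [LinearMap.dualMap_apply, hAe _ hj, hf, hd j hj.le i hi.le]
    simp only [eq_comm]
  · refine isUnit_det_of_dual (n := n + 1) (e := f) (x := w) fun i hi j hj => ?_
    rw [hf, hd j (by omega) i (by omega)]
    simp only [eq_comm]

/-- With `B` invertible the pencil is the single operator `T = B⁻¹ A`, and a longest Jordan chain
for an eigenvalue of `T` splits off. -/
theorem exists_splitBlock_jordan [IsAlgClosed K] [FiniteDimensional K U] [Nontrivial U]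
    (hB : Function.Bijective B) : Nonempty (SplitBlock A B) := by
  classical
  let E := LinearEquiv.ofBijective B hB
  let T : Module.End K U := E.symm.toLinearMap.comp A
  have hT : ∀ u, B (T u) = A u := fun u => E.apply_symm_apply (A u)
  obtain ⟨c, hc⟩ := Module.End.exists_eigenvalue T
  let N : Module.End K U := T - c • 1
  have hN : ∀ u, A u = c • B u + B (N u) := by
    intro u
    simp [N, hT]
  have hstab : ∃ m, LinearMap.ker (N ^ m) = LinearMap.ker (N ^ (m + 1)) := by
    obtain ⟨m, -, hm⟩ := N.exists_ker_pow_eq_ker_pow_succ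
    exact ⟨m, hm⟩
  have hpos : Nat.find hstab ≠ 0 := by
    intro h0
    have := Nat.find_spec hstab
    rw [h0] at this
    obtain ⟨v, hv⟩ := hc.exists_hasEigenvector
    have hv' : v ∈ LinearMap.ker (N ^ 0) := by
      rw [this, zero_add, pow_one, LinearMap.mem_ker]
      simp [N, hv.apply_eq_smul]
    exact hv.2 (by simpa using hv')
  obtain ⟨n, hn⟩ : ∃ n, Nat.find hstab = n + 1 := ⟨Nat.find hstab - 1, by omega⟩
  have h1 : LinearMap.ker (N ^ (n + 1)) = LinearMap.ker (N ^ (n + 2)) := by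
    have := Nat.find_spec hstab
    rwa [hn] at this
  have h2 : ¬ LinearMap.ker (N ^ (n + 1)) ≤ LinearMap.ker (N ^ n) := by
    intro h
    refine Nat.find_min hstab (m := n) (by omega) (le_antisymm ?_ h)
    intro u hu
    rw [LinearMap.mem_ker] at hu ⊢
    rw [pow_succ', Module.End.mul_apply, hu, map_zero]
  obtain ⟨u, hu, hu'⟩ := Set.not_subset.1 h2
  have hu1 : (N ^ (n + 1)) u = 0 := hu
  -- Stabilisation of the kernels at `n + 1` prevents the end of a longest chain from having depth
  -- `n + 1`. A functional `φ` killing that range but not `N ^ n u` then gives the covectors `φ ∘ N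
  -- ^ i`.
  have hnot : (N ^ n) u ∉ LinearMap.range (N ^ (n + 1)) := by
    rintro ⟨v, hv⟩
    apply hu'
    have : v ∈ LinearMap.ker (N ^ (n + 2)) := by
      rw [LinearMap.mem_ker, pow_succ', Module.End.mul_apply, hv, ← Module.End.mul_apply,
        ← pow_succ', hu1]
    rw [← h1, LinearMap.mem_ker, hv] at this
    exact this
  obtain ⟨φ, hφ, hker⟩ := Submodule.exists_le_ker_of_notMem hnot
  have hφN : ∀ v, φ ((N ^ (n + 1)) v) = 0 := fun v => hker ⟨v, rfl⟩
  let e : ℕ → U := fun j => (N ^ (n - j)) u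
  let x : ℕ → Module.Dual K U := fun i => φ.comp (N ^ i)
  have hxN : ∀ i v, x i (N v) = x (i + 1) v := by
    intro i v
    simp only [x, LinearMap.comp_apply, pow_succ, Module.End.mul_apply]
  have hxn : x (n + 1) = 0 := LinearMap.ext hφN
  have hsolve : ∀ v, x n (N v) = 0 := fun v => by rw [hxN, hxn]; rfl
  -- The pairing is `φ (N ^ (n + i - j) u)`: it vanishes for `i > j` and equals `φ (N ^ n u) ≠ 0`
  -- for `i = j`.
  have hdet : IsUnit (Matrix.of fun i j : Fin (n + 1) => x i (e j)).det := by
    rw [Matrix.det_of_isUpperTriangular]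
    · refine (Finset.prod_ne_zero_iff.2 fun i _ => ?_).isUnit
      have hi : (i : ℕ) < n + 1 := i.2
      rw [Matrix.of_apply]
      simp only [x, e, LinearMap.comp_apply, ← Module.End.mul_apply, ← pow_add]
      rwa [show (i : ℕ) + (n - i) = n by omega]
    · intro i j hij
      have hi : (i : ℕ) < n + 1 := i.2
      have hij' : (j : ℕ) < i := hij
      rw [Matrix.of_apply]
      simp only [x, e, LinearMap.comp_apply, ← Module.End.mul_apply, ← pow_add]
      rw [show (i : ℕ) + (n - j) = (i - j - 1) + (n + 1) by omega, pow_add, Module.End.mul_apply,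
        hu1, map_zero, map_zero]
  refine ⟨{ block := .jordan (some c) n, e := fun j => e j, x := fun j => x j,
            f := fun i => B (e i), y := fun i => (x i).comp E.symm.toLinearMap,
            map_A := fun j => ?_, map_B := fun j => ?_, comp_A := fun k v => ?_,
            comp_B := fun k v => ?_, det_x := ?_, det_y := ?_ }⟩
  · refine Eq.trans ?_ (sum_upperBand_col (m := n + 1) (n := n + 1) c 1 j fun i => B (e i)).symm
    have hj : (j : ℕ) < n + 1 := j.2
    rw [if_pos hj, hN]
    congr 1
    rcases Nat.eq_zero_or_pos (j : ℕ) with h1 | h1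
    · rw [if_neg (by omega), h1]
      have : N (e 0) = 0 := by
        simp only [e, Nat.sub_zero]
        rw [← Module.End.mul_apply, ← pow_succ', hu1]
      rw [this, map_zero]
    · rw [if_pos ⟨h1, by omega⟩, one_smul]
      congr 1
      simp only [e]
      rw [← Module.End.mul_apply, ← pow_succ']
      congr 2
      omega
  · refine Eq.trans ?_ (sum_upperBand_col (m := n + 1) (n := n + 1) (1 : K) 0 j
      fun i => B (e i)).symm
    have hj : (j : ℕ) < n + 1 := j.2
    rw [if_pos hj]
    simp
  · refine Eq.trans ?_ (congrArg (fun φ : Module.Dual K U => φ v)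
      (sum_upperBand_row (m := n + 1) (n := n + 1) c 1 k fun i => x i).symm) |>.trans ?_
    · have hk : (k : ℕ) < n + 1 := k.2
      have e1 : E.symm (A v) = c • v + N v := by
        rw [LinearEquiv.symm_apply_eq, map_add, map_smul]
        exact hN v
      simp only [LinearMap.comp_apply, LinearEquiv.coe_coe, e1, map_add, map_smul, if_pos hk,
        LinearMap.add_apply, LinearMap.smul_apply]
      congr 1
      by_cases h1 : (k : ℕ) + 1 < n + 1
      · rw [if_pos h1, one_smul, hxN]
      · rw [if_neg h1, show (k : ℕ) = n by omega, hsolve]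
        rfl
    · simp only [LinearMap.sum_apply, LinearMap.smul_apply]
      rfl
  · refine Eq.trans ?_ (congrArg (fun φ : Module.Dual K U => φ v)
      (sum_upperBand_row (m := n + 1) (n := n + 1) (1 : K) 0 k fun i => x i).symm) |>.trans ?_
    · have hk : (k : ℕ) < n + 1 := k.2
      have e1 : E.symm (B v) = v := E.symm_apply_apply v
      simp only [LinearMap.comp_apply, LinearEquiv.coe_coe, e1, if_pos hk, one_smul, zero_smul,
        ite_self, add_zero]
    · simp only [LinearMap.sum_apply, LinearMap.smul_apply]
      rfl
  · exact hdet
  · have : (Matrix.of fun i j : Fin (n + 1) => ((x i).comp E.symm.toLinearMap) (B (e j))) =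
        Matrix.of fun i j : Fin (n + 1) => x i (e j) := by
      ext i j
      exact congrArg (x i) (E.symm_apply_apply (e j))
    exact this ▸ hdet

/-- If the pencil has no polynomial kernel vectors, kernel chains force `B` to be injective. Then
`B^*` is surjective, so the dual pencil has kernel chains automatically, and without polynomial
kernel vectors `B^*` is injective too. What remains is the Jordan case with `B` bijective. -/
theorem HasKerChains.nonempty_splitBlock [IsAlgClosed K] [FiniteDimensional K U]
    [FiniteDimensional K V] (h : HasKerChains A B)
    (hd : 0 < Module.finrank K U + Module.finrank K V) : Nonempty (SplitBlock A B) := by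
  by_cases h1 : ∃ n w, IsFinChain A B n w ∧ w ≠ 0
  · exact exists_splitBlock_hor h1
  by_cases h2 : ∃ n w, IsFinChain A.dualMap B.dualMap n w ∧ w ≠ 0
  · exact exists_splitBlock_vert h2
  have hinj : Function.Injective B := by
    by_contra hB
    exact h1 (h.exists_isFinChain hB)
  have hsurj : Function.Surjective B := by
    by_contra hB
    refine h2 (HasKerChains.exists_isFinChain (hasKerChains_of_surjective ?_) ?_)
    · exact LinearMap.dualMap_surjective_iff.2 hinj
    · rwa [LinearMap.dualMap_injective_iff]
  have he := (LinearEquiv.ofBijective B ⟨hinj, hsurj⟩).finrank_eq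
  have : Nontrivial U := Module.finrank_pos_iff.1 (by omega : 0 < Module.finrank K U)
  exact exists_splitBlock_jordan ⟨hinj, hsurj⟩

omit [Field K] in
theorem Block.rows_add_cols_pos (β : Block K) : 0 < β.rows + β.cols := by
  cases β <;> simp [Block.rows, Block.cols]

theorem HasKerChains.hasBlockForm [IsAlgClosed K] [FiniteDimensional K U]
    [FiniteDimensional K V] (h : HasKerChains A B) : HasBlockForm A B := by
  obtain ⟨d, hd⟩ : ∃ d, Module.finrank K U + Module.finrank K V = d := ⟨_, rfl⟩
  induction d using Nat.strong_induction_on generalizing U V with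
  | _ d ih =>
    rcases Nat.eq_zero_or_pos d with rfl | hpos
    · have hU : Subsingleton U := Module.finrank_zero_iff.1 (by omega : Module.finrank K U = 0)
      have hV : Subsingleton V := Module.finrank_zero_iff.1 (by omega : Module.finrank K V = 0)
      exact ⟨Empty, inferInstance, Empty.elim, Module.Basis.empty U, Module.Basis.empty V,
        fun i => i.elim, fun i => i.elim⟩
    · obtain ⟨S⟩ := h.nonempty_splitBlock (by omega)
      refine S.hasBlockForm (ih _ ?_ (S.hasKerChains h) rfl)
      have h1 := S.finrank_add_cols
      have h2 := S.finrank_add_rows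
      have h3 := S.block.rows_add_cols_pos
      omega

/-- Kronecker's theorem for pencils in which `∞` is not an eigenvalue. -/
theorem HasKerChains.nonempty_canonicalForm [IsAlgClosed K] [FiniteDimensional K U]
    [FiniteDimensional K V] (h : HasKerChains A B) : Nonempty (CanonicalForm A B) :=
  h.hasBlockForm.nonempty_canonicalForm

end Existence


/-! ### Reading the chain spans off a canonical form -/

section Invariants

variable {K : Type*} [Field K]

/-- The number of columns of a horizontal block, and `0` for other blocks. -/
def Block.horSize : Block K → ℕ
  | .hor ε => ε + 1
  | _ => 0

/-- The number of rows of a vertical block, and `0` for other blocks. -/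
def Block.vertSize : Block K → ℕ
  | .vert η => η + 1
  | _ => 0

/-- The size of a Jordan block, and `0` for other blocks. -/
def Block.jordanDim : Block K → ℕ
  | .jordan _ n => n + 1
  | _ => 0

/-- The rank of a block at a generic point. -/
def Block.core : Block K → ℕ
  | .jordan _ n => n + 1
  | .hor ε => ε
  | .vert η => η

/-- The block is horizontal. -/
def Block.IsHor : Block K → Prop
  | .hor _ => True
  | _ => False

/-- The block is vertical. -/
def Block.IsVert : Block K → Prop
  | .vert _ => True
  | _ => False

/-- The block is a Jordan block with eigenvalue `∞`. -/
def Block.IsInfinite : Block K → Prop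
  | .jordan none _ => True
  | _ => False

theorem upperBand_one_zero (n : ℕ) : upperBand n n (1 : K) 0 = 1 := by
  ext i j
  rw [upperBand, Matrix.of_apply, Matrix.one_apply]
  simp only [ite_self, Fin.ext_iff, eq_comm]

theorem vecMul_upperBand_eq_zero {n : ℕ} {ξ : Fin n → K}
    (h : Matrix.vecMul ξ (upperBand n (n + 1) 0 1) = 0) : ξ = 0 := by
  ext j
  have := congrFun h j.succ
  rw [Matrix.vecMul, dotProduct, Finset.sum_eq_single_of_mem j (Finset.mem_univ _)] at this
  · simpa [upperBand] using this
  · intro l _ hl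
    have : (j : ℕ) + 1 ≠ l + 1 := fun h => hl (Fin.ext (by omega))
    rw [upperBand, Matrix.of_apply, Fin.val_succ, if_neg this, ite_self, mul_zero]

theorem Block.matB_mulVec_eq_zero {β : Block K} (h1 : ¬ β.IsHor) (h2 : ¬ β.IsInfinite)
    {ξ : Fin β.cols → K} (h : β.matB.mulVec ξ = 0) : ξ = 0 := by
  rcases β with ⟨(_ | e), n⟩ | ε | η
  · exact absurd trivial h2
  · have h' : (upperBand (n + 1) (n + 1) (1 : K) 0).mulVec ξ = 0 := h
    rw [upperBand_one_zero] at h'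
    exact (Matrix.one_mulVec ξ).symm.trans h'
  · exact absurd trivial h1
  · exact vecMul_upperBand_eq_zero
      ((Matrix.mulVec_transpose (upperBand η (η + 1) (0 : K) 1) ξ).symm.trans h)

theorem Block.vecMul_matB_eq_zero {β : Block K} (h1 : ¬ β.IsVert) (h2 : ¬ β.IsInfinite)
    {ξ : Fin β.rows → K} (h : Matrix.vecMul ξ β.matB = 0) : ξ = 0 := by
  rcases β with ⟨(_ | e), n⟩ | ε | η
  · exact absurd trivial h2
  · have h' : Matrix.vecMul ξ (upperBand (n + 1) (n + 1) (1 : K) 0) = 0 := h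
    rw [upperBand_one_zero] at h'
    exact (Matrix.vecMul_one ξ).symm.trans h'
  · exact vecMul_upperBand_eq_zero h
  · exact absurd trivial h1

variable {U V : Type*} [AddCommGroup U] [Module K U] [AddCommGroup V] [Module K V]
variable {A B : U →ₗ[K] V}

theorem mem_chainSpan_of_upperBand {n : ℕ} {e : Fin (n + 1) → U} {f : Fin n → V}
    (hA : ∀ j, A (e j) = ∑ k, upperBand n (n + 1) (1 : K) 0 k j • f k)
    (hB : ∀ j, B (e j) = ∑ k, upperBand n (n + 1) (0 : K) 1 k j • f k) (j : Fin (n + 1)) :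
    e j ∈ chainSpan A B := by
  have hA' : ∀ j : Fin n, A (e j.castSucc) = f j := by
    intro j
    rw [hA, Finset.sum_eq_single_of_mem j (Finset.mem_univ _)]
    · simp [upperBand]
    · intro k _ hk
      have : (j : ℕ) ≠ k := fun h => hk (Fin.ext h.symm)
      rw [upperBand, Matrix.of_apply, Fin.val_castSucc, if_neg this, ite_self, zero_smul]
  have hB' : ∀ j : Fin n, B (e j.succ) = f j := by
    intro j
    rw [hB, Finset.sum_eq_single_of_mem j (Finset.mem_univ _)]
    · simp [upperBand]
    · intro k _ hk
      have : (j : ℕ) + 1 ≠ k + 1 := fun h => hk (Fin.ext (by omega))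
      rw [upperBand, Matrix.of_apply, Fin.val_succ, if_neg this, ite_self, zero_smul]
  have hB0 : B (e 0) = 0 := by
    rw [hB]
    exact Finset.sum_eq_zero fun k _ => by simp [upperBand]
  induction j using Fin.induction with
  | zero => exact mem_chainSpan_of_ker hB0
  | succ j ih => exact mem_chainSpan_of_eq ih ((hB' j).trans (hA' j).symm)

theorem mem_chainSpan_of_isHor {β : Block K} (hβ : β.IsHor) {e : Fin β.cols → U}
    {f : Fin β.rows → V} (hA : ∀ j, A (e j) = ∑ k, β.matA k j • f k)
    (hB : ∀ j, B (e j) = ∑ k, β.matB k j • f k) (j : Fin β.cols) : e j ∈ chainSpan A B := by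
  rcases β with ⟨_, n⟩ | ε | η
  · exact hβ.elim
  · exact mem_chainSpan_of_upperBand hA hB j
  · exact hβ.elim

theorem mem_chainSpan_of_isVert {β : Block K} (hβ : β.IsVert) {x : Fin β.cols → Module.Dual K U}
    {y : Fin β.rows → Module.Dual K V} (hA : ∀ k, A.dualMap (y k) = ∑ j, β.matA k j • x j)
    (hB : ∀ k, B.dualMap (y k) = ∑ j, β.matB k j • x j) (k : Fin β.rows) :
    y k ∈ chainSpan A.dualMap B.dualMap := by
  rcases β with ⟨_, n⟩ | ε | η
  · exact hβ.elim
  · exact hβ.elim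
  · refine mem_chainSpan_of_isHor (β := .hor η) trivial (e := y) (f := x) ?_ ?_ k
    · exact hA
    · exact hB

/-- In a block at infinity `A` is the identity and `B` a nilpotent shift. The chain starting at the
first basis vector has `k`-th coordinate `1` at step `k`, and after the last coordinate there is
nothing left to solve with. -/
theorem HasKerChains.false_of_upperBand (h : HasKerChains A B) {n : ℕ} {e : Fin (n + 1) → U}
    {f : Fin (n + 1) → V} {x : Fin (n + 1) → Module.Dual K U}
    {y : Fin (n + 1) → Module.Dual K V} (hx : ∀ i, x i (e i) = 1)
    (heB : ∀ j, B (e j) = ∑ k, upperBand (n + 1) (n + 1) (0 : K) 1 k j • f k)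
    (hA : ∀ k u, y k (A u) = ∑ j, upperBand (n + 1) (n + 1) (1 : K) 0 k j * x j u)
    (hB : ∀ k u, y k (B u) = ∑ j, upperBand (n + 1) (n + 1) (0 : K) 1 k j * x j u) : False := by
  have hA' : ∀ k u, y k (A u) = x k u := by
    intro k u
    rw [hA, upperBand_one_zero]
    simp [Matrix.one_apply]
  have hB' : ∀ (k : Fin n) u, y k.castSucc (B u) = x k.succ u := by
    intro k u
    rw [hB, Finset.sum_eq_single_of_mem k.succ (Finset.mem_univ _)]
    · simp [upperBand]
    · intro j _ hj
      have : (j : ℕ) ≠ k + 1 := fun h => hj (Fin.ext h)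
      rw [upperBand, Matrix.of_apply, Fin.val_castSucc, if_neg this, ite_self, zero_mul]
  have hBn : ∀ u, y (Fin.last n) (B u) = 0 := by
    intro u
    rw [hB]
    refine Finset.sum_eq_zero fun j _ => ?_
    have : (j : ℕ) ≠ n + 1 := by omega
    rw [upperBand, Matrix.of_apply, Fin.val_last, if_neg this, ite_self, zero_mul]
  have hB0 : B (e 0) = 0 := by
    rw [heB]
    exact Finset.sum_eq_zero fun k _ => by simp [upperBand]
  obtain ⟨w, h0, hw⟩ := h _ hB0
  have hk : ∀ k : Fin (n + 1), x k (w k) = 1 := by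
    intro k
    induction k using Fin.induction with
    | zero => rw [Fin.val_zero, h0, hx]
    | succ k ih => rw [← hB', Fin.val_succ, hw, hA']; exact ih
  have h1 := hBn (w (n + 1))
  rw [hw, hA'] at h1
  exact one_ne_zero ((hk (Fin.last n)).symm.trans h1)

theorem HasKerChains.not_isInfinite (h : HasKerChains A B) {β : Block K} {e : Fin β.cols → U}
    {f : Fin β.rows → V} {x : Fin β.cols → Module.Dual K U}
    {y : Fin β.rows → Module.Dual K V} (hx : ∀ i, x i (e i) = 1)
    (heB : ∀ j, B (e j) = ∑ k, β.matB k j • f k)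
    (hA : ∀ k u, y k (A u) = ∑ j, β.matA k j * x j u)
    (hB : ∀ k u, y k (B u) = ∑ j, β.matB k j * x j u) : ¬ β.IsInfinite := by
  rcases β with ⟨(_ | c), n⟩ | ε | η
  · exact fun _ => h.false_of_upperBand hx heB hA hB
  all_goals exact fun h => h

theorem finrank_span_image_basis {κ : Type*} [Finite κ] (b : Module.Basis κ K U) (s : Set κ) :
    Module.finrank K (Submodule.span K (b '' s)) = Nat.card s := by
  have := Fintype.ofFinite s
  rw [Set.image_eq_range, Nat.card_eq_fintype_card]
  exact finrank_span_eq_card (b.linearIndependent.comp _ Subtype.val_injective)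

theorem card_sigma_fin {m : ℕ} (N : Fin m → ℕ) (P : Fin m → Prop) [DecidablePred P] :
    Nat.card {p : Σ i, Fin (N i) | P p.1} = ∑ i, if P i then N i else 0 := by
  classical
  have : Nat.card {p : Σ i, Fin (N i) | P p.1} = Fintype.card {p : Σ i, Fin (N i) // P p.1} :=
    Nat.card_eq_fintype_card
  rw [this, Fintype.card_subtype, Finset.card_filter, Fintype.sum_sigma]
  refine Finset.sum_congr rfl fun i _ => ?_
  split_ifs <;> simp

theorem sum_map_filterMap {α : Type*} (s : Multiset α) (p : α → Option ℕ) (g : ℕ → ℕ) :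
    ((s.filterMap p).map g).sum = (s.map fun a => (p a).elim 0 g).sum := by
  induction s using Multiset.induction_on with
  | empty => simp
  | cons a s ih =>
    rw [Multiset.map_cons, Multiset.sum_cons, ← ih]
    rcases h : p a with _ | n
    · rw [Multiset.filterMap_cons_none _ _ h]
      simp
    · rw [Multiset.filterMap_cons_some _ _ _ h]
      simp

namespace CanonicalForm

variable (F : CanonicalForm A B)

/-- The total size of the horizontal blocks in the source. -/
def kHor : ℕ := (F.colIndices.map fun ε => ε + 1).sum

theorem kVert_eq_sum : F.kVert = ∑ i, (F.block i).vertSize := by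
  rw [kVert, rowIndices, sum_map_filterMap]
  refine congrArg Multiset.sum (Multiset.map_congr rfl fun i _ => ?_)
  rcases F.block i with _ | _ | _ <;> rfl

theorem kHor_eq_sum : F.kHor = ∑ i, (F.block i).horSize := by
  rw [kHor, colIndices, sum_map_filterMap]
  refine congrArg Multiset.sum (Multiset.map_congr rfl fun i _ => ?_)
  rcases F.block i with _ | _ | _ <;> rfl

theorem map_eq {C : U →ₗ[K] V} {M : ∀ i, Matrix (Fin (F.block i).rows) (Fin (F.block i).cols) K}
    (h : LinearMap.toMatrix F.basisU F.basisV C = Matrix.blockDiagonal' M) (i : Fin F.num)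
    (j : Fin (F.block i).cols) :
    C (F.basisU ⟨i, j⟩) = ∑ k, M i k j • F.basisV ⟨i, k⟩ := by
  rw [← F.basisV.sum_repr (C (F.basisU ⟨i, j⟩)), Fintype.sum_sigma,
    Finset.sum_eq_single_of_mem i (Finset.mem_univ _)]
  · refine Finset.sum_congr rfl fun k _ => ?_
    rw [← LinearMap.toMatrix_apply, h, Matrix.blockDiagonal'_apply_eq]
  · intro i' _ hi
    refine Finset.sum_eq_zero fun k _ => ?_
    rw [← LinearMap.toMatrix_apply, h, Matrix.blockDiagonal'_apply_ne _ _ _ hi, zero_smul]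

theorem repr_map_eq {C : U →ₗ[K] V}
    {M : ∀ i, Matrix (Fin (F.block i).rows) (Fin (F.block i).cols) K}
    (h : LinearMap.toMatrix F.basisU F.basisV C = Matrix.blockDiagonal' M) (i : Fin F.num)
    (k : Fin (F.block i).rows) (u : U) :
    F.basisV.repr (C u) ⟨i, k⟩ = ∑ j, M i k j * F.basisU.repr u ⟨i, j⟩ := by
  rw [← LinearMap.toMatrix_mulVec_repr F.basisU F.basisV, h, Matrix.mulVec, dotProduct,
    Fintype.sum_sigma, Finset.sum_eq_single_of_mem i (Finset.mem_univ _)]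
  · refine Finset.sum_congr rfl fun k _ => ?_
    rw [Matrix.blockDiagonal'_apply_eq]
  · intro i' _ hi
    refine Finset.sum_eq_zero fun k _ => ?_
    rw [Matrix.blockDiagonal'_apply_ne _ _ _ hi.symm, zero_mul]

theorem not_isInfinite (h : HasKerChains A B) (i : Fin F.num) : ¬ (F.block i).IsInfinite :=
  h.not_isInfinite (e := fun j => F.basisU ⟨i, j⟩) (f := fun k => F.basisV ⟨i, k⟩)
    (x := fun j => F.basisU.coord ⟨i, j⟩) (y := fun k => F.basisV.coord ⟨i, k⟩)
    (fun j => by simp) (F.map_eq F.matB_eq i) (F.repr_map_eq F.matA_eq i)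
    (F.repr_map_eq F.matB_eq i)

/-- On vertical and finite Jordan blocks the `B` part is injective, so chains starting in `ker B`
have no component there. A horizontal block is itself one chain. -/
theorem chainSpan_eq (h : ∀ i, ¬ (F.block i).IsInfinite) :
    chainSpan A B = Submodule.span K (F.basisU '' {p | (F.block p.1).IsHor}) := by
  have hmem : ∀ u, u ∈ Submodule.span K (F.basisU '' {p | (F.block p.1).IsHor}) ↔
      ∀ i, ¬ (F.block i).IsHor → ∀ j, F.basisU.repr u ⟨i, j⟩ = 0 := by
    intro u
    rw [Module.Basis.mem_span_image]
    constructor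
    · intro hs i hi j
      by_contra h0
      exact hi (hs (Finsupp.mem_support_iff.2 h0))
    · rintro hs ⟨i, j⟩ hp
      by_contra hi
      exact Finsupp.mem_support_iff.1 hp (hs i hi j)
  apply le_antisymm
  · have key : ∀ u v, (∀ i, ¬ (F.block i).IsHor → ∀ j, F.basisU.repr v ⟨i, j⟩ = 0) → B u = A v →
        ∀ i, ¬ (F.block i).IsHor → ∀ j, F.basisU.repr u ⟨i, j⟩ = 0 := by
      intro u v hv huv i hi
      refine congrFun (Block.matB_mulVec_eq_zero hi (h i) (ξ := fun j => F.basisU.repr u ⟨i, j⟩) ?_)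
      ext k
      refine (F.repr_map_eq F.matB_eq i k u).symm.trans ?_
      rw [huv, F.repr_map_eq F.matA_eq]
      exact Finset.sum_eq_zero fun j _ => by rw [hv i hi, mul_zero]
    refine chainSpan_le (fun u hu => (hmem u).2 (key u 0 (by simp) (by simp [hu])))
      fun u v hv huv => (hmem u).2 (key u v ((hmem v).1 hv) huv)
  · rw [Submodule.span_le]
    rintro _ ⟨⟨i, j⟩, hi, rfl⟩
    exact mem_chainSpan_of_isHor hi (e := fun j => F.basisU ⟨i, j⟩) (F.map_eq F.matA_eq i)
      (F.map_eq F.matB_eq i) j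

theorem finrank_chainSpan (h : ∀ i, ¬ (F.block i).IsInfinite) :
    Module.finrank K (chainSpan A B) = F.kHor := by
  classical
  rw [F.chainSpan_eq h, finrank_span_image_basis, card_sigma_fin (fun i => (F.block i).cols)
    (fun i => (F.block i).IsHor), kHor_eq_sum]
  refine Finset.sum_congr rfl fun i _ => ?_
  rcases F.block i with _ | _ | _ <;> simp [Block.IsHor, Block.horSize, Block.cols]

/-- Transposition exchanges horizontal and vertical blocks, so this is the mirror image of
`chainSpan_eq`. -/
theorem chainSpan_dualMap_eq (h : ∀ i, ¬ (F.block i).IsInfinite) :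
    chainSpan A.dualMap B.dualMap =
      Submodule.span K (F.basisV.dualBasis '' {p | (F.block p.1).IsVert}) := by
  have hmem : ∀ φ, φ ∈ Submodule.span K (F.basisV.dualBasis '' {p | (F.block p.1).IsVert}) ↔
      ∀ i, ¬ (F.block i).IsVert → ∀ k, φ (F.basisV ⟨i, k⟩) = 0 := by
    intro φ
    rw [Module.Basis.mem_span_image]
    constructor
    · intro hs i hi j
      by_contra h0
      exact hi (hs (Finsupp.mem_support_iff.2
        (by rwa [Module.Basis.dualBasis_repr] : F.basisV.dualBasis.repr φ ⟨i, j⟩ ≠ 0)))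
    · rintro hs ⟨i, j⟩ hp
      by_contra hi
      refine Finsupp.mem_support_iff.1 hp ?_
      rw [Module.Basis.dualBasis_repr]
      exact hs i hi j
  apply le_antisymm
  · have key : ∀ φ ψ : Module.Dual K V,
        (∀ i, ¬ (F.block i).IsVert → ∀ j, ψ (F.basisV ⟨i, j⟩) = 0) →
        B.dualMap φ = A.dualMap ψ →
        ∀ i, ¬ (F.block i).IsVert → ∀ j, φ (F.basisV ⟨i, j⟩) = 0 := by
      intro φ ψ hψ hφψ i hi
      refine congrFun (Block.vecMul_matB_eq_zero hi (h i) (ξ := fun j => φ (F.basisV ⟨i, j⟩)) ?_)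
      ext j
      have h1 : φ (B (F.basisU ⟨i, j⟩)) = ψ (A (F.basisU ⟨i, j⟩)) :=
        LinearMap.congr_fun hφψ _
      rw [F.map_eq F.matA_eq, F.map_eq F.matB_eq, map_sum, map_sum] at h1
      simp only [map_smul, hψ i hi, smul_eq_mul, mul_zero,
        Finset.sum_const_zero] at h1
      simpa [Matrix.vecMul, dotProduct, mul_comm] using h1
    refine chainSpan_le (fun u hu => (hmem u).2 (key u 0 (by simp) (by simp [hu])))
      fun u v hv huv => (hmem u).2 (key u v ((hmem v).1 hv) huv)
  · rw [Submodule.span_le]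
    rintro _ ⟨⟨i, k⟩, hi, rfl⟩
    have key : ∀ (C : U →ₗ[K] V)
        (M : ∀ i, Matrix (Fin (F.block i).rows) (Fin (F.block i).cols) K),
        LinearMap.toMatrix F.basisU F.basisV C = Matrix.blockDiagonal' M →
        ∀ k, C.dualMap (F.basisV.dualBasis ⟨i, k⟩) = ∑ j, M i k j • F.basisU.coord ⟨i, j⟩ := by
      intro C M hC k
      ext u
      rw [LinearMap.dualMap_apply, Module.Basis.coe_dualBasis, Module.Basis.coord_apply,
        F.repr_map_eq hC]
      simp
    exact mem_chainSpan_of_isVert hi (y := fun k => F.basisV.dualBasis ⟨i, k⟩)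
      (x := fun j => F.basisU.coord ⟨i, j⟩) (key A _ F.matA_eq) (key B _ F.matB_eq) k

theorem finrank_chainSpan_dualMap (h : ∀ i, ¬ (F.block i).IsInfinite) :
    Module.finrank K (chainSpan A.dualMap B.dualMap) = F.kVert := by
  classical
  rw [F.chainSpan_dualMap_eq h, finrank_span_image_basis, card_sigma_fin (fun i => (F.block i).rows)
    (fun i => (F.block i).IsVert), kVert_eq_sum]
  refine Finset.sum_congr rfl fun i _ => ?_
  rcases F.block i with _ | _ | _ <;> simp [Block.IsVert, Block.vertSize, Block.rows]

/-- Blockwise, rows plus columns. The identity turns a statement about the degree of the common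
divisor of the minors into one about the two Kronecker indices. -/
theorem sum_jordanDim_add :
    ∑ i, (F.block i).jordanDim + F.kVert + F.kHor + ∑ i, (F.block i).core =
      Module.finrank K U + Module.finrank K V := by
  rw [kVert_eq_sum, kHor_eq_sum, Module.finrank_eq_card_basis F.basisU,
    Module.finrank_eq_card_basis F.basisV, Fintype.card_sigma, Fintype.card_sigma,
    ← Finset.sum_add_distrib, ← Finset.sum_add_distrib, ← Finset.sum_add_distrib,
    ← Finset.sum_add_distrib]
  refine Finset.sum_congr rfl fun i _ => ?_
  rw [Fintype.card_fin, Fintype.card_fin]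
  rcases F.block i with _ | _ | _ <;>
    simp only [Block.jordanDim, Block.vertSize, Block.horSize, Block.core, Block.rows,
      Block.cols] <;> omega

end CanonicalForm

/-- Every canonical form gives the same value, the intrinsic dimension of the dual chain span, and a
form exists. So the `sInf` is over a singleton and is not the default `0` of the empty set. -/
theorem kVert_eq_finrank_chainSpan [IsAlgClosed K] [FiniteDimensional K U] [FiniteDimensional K V]
    (h : HasKerChains A B) : kVert A B = Module.finrank K (chainSpan A.dualMap B.dualMap) := by
  have : {k | ∃ F : CanonicalForm A B, F.kVert = k} =
      {Module.finrank K (chainSpan A.dualMap B.dualMap)} := by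
    ext k
    constructor
    · rintro ⟨F, rfl⟩
      exact (F.finrank_chainSpan_dualMap (F.not_isInfinite h)).symm
    · rintro rfl
      obtain ⟨F⟩ := h.nonempty_canonicalForm
      exact ⟨F, (F.finrank_chainSpan_dualMap (F.not_isInfinite h)).symm⟩
  rw [kVert, this, csInf_singleton]

end Invariants


/-! ### Maximal minors of a pencil and their greatest common divisor -/

section Minors

open Polynomial

variable {K : Type*} [Field K]

theorem det_blockDiagonal' {R : Type*} [CommRing R] {m : ℕ} {n : Fin m → Type*}
    [∀ i, Fintype (n i)] [∀ i, DecidableEq (n i)] (M : ∀ i, Matrix (n i) (n i) R) :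
    (Matrix.blockDiagonal' M).det = ∏ i, (M i).det := by
  rw [(Matrix.blockTriangular_blockDiagonal' M).det_fintype]
  refine Finset.prod_congr rfl fun i _ => ?_
  rw [← Matrix.det_submatrix_equiv_self (Equiv.sigmaSubtype i).symm]
  congr 1
  ext j k
  simp [Matrix.toSquareBlock_def, Equiv.sigmaSubtype]

theorem det_mul_mem_of_rows {R : Type*} [CommRing R] {q m : Type*} [Fintype q] [DecidableEq q]
    [Fintype m] [DecidableEq m] (P : Matrix q m R) (M : Matrix m q R) (I : Ideal R)
    (h : ∀ f : q → m, (M.submatrix f id).det ∈ I) : (P * M).det ∈ I := by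
  have h1 : P * M = Matrix.of fun i => ∑ k, P i k • M k := by
    ext i j
    simp [Matrix.mul_apply]
  have h2 : (P * M).det = Matrix.detRowAlternating fun i => ∑ k, P i k • M k := by
    rw [h1]; rfl
  rw [h2]
  change (Matrix.detRowAlternating (n := q) (R := R)).toMultilinearMap _ ∈ I
  rw [MultilinearMap.map_sum]
  refine Ideal.sum_mem _ fun f _ => ?_
  rw [MultilinearMap.map_smul_univ]
  exact Ideal.mul_mem_left _ _ (h f)

/-- The determinant of a product lies in the ideal of minors of the middle factor. -/
theorem det_mul_mem {R : Type*} [CommRing R] {q m n : Type*} [Fintype q] [DecidableEq q]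
    [Fintype m] [Fintype n] [DecidableEq m] [DecidableEq n] (P : Matrix q m R) (M : Matrix m n R)
    (N : Matrix n q R) (I : Ideal R) (h : ∀ (f : q → m) (g : q → n), (M.submatrix f g).det ∈ I) :
    (P * M * N).det ∈ I := by
  rw [Matrix.mul_assoc]
  refine det_mul_mem_of_rows P (M * N) I fun f => ?_
  have h3 : (M * N).submatrix f id = M.submatrix f id * N := by
    ext i j
    simp [Matrix.mul_apply]
  rw [h3, ← Matrix.det_transpose, Matrix.transpose_mul]
  refine det_mul_mem_of_rows _ _ I fun g => ?_
  have h4 : ((M.submatrix f id).transpose.submatrix g id) = (M.submatrix f g).transpose := rfl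
  rw [h4, Matrix.det_transpose]
  exact h f g

/-- The matrix of the pencil `A + X B` over the polynomial ring. -/
def pencilMatrix {m n : Type*} (MA MB : Matrix m n K) : Matrix m n K[X] :=
  (X : K[X]) • MB.map C + MA.map C

theorem pencilMatrix_mul {m n p q : Type*} [Fintype n] [Fintype m] (P : Matrix p m K)
    (MA MB : Matrix m n K) (Q : Matrix n q K) :
    pencilMatrix (P * MA * Q) (P * MB * Q) = P.map C * pencilMatrix MA MB * Q.map C := by
  simp only [pencilMatrix, Matrix.map_mul, Matrix.mul_add, Matrix.add_mul, Matrix.mul_smul,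
    Matrix.smul_mul]

theorem det_pencilMatrix_upperBand (n : ℕ) :
    ((pencilMatrix (upperBand n (n + 1) (1 : K) 0) (upperBand n (n + 1) 0 1)).submatrix id
      Fin.castSucc).det = 1 := by
  rw [Matrix.det_of_isUpperTriangular]
  · refine Finset.prod_eq_one fun i _ => ?_
    simp [pencilMatrix, upperBand]
  · intro i j hij
    have h1 : (j : ℕ) < i := hij
    have h2 : (j : ℕ) ≠ i := h1.ne
    have h3 : (j : ℕ) ≠ i + 1 := by omega
    simp [pencilMatrix, upperBand, h2, h3]

namespace Block

/-- The matrix of a block over the polynomial ring. -/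
def mat (β : Block K) : Matrix (Fin β.rows) (Fin β.cols) K[X] := pencilMatrix β.matA β.matB

/-- The left factor of a block. -/
def left : (β : Block K) → Matrix (Fin β.rows) (Fin β.core) K[X]
  | .jordan _ n => (1 : Matrix (Fin (n + 1)) (Fin (n + 1)) K[X])
  | .hor ε => (1 : Matrix (Fin ε) (Fin ε) K[X])
  | .vert η => (Block.vert η).mat

/-- The square factor of a block. -/
def mid : (β : Block K) → Matrix (Fin β.core) (Fin β.core) K[X]
  | .jordan e n => (Block.jordan e n).mat
  | .hor ε => (1 : Matrix (Fin ε) (Fin ε) K[X])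
  | .vert η => (1 : Matrix (Fin η) (Fin η) K[X])

/-- The right factor of a block. -/
def right : (β : Block K) → Matrix (Fin β.core) (Fin β.cols) K[X]
  | .jordan _ n => (1 : Matrix (Fin (n + 1)) (Fin (n + 1)) K[X])
  | .hor ε => (Block.hor ε).mat
  | .vert η => (1 : Matrix (Fin η) (Fin η) K[X])

theorem mat_eq (β : Block K) : β.mat = β.left * β.mid * β.right := by
  rcases β with ⟨e, n⟩ | ε | η
  · have key : ∀ M : Matrix (Fin (n + 1)) (Fin (n + 1)) K[X],
        M = (1 : Matrix (Fin (n + 1)) (Fin (n + 1)) K[X]) * M *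
          (1 : Matrix (Fin (n + 1)) (Fin (n + 1)) K[X]) := by simp
    exact key _
  · have key : ∀ M : Matrix (Fin ε) (Fin (ε + 1)) K[X],
        M = (1 : Matrix (Fin ε) (Fin ε) K[X]) * (1 : Matrix (Fin ε) (Fin ε) K[X]) * M := by simp
    exact key _
  · have key : ∀ M : Matrix (Fin (η + 1)) (Fin η) K[X],
        M = M * (1 : Matrix (Fin η) (Fin η) K[X]) * (1 : Matrix (Fin η) (Fin η) K[X]) := by simp
    exact key _

omit [Field K] in
theorem core_le_rows (β : Block K) : β.core ≤ β.rows := by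
  cases β <;> simp [core, rows]

omit [Field K] in
theorem core_le_cols (β : Block K) : β.core ≤ β.cols := by
  cases β <;> simp [core, cols]

theorem det_left (β : Block K) :
    (β.left.submatrix (Fin.castLE β.core_le_rows) id).det = 1 := by
  rcases β with ⟨e, n⟩ | ε | η
  · exact Matrix.det_one (R := K[X]) (n := Fin (n + 1))
  · exact Matrix.det_one (R := K[X]) (n := Fin ε)
  · exact (Matrix.det_transpose _).trans (det_pencilMatrix_upperBand η)

theorem det_right (β : Block K) :
    (β.right.submatrix id (Fin.castLE β.core_le_cols)).det = 1 := by
  rcases β with ⟨e, n⟩ | ε | η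
  · exact Matrix.det_one (R := K[X]) (n := Fin (n + 1))
  · exact det_pencilMatrix_upperBand ε
  · exact Matrix.det_one (R := K[X]) (n := Fin η)

theorem det_mid {β : Block K} (h : ¬ β.IsInfinite) :
    β.mid.det.Monic ∧ β.mid.det.natDegree = β.jordanDim := by
  rcases β with ⟨(_ | e), n⟩ | ε | η
  · exact absurd trivial h
  · have key : (pencilMatrix (upperBand (n + 1) (n + 1) e 1)
        (upperBand (n + 1) (n + 1) (1 : K) 0)).det = (X + C e) ^ (n + 1) := by
      rw [Matrix.det_of_isUpperTriangular]
      · rw [Finset.prod_congr rfl fun i _ => ?_, Finset.prod_const, Finset.card_univ,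
          Fintype.card_fin]
        simp [pencilMatrix, upperBand]
      · intro i j hij
        have h1 : (j : ℕ) < i := hij
        have h2 : (j : ℕ) ≠ i := h1.ne
        have h3 : (j : ℕ) ≠ i + 1 := by omega
        simp [pencilMatrix, upperBand, h2, h3]
    have key2 : (pencilMatrix (upperBand (n + 1) (n + 1) e 1)
        (upperBand (n + 1) (n + 1) (1 : K) 0)).det.Monic ∧
        (pencilMatrix (upperBand (n + 1) (n + 1) e 1)
        (upperBand (n + 1) (n + 1) (1 : K) 0)).det.natDegree = n + 1 := by
      rw [key]
      refine ⟨(monic_X_add_C e).pow _, ?_⟩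
      rw [(monic_X_add_C e).natDegree_pow, natDegree_X_add_C, mul_one]
    exact key2
  · have h1 := Matrix.det_one (R := K[X]) (n := Fin ε)
    have key : (1 : Matrix (Fin ε) (Fin ε) K[X]).det.Monic ∧
      (1 : Matrix (Fin ε) (Fin ε) K[X]).det.natDegree = 0 := by
      rw [h1]
      exact ⟨monic_one, natDegree_one⟩
    exact key
  · have h1 := Matrix.det_one (R := K[X]) (n := Fin η)
    have key : (1 : Matrix (Fin η) (Fin η) K[X]).det.Monic ∧
      (1 : Matrix (Fin η) (Fin η) K[X]).det.natDegree = 0 := by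
      rw [h1]
      exact ⟨monic_one, natDegree_one⟩
    exact key

/-- Gives the upper bound for the rank of `B`: away from infinity each block of `B` factors through
a space of dimension `core`. -/
theorem matB_factor {β : Block K} (h : ¬ β.IsInfinite) :
    ∃ (P : Matrix (Fin β.rows) (Fin β.core) K) (Q : Matrix (Fin β.core) (Fin β.cols) K),
      β.matB = P * Q := by
  rcases β with ⟨(_ | e), n⟩ | ε | η
  · exact absurd trivial h
  · exact ⟨upperBand (n + 1) (n + 1) (1 : K) 0, (1 : Matrix (Fin (n + 1)) (Fin (n + 1)) K),
      (Matrix.mul_one (upperBand (n + 1) (n + 1) (1 : K) 0)).symm⟩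
  · exact ⟨(1 : Matrix (Fin ε) (Fin ε) K), upperBand ε (ε + 1) (0 : K) 1,
      (Matrix.one_mul (upperBand ε (ε + 1) (0 : K) 1)).symm⟩
  · exact ⟨(upperBand η (η + 1) (0 : K) 1).transpose, (1 : Matrix (Fin η) (Fin η) K),
      (Matrix.mul_one (upperBand η (η + 1) (0 : K) 1).transpose).symm⟩

end Block

namespace CanonicalForm

variable {U V : Type*} [AddCommGroup U] [Module K U] [AddCommGroup V] [Module K V]
variable {A B : U →ₗ[K] V} (F : CanonicalForm A B)

/-- The greatest common divisor of the maximal minors of the pencil. -/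
def elementaryProduct : K[X] :=
  (Matrix.blockDiagonal' fun i => (F.block i).mid).det

theorem elementaryProduct_monic (h : ∀ i, ¬ (F.block i).IsInfinite) :
    F.elementaryProduct.Monic := by
  rw [elementaryProduct, det_blockDiagonal']
  exact monic_prod_of_monic _ _ fun i _ => (Block.det_mid (h i)).1

theorem natDegree_elementaryProduct (h : ∀ i, ¬ (F.block i).IsInfinite) :
    F.elementaryProduct.natDegree = ∑ i, (F.block i).jordanDim := by
  rw [elementaryProduct, det_blockDiagonal',
    natDegree_prod_of_monic _ _ fun i _ => (Block.det_mid (h i)).1]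
  exact Finset.sum_congr rfl fun i _ => (Block.det_mid (h i)).2

theorem pencilMatrix_eq :
    pencilMatrix (LinearMap.toMatrix F.basisU F.basisV A) (LinearMap.toMatrix F.basisU F.basisV B) =
      Matrix.blockDiagonal' (fun i => (F.block i).left) *
      Matrix.blockDiagonal' (fun i => (F.block i).mid) *
      Matrix.blockDiagonal' (fun i => (F.block i).right) := by
  rw [← Matrix.blockDiagonal'_mul, ← Matrix.blockDiagonal'_mul, F.matA_eq, F.matB_eq, pencilMatrix,
    Matrix.blockDiagonal'_map _ _ (map_zero C), Matrix.blockDiagonal'_map _ _ (map_zero C),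
    ← Matrix.blockDiagonal'_smul, ← Matrix.blockDiagonal'_add]
  congr 1
  ext1 i
  exact (F.block i).mat_eq

variable {ι κ : Type*} [Fintype ι] [Fintype κ] [DecidableEq ι] [DecidableEq κ]
  (c : Module.Basis κ K U) (b : Module.Basis ι K V)

omit [DecidableEq ι] in
-- The pencil factors as (left) · (mid) · (right) through a square middle matrix of size the generic
-- rank, so the determinant of the middle one divides each minor of that size.
theorem elementaryProduct_dvd {q : Type*} [Fintype q] [DecidableEq q]
    (hq : Fintype.card q = ∑ i, (F.block i).core) (f : q → ι) (g : q → κ) :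
    F.elementaryProduct ∣ ((pencilMatrix (LinearMap.toMatrix c b A)
      (LinearMap.toMatrix c b B)).submatrix f g).det := by
  have e : q ≃ Σ i, Fin (F.block i).core := Fintype.equivOfCardEq (by
    rw [hq, Fintype.card_sigma]; simp)
  rw [← basis_toMatrix_mul_linearMap_toMatrix_mul_basis_toMatrix c F.basisU b F.basisV A,
    ← basis_toMatrix_mul_linearMap_toMatrix_mul_basis_toMatrix c F.basisU b F.basisV B,
    pencilMatrix_mul, pencilMatrix_eq, ← Matrix.det_submatrix_equiv_self e.symm,
    Matrix.submatrix_submatrix]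
  set L := Matrix.blockDiagonal' (fun i => (F.block i).left)
  set R := Matrix.blockDiagonal' (fun i => (F.block i).right)
  set P := (b.toMatrix F.basisV).map (C : K → K[X])
  set Q := (F.basisU.toMatrix c).map (C : K → K[X])
  have : (P * (L * Matrix.blockDiagonal' (fun i => (F.block i).mid) * R) * Q).submatrix
      (f ∘ e.symm) (g ∘ e.symm) = (P * L).submatrix (f ∘ e.symm) id *
        Matrix.blockDiagonal' (fun i => (F.block i).mid) * (R * Q).submatrix id (g ∘ e.symm) := by
    rw [show P * (L * Matrix.blockDiagonal' (fun i => (F.block i).mid) * R) * Q =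
      (P * L) * Matrix.blockDiagonal' (fun i => (F.block i).mid) * (R * Q) by
        simp only [Matrix.mul_assoc],
      Matrix.submatrix_mul _ _ _ id _ Function.bijective_id,
      Matrix.submatrix_mul _ _ _ id _ Function.bijective_id, Matrix.submatrix_id_id]
  rw [this, Matrix.det_mul, Matrix.det_mul]
  exact Dvd.dvd.mul_right (Dvd.intro_left _ rfl) _

theorem elementaryProduct_eq : F.elementaryProduct =
    ((pencilMatrix (LinearMap.toMatrix F.basisU F.basisV A)
      (LinearMap.toMatrix F.basisU F.basisV B)).submatrix
      (fun p : Σ i, Fin (F.block i).core => ⟨p.1, Fin.castLE (Block.core_le_rows _) p.2⟩)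
      (fun p : Σ i, Fin (F.block i).core => ⟨p.1, Fin.castLE (Block.core_le_cols _) p.2⟩)).det := by
  rw [pencilMatrix_eq, Matrix.submatrix_mul _ _ _ id _ Function.bijective_id,
    Matrix.submatrix_mul _ _ _ id _ Function.bijective_id, Matrix.submatrix_id_id, Matrix.det_mul,
    Matrix.det_mul]
  have h1 : (Matrix.blockDiagonal' fun i => (F.block i).left).submatrix
      (fun p : Σ i, Fin (F.block i).core => ⟨p.1, Fin.castLE (Block.core_le_rows _) p.2⟩) id =
      Matrix.blockDiagonal' fun i =>
        (F.block i).left.submatrix (Fin.castLE (Block.core_le_rows _)) id := by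
    ext ⟨i, j⟩ ⟨i', j'⟩
    by_cases h : i = i'
    · subst h
      simp [Matrix.blockDiagonal'_apply]
    · simp [Matrix.blockDiagonal'_apply, h]
  have h2 : (Matrix.blockDiagonal' fun i => (F.block i).right).submatrix id
      (fun p : Σ i, Fin (F.block i).core => ⟨p.1, Fin.castLE (Block.core_le_cols _) p.2⟩) =
      Matrix.blockDiagonal' fun i =>
        (F.block i).right.submatrix id (Fin.castLE (Block.core_le_cols _)) := by
    ext ⟨i, j⟩ ⟨i', j'⟩
    by_cases h : i = i'
    · subst h
      simp [Matrix.blockDiagonal'_apply]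
    · simp [Matrix.blockDiagonal'_apply, h]
  rw [h1, h2, det_blockDiagonal', det_blockDiagonal' (fun i => Matrix.submatrix _ _ _),
    Finset.prod_congr rfl fun i _ => (F.block i).det_left,
    Finset.prod_congr rfl fun i _ => (F.block i).det_right]
  simp [elementaryProduct]

/-- The outer factors have a minor equal to `1`, so the product is itself a minor in the adapted
bases. Expanding the change of bases multilinearly puts it in the ideal of minors in any bases. -/
theorem elementaryProduct_mem {q : Type*} [Fintype q] [DecidableEq q]
    (hq : Fintype.card q = ∑ i, (F.block i).core) :
    F.elementaryProduct ∈ Ideal.span {m | ∃ (f : q → ι) (g : q → κ),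
      m = ((pencilMatrix (LinearMap.toMatrix c b A)
      (LinearMap.toMatrix c b B)).submatrix f g).det} := by
  have e : q ≃ Σ i, Fin (F.block i).core := Fintype.equivOfCardEq (by
    rw [hq, Fintype.card_sigma]; simp)
  rw [elementaryProduct_eq,
    ← basis_toMatrix_mul_linearMap_toMatrix_mul_basis_toMatrix F.basisU c F.basisV b A,
    ← basis_toMatrix_mul_linearMap_toMatrix_mul_basis_toMatrix F.basisU c F.basisV b B,
    pencilMatrix_mul, ← Matrix.det_submatrix_equiv_self e, Matrix.submatrix_submatrix,
    Matrix.submatrix_mul _ _ _ id _ Function.bijective_id,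
    Matrix.submatrix_mul _ _ _ id _ Function.bijective_id, Matrix.submatrix_id_id]
  exact det_mul_mem _ _ _ _ fun f g => Ideal.subset_span ⟨f, g, rfl⟩

theorem finrank_range_le (h : ∀ i, ¬ (F.block i).IsInfinite) :
    Module.finrank K (LinearMap.range B) ≤ ∑ i, (F.block i).core := by
  choose P Q hPQ using fun i => Block.matB_factor (h i)
  have : LinearMap.toMatrix F.basisU F.basisV B =
      Matrix.blockDiagonal' P * Matrix.blockDiagonal' Q := by
    rw [← Matrix.blockDiagonal'_mul, F.matB_eq]
    congr 1
    ext1 i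
    exact hPQ i
  have h1 := (LinearMap.toMatrix F.basisU F.basisV B).rank_eq_finrank_range_toLin F.basisV F.basisU
  rw [Matrix.toLin_toMatrix] at h1
  rw [← h1, this]
  refine (Matrix.rank_mul_le_left _ _).trans ((Matrix.rank_le_card_width _).trans ?_)
  rw [Fintype.card_sigma]
  simp

/-- The monic product is one minor in adapted bases, so at any non-root `t` the pencil has rank at
least the total core size. -/
theorem exists_le_finrank_range [Infinite K] (h : ∀ i, ¬ (F.block i).IsInfinite) :
    ∃ t : K, ∑ i, (F.block i).core ≤ Module.finrank K (LinearMap.range (A + t • B)) := by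
  obtain ⟨t, ht⟩ : ∃ t, F.elementaryProduct.eval t ≠ 0 := by
    by_contra! hcon
    exact (F.elementaryProduct_monic h).ne_zero (Polynomial.funext fun t => by simp [hcon])
  refine ⟨t, ?_⟩
  rw [elementaryProduct_eq, ← Polynomial.coe_evalRingHom, RingHom.map_det] at ht
  have h1 := (LinearMap.toMatrix F.basisU F.basisV (A + t • B)).rank_eq_finrank_range_toLin
    F.basisV F.basisU
  rw [Matrix.toLin_toMatrix] at h1
  rw [← h1]
  refine le_trans (le_of_eq ?_) (Matrix.rank_submatrix_le _
      (fun p : Σ i, Fin (F.block i).core => ⟨p.1, Fin.castLE (Block.core_le_rows _) p.2⟩)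
      (fun p : Σ i, Fin (F.block i).core => ⟨p.1, Fin.castLE (Block.core_le_cols _) p.2⟩))
  rw [Matrix.rank_of_isUnit]
  · rw [Fintype.card_sigma]
    simp
  · rw [Matrix.isUnit_iff_isUnit_det]
    refine (Ne.isUnit ?_)
    convert ht using 2
    ext p q
    simp only [pencilMatrix, Matrix.submatrix_apply, RingHom.mapMatrix_apply, Matrix.map_apply,
      Matrix.add_apply, Matrix.smul_apply, smul_eq_mul, coe_evalRingHom, eval_add, eval_mul, eval_X,
      eval_C, map_add, map_smul]
    ring

end CanonicalForm

end Minors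


/-! ### Polynomial vector fields and the Poincaré lemma -/

section Derivations

open MvPolynomial

variable {V ι : Type*} [AddCommGroup V] [Module ℂ V] [Fintype ι] (b : Module.Basis ι ℂ V)

theorem evalAt_ext {p q : MvPolynomial ι ℂ} (h : ∀ x, evalAt b x p = evalAt b x q) : p = q := by
  refine MvPolynomial.funext fun y => ?_
  have := h (b.equivFun.symm y)
  have e : (fun i => b.repr (b.equivFun.symm y) i) = y := by
    ext i
    rw [← Module.Basis.equivFun_apply, LinearEquiv.apply_symm_apply]
  rwa [evalAt, evalAt, e] at this

theorem derivation_eq_sum (D : Derivation ℂ (MvPolynomial ι ℂ) (MvPolynomial ι ℂ))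
    (g : MvPolynomial ι ℂ) : D g = ∑ i, pderiv i g * D (X i) := by
  classical
  have hsum : ∀ g, (∑ i, D (X i) • pderiv i : Derivation ℂ (MvPolynomial ι ℂ) _) g =
      ∑ i, (D (X i) • pderiv i : Derivation ℂ (MvPolynomial ι ℂ) _) g := fun g => by
    have := map_sum (Derivation.coeFnAddMonoidHom (R := ℂ) (A := MvPolynomial ι ℂ)
      (M := MvPolynomial ι ℂ)) (fun i => D (X i) • pderiv i) Finset.univ
    exact (congrFun this g).trans (Finset.sum_apply _ _ _)
  have : D = ∑ i, D (X i) • pderiv i := by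
    refine MvPolynomial.derivation_ext fun j => ?_
    rw [hsum, Finset.sum_eq_single_of_mem j (Finset.mem_univ _)]
    · simp
    · intro i _ hi
      simp [pderiv_X_of_ne hi.symm]
  conv_lhs => rw [this]
  rw [hsum]
  exact Finset.sum_congr rfl fun i _ => by
    rw [Derivation.smul_apply, smul_eq_mul, mul_comm]

theorem differential_apply (g : MvPolynomial ι ℂ) (x v : V) :
    differential b g x v = ∑ i, evalAt b x (pderiv i g) * b.repr v i := by
  simp [differential]

/-- The derivative along a constant vector field. -/
def dirDeriv (v : V) : Derivation ℂ (MvPolynomial ι ℂ) (MvPolynomial ι ℂ) :=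
  mkDerivation ℂ fun i => C (b.repr v i)

/-- The derivative along a linear vector field. -/
def linDeriv (T : Module.End ℂ V) : Derivation ℂ (MvPolynomial ι ℂ) (MvPolynomial ι ℂ) :=
  mkDerivation ℂ fun i => ∑ k, C (b.repr (T (b k)) i) * X k

omit [Fintype ι] in
theorem dirDeriv_X (v : V) (i : ι) : dirDeriv b v (X i) = C (b.repr v i) :=
  mkDerivation_X _ _ _

theorem linDeriv_X (T : Module.End ℂ V) (i : ι) :
    linDeriv b T (X i) = ∑ k, C (b.repr (T (b k)) i) * X k :=
  mkDerivation_X _ _ _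

theorem repr_apply_eq_sum (T : Module.End ℂ V) (v : V) (i : ι) :
    b.repr (T v) i = ∑ k, b.repr (T (b k)) i * b.repr v k := by
  conv_lhs => rw [← b.sum_repr v]
  simp only [map_sum, map_smul, Finsupp.coe_finsetSum, Finset.sum_apply, Finsupp.smul_apply,
    smul_eq_mul]
  exact Finset.sum_congr rfl fun _ _ => mul_comm _ _

theorem evalAt_dirDeriv (v x : V) (g : MvPolynomial ι ℂ) :
    evalAt b x (dirDeriv b v g) = differential b g x v := by
  rw [derivation_eq_sum, differential_apply, evalAt, map_sum]
  refine Finset.sum_congr rfl fun i _ => ?_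
  rw [map_mul, dirDeriv_X, eval_C]
  rfl

theorem evalAt_linDeriv (T : Module.End ℂ V) (x : V) (g : MvPolynomial ι ℂ) :
    evalAt b x (linDeriv b T g) = differential b g x (T x) := by
  rw [derivation_eq_sum, differential_apply, evalAt, map_sum]
  refine Finset.sum_congr rfl fun i _ => ?_
  rw [map_mul, linDeriv_X, map_sum, repr_apply_eq_sum]
  simp only [map_mul, eval_C, eval_X]
  rfl

theorem dirDeriv_add (v w : V) (g : MvPolynomial ι ℂ) :
    dirDeriv b (v + w) g = dirDeriv b v g + dirDeriv b w g := by
  refine evalAt_ext b fun x => ?_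
  rw [evalAt_dirDeriv, map_add, evalAt, map_add, ← evalAt, ← evalAt, evalAt_dirDeriv,
    evalAt_dirDeriv]

theorem linDeriv_sub (S T : Module.End ℂ V) (g : MvPolynomial ι ℂ) :
    linDeriv b (S - T) g = linDeriv b S g - linDeriv b T g := by
  refine evalAt_ext b fun x => ?_
  rw [evalAt_linDeriv, LinearMap.sub_apply, map_sub, evalAt, map_sub, ← evalAt, ← evalAt,
    evalAt_linDeriv, evalAt_linDeriv]

omit [Fintype ι] in
theorem dirDeriv_comm (v w : V) (g : MvPolynomial ι ℂ) :
    dirDeriv b v (dirDeriv b w g) = dirDeriv b w (dirDeriv b v g) := by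
  have : ⁅dirDeriv b v, dirDeriv b w⁆ = 0 := by
    refine MvPolynomial.derivation_ext fun i => ?_
    rw [Derivation.commutator_apply, dirDeriv_X, dirDeriv_X]
    simp
  have h := congrArg (fun D => D g) this
  rw [← sub_eq_zero, ← Derivation.commutator_apply]
  exact h

/-- The bracket of the constant field `v` with the linear field `x ↦ T x` is the constant field `T
v`; it suffices to check coordinates. -/
theorem dirDeriv_linDeriv (v : V) (T : Module.End ℂ V) (g : MvPolynomial ι ℂ) :
    dirDeriv b v (linDeriv b T g) = linDeriv b T (dirDeriv b v g) + dirDeriv b (T v) g := by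
  have : ⁅dirDeriv b v, linDeriv b T⁆ = dirDeriv b (T v) := by
    refine MvPolynomial.derivation_ext fun i => ?_
    rw [Derivation.commutator_apply, dirDeriv_X, linDeriv_X, dirDeriv_X, repr_apply_eq_sum]
    simp only [map_sum, Derivation.leibniz, derivation_C, mul_zero, add_zero, dirDeriv_X, sub_zero,
      smul_eq_mul, map_mul]
  have h := congrArg (fun D => D g) this
  rw [← sub_eq_iff_eq_add', ← Derivation.commutator_apply]
  exact h

theorem linDeriv_linDeriv (S T : Module.End ℂ V) (g : MvPolynomial ι ℂ) :
    linDeriv b S (linDeriv b T g) - linDeriv b T (linDeriv b S g) = linDeriv b (T * S - S * T) g := by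
  have key : ∀ (S T : Module.End ℂ V) i, linDeriv b S (linDeriv b T (X i)) = linDeriv b (T * S) (X i)
      := by
    intro S T i
    rw [linDeriv_X, linDeriv_X]
    simp only [map_sum, Derivation.leibniz, derivation_C, mul_zero, add_zero, linDeriv_X,
      smul_eq_mul, Module.End.mul_apply, Finset.mul_sum]
    rw [Finset.sum_comm]
    refine Finset.sum_congr rfl fun k _ => ?_
    rw [repr_apply_eq_sum b T, map_sum, Finset.sum_mul]
    refine Finset.sum_congr rfl fun l _ => ?_
    rw [map_mul, mul_assoc]
  have : ⁅linDeriv b S, linDeriv b T⁆ = linDeriv b (T * S - S * T) := by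
    refine MvPolynomial.derivation_ext fun i => ?_
    rw [Derivation.commutator_apply, key, key, ← linDeriv_sub]
  rw [← Derivation.commutator_apply, this]

theorem isHomogeneous_dirDeriv (v : V) {n : ℕ} {g : MvPolynomial ι ℂ} (h : g.IsHomogeneous n) :
    (dirDeriv b v g).IsHomogeneous (n - 1) := by
  rw [derivation_eq_sum]
  refine IsHomogeneous.sum _ _ _ fun i _ => ?_
  rw [dirDeriv_X]
  simpa using h.pderiv.mul (isHomogeneous_C _ (b.repr v i))

theorem isHomogeneous_linDeriv (T : Module.End ℂ V) {n : ℕ} {g : MvPolynomial ι ℂ}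
    (h : g.IsHomogeneous (n + 1)) : (linDeriv b T g).IsHomogeneous (n + 1) := by
  rw [derivation_eq_sum]
  refine IsHomogeneous.sum _ _ _ fun i _ => ?_
  rw [linDeriv_X]
  have h1 : (∑ k, C (b.repr (T (b k)) i) * X k : MvPolynomial ι ℂ).IsHomogeneous 1 :=
    IsHomogeneous.sum _ _ _ fun k _ => by
      simpa using (isHomogeneous_C _ (b.repr (T (b k)) i)).mul (isHomogeneous_X ℂ k)
  simpa using h.pderiv.mul h1

/-- A linear form as a polynomial. -/
def linForm (φ : Module.Dual ℂ V) : MvPolynomial ι ℂ := ∑ i, C (φ (b i)) * X i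

theorem isHomogeneous_linForm (φ : Module.Dual ℂ V) : (linForm b φ).IsHomogeneous 1 :=
  IsHomogeneous.sum _ _ _ fun k _ => by
    simpa using (isHomogeneous_C _ (φ (b k))).mul (isHomogeneous_X ℂ k)

theorem dirDeriv_linForm (φ : Module.Dual ℂ V) (v : V) : dirDeriv b v (linForm b φ) = C (φ v) := by
  rw [linForm]
  conv_rhs => rw [← b.sum_repr v]
  simp only [map_sum, Derivation.leibniz, derivation_C, mul_zero, add_zero, dirDeriv_X,
      smul_eq_mul, map_smul, map_mul]
  exact Finset.sum_congr rfl fun i _ => mul_comm _ _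

theorem differential_linForm (φ : Module.Dual ℂ V) (x : V) :
    differential b (linForm b φ) x = φ := by
  ext v
  rw [← evalAt_dirDeriv, dirDeriv_linForm, evalAt, eval_C]

theorem differential_const (c : ℂ) (x : V) : differential b (C c) x = 0 := by
  simp [differential, evalAt]

omit [Fintype ι] in
theorem eq_C_of_isHomogeneous_zero {g : MvPolynomial ι ℂ} (h : g.IsHomogeneous 0) :
    ∃ c, g = C c := by
  refine ⟨coeff 0 g, (totalDegree_eq_zero_iff_eq_C).1 ?_⟩
  exact Nat.le_zero.1 h.totalDegree_le

theorem iterate_dirDeriv_isHomogeneous (w : V) {n : ℕ} {g : MvPolynomial ι ℂ}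
    (h : g.IsHomogeneous n) (k : ℕ) : ((dirDeriv b w)^[k] g).IsHomogeneous (n - k) := by
  induction k with
  | zero => exact h
  | succ k ih =>
    rw [Function.iterate_succ_apply', Nat.sub_succ]
    exact isHomogeneous_dirDeriv b w ih

theorem iterate_dirDeriv_eq_zero (w : V) {n : ℕ} {g : MvPolynomial ι ℂ}
    (h : g.IsHomogeneous n) : (dirDeriv b w)^[n + 1] g = 0 := by
  have h1 := iterate_dirDeriv_isHomogeneous b w h n
  rw [Nat.sub_self] at h1
  obtain ⟨c, hc⟩ := eq_C_of_isHomogeneous_zero h1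
  rw [Function.iterate_succ_apply', hc]
  exact derivation_C _ _

/-- Integration of a polynomial along one direction. -/
theorem exists_antiderivative (w : V) (φ : Module.Dual ℂ V) (hφ : φ w = 1) {n : ℕ}
    {g : MvPolynomial ι ℂ} (hg : g.IsHomogeneous n) :
    ∃ f : MvPolynomial ι ℂ, f.IsHomogeneous (n + 1) ∧ dirDeriv b w f = g ∧
      ∀ v, φ v = 0 → dirDeriv b v g = 0 → dirDeriv b v f = 0 := by
  set L := linForm b φ with hL
  set D := dirDeriv b w with hD
  -- The antiderivative is `∑ (-1)^k / (k + 1)! · L^(k + 1) · D^k g`, iterated integration by parts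
  -- with `D L = 1`. Its derivative telescopes to `g`, since `D^(n + 1) g = 0`.
  let c : ℕ → ℂ := fun k => (-1) ^ k / (Nat.factorial k : ℂ)
  have hc : ∀ k, c (k + 1) * (k + 1 : ℕ) = - c k := by
    intro k
    have h1 : ((k + 1 : ℕ) : ℂ) ≠ 0 := Nat.cast_ne_zero.2 (Nat.succ_ne_zero k)
    have h2 : (Nat.factorial k : ℂ) ≠ 0 := Nat.cast_ne_zero.2 (Nat.factorial_ne_zero k)
    simp only [c, Nat.factorial_succ, Nat.cast_mul, pow_succ]
    field_simp
  refine ⟨∑ k ∈ Finset.range (n + 1), (- c (k + 1)) • (L ^ (k + 1) * D^[k] g), ?_, ?_, ?_⟩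
  · refine IsHomogeneous.sum _ _ _ fun k hk => ?_
    have hk' : k < n + 1 := Finset.mem_range.1 hk
    have h1 := ((isHomogeneous_linForm b φ).pow (k + 1)).mul
      (iterate_dirDeriv_isHomogeneous b w hg k)
    rw [show 1 * (k + 1) + (n - k) = n + 1 by omega] at h1
    rw [smul_eq_C_mul]
    simpa using (isHomogeneous_C _ (- c (k + 1))).mul h1
  · let a : ℕ → MvPolynomial ι ℂ := fun k => c k • (L ^ k * D^[k] g)
    have hterm : ∀ k, D ((- c (k + 1)) • (L ^ (k + 1) * D^[k] g)) = a k - a (k + 1) := by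
      intro k
      have h1 : D (L ^ (k + 1)) = ((k + 1 : ℕ) : ℂ) • L ^ k := by
        rw [Derivation.leibniz_pow, hD, hL, dirDeriv_linForm, hφ, ← hL]
        simp [smul_eq_C_mul]
      rw [Derivation.map_smul, Derivation.leibniz, h1, ← Function.iterate_succ_apply' D]
      simp only [a, smul_eq_mul]
      have h2 : c k = - (c (k + 1) * (k + 1 : ℕ)) := by rw [hc, neg_neg]
      rw [h2]
      simp only [smul_eq_C_mul, map_neg, map_mul]
      ring
    rw [map_sum, Finset.sum_congr rfl fun k _ => hterm k, Finset.sum_range_sub']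
    simp only [a]
    rw [hD, iterate_dirDeriv_eq_zero b w hg]
    simp [c]
  · intro v hv hvg
    have hit : ∀ k, dirDeriv b v (D^[k] g) = 0 := by
      intro k
      induction k with
      | zero => exact hvg
      | succ k ih => rw [Function.iterate_succ_apply', hD, dirDeriv_comm, ← hD, ih, map_zero]
    rw [map_sum]
    refine Finset.sum_eq_zero fun k _ => ?_
    rw [Derivation.map_smul, Derivation.leibniz, hit, Derivation.leibniz_pow, hL, dirDeriv_linForm, hv]
    simp

/-- The polynomial Poincaré lemma along a family of independent directions. -/
theorem exists_potential {n : ℕ} {s : ℕ} (w : Fin s → V) (φ : Fin s → Module.Dual ℂ V)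
    (hφ : ∀ i j, φ i (w j) = if i = j then 1 else 0) (ω : Fin s → MvPolynomial ι ℂ)
    (hω : ∀ i, (ω i).IsHomogeneous n)
    (hcomp : ∀ i j, dirDeriv b (w i) (ω j) = dirDeriv b (w j) (ω i)) :
    ∃ f : MvPolynomial ι ℂ, f.IsHomogeneous (n + 1) ∧ ∀ i, dirDeriv b (w i) f = ω i := by
  induction s with
  | zero => exact ⟨0, isHomogeneous_zero _ _ _, fun i => i.elim0⟩
  | succ s ih =>
    obtain ⟨f, hf, hf'⟩ := ih (fun i => w i.castSucc) (fun i => φ i.castSucc)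
      (fun i j => by rw [hφ]; simp) (fun i => ω i.castSucc) (fun i => hω _) fun i j => hcomp _ _
    have hg : (ω (Fin.last s) - dirDeriv b (w (Fin.last s)) f).IsHomogeneous n :=
      (hω _).sub (by simpa using isHomogeneous_dirDeriv b (w (Fin.last s)) hf)
    obtain ⟨f', h1, h2, h3⟩ := exists_antiderivative b (w (Fin.last s)) (φ (Fin.last s))
      (by rw [hφ, if_pos rfl]) hg
    refine ⟨f + f', hf.add h1, fun i => ?_⟩
    rw [map_add]
    refine Fin.lastCases ?_ (fun i => ?_) i
    · rw [h2]
      abel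
    · rw [hf', h3, add_zero]
      · rw [hφ, if_neg (Fin.castSucc_lt_last i).ne']
      · rw [map_sub, dirDeriv_comm, hf', hcomp, sub_self]

end Derivations


/-! ### Existence of formal invariants and the span of their differentials -/

section FormalInvariants

open MvPolynomial

variable {𝔤 V ι : Type*} [LieRing 𝔤] [LieAlgebra ℂ 𝔤] [AddCommGroup V] [Module ℂ V] [Fintype ι]
  {ρ : 𝔤 →ₗ⁅ℂ⁆ Module.End ℂ V}

omit [Fintype ι] in
theorem R_apply (x : V) (ξ : 𝔤) : R ρ x ξ = ρ ξ x := rfl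

theorem R_add (x y : V) : R ρ (x + y) = R ρ x + R ρ y := by
  ext ξ; simp [R_apply]

theorem R_smul (t : ℂ) (x : V) : R ρ (t • x) = t • R ρ x := by
  ext ξ; simp [R_apply]

theorem R_sub (x y : V) : R ρ (x - y) = R ρ x - R ρ y := by
  ext ξ; simp [R_apply]

theorem R_neg (x : V) : R ρ (-x) = -R ρ x := by
  ext ξ; simp [R_apply]

theorem IsRegularPoint.finrank_range_le [FiniteDimensional ℂ 𝔤] {a : V} (ha : IsRegularPoint ρ a)
    (x : V) : Module.finrank ℂ (LinearMap.range (R ρ x)) ≤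
      Module.finrank ℂ (LinearMap.range (R ρ a)) := by
  have h1 := LinearMap.finrank_range_add_finrank_ker (R ρ x)
  have h2 := LinearMap.finrank_range_add_finrank_ker (R ρ a)
  have h3 := ha x
  omega

theorem IsRegularPoint.hasKerChains [FiniteDimensional ℂ 𝔤] [FiniteDimensional ℂ V] {a : V}
    (ha : IsRegularPoint ρ a) (x : V) : HasKerChains (R ρ x) (R ρ a) := by
  refine hasKerChains_of_finrank_le fun c => ?_
  rw [← R_smul, ← R_sub]
  exact ha.finrank_range_le _

theorem IsRegularPoint.hasKerChains_dualMap [FiniteDimensional ℂ 𝔤] [FiniteDimensional ℂ V] {a : V}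
    (ha : IsRegularPoint ρ a) (x : V) : HasKerChains (R ρ x).dualMap (R ρ a).dualMap := by
  refine hasKerChains_of_finrank_le fun c => ?_
  have h : (R ρ a).dualMap - c • (R ρ x).dualMap = (R ρ (a - c • x)).dualMap := by
    rw [R_sub, R_smul]
    ext φ ξ
    simp
  rw [h, LinearMap.finrank_range_dualMap_eq_finrank_range,
    LinearMap.finrank_range_dualMap_eq_finrank_range]
  exact ha.finrank_range_le _

theorem exists_seq_of_step {α : Type*} (H : ℕ → α → α → Prop)
    (step : ∀ j p q, H j p q → ∃ r, H (j + 1) q r) {p q : α} (h : H 0 p q) :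
    ∃ g : ℕ → α, g 0 = p ∧ g 1 = q ∧ ∀ j, H j (g j) (g (j + 1)) := by
  choose F hF using step
  let s : ∀ j, {x : α × α // H j x.1 x.2} := fun j =>
    Nat.rec ⟨(p, q), h⟩ (fun j x => ⟨(x.1.2, F j x.1.1 x.1.2 x.2), hF j _ _ x.2⟩) j
  exact ⟨fun j => (s j).1.1, rfl, rfl, fun j => (s j).2⟩

variable (ρ) (b : Module.Basis ι ℂ V) (a : V)

/-- The differential of `q` annihilates the images under `R_x` of all chains issuing from
`Ker R_a`. -/
def AnnihilatesChains (q : MvPolynomial ι ℂ) : Prop :=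
  ∀ (x : V) (w : ℕ → 𝔤), R ρ a (w 0) = 0 → (∀ n, R ρ a (w (n + 1)) = -R ρ x (w n)) →
    ∀ n, differential b q x (R ρ x (w n)) = 0

/-- `p` and `q` can be consecutive components of a formal invariant. -/
structure AreConsecutive (j : ℕ) (p q : MvPolynomial ι ℂ) : Prop where
  left : p.IsHomogeneous j
  right : q.IsHomogeneous (j + 1)
  eq : ∀ x ξ, differential b q x (R ρ a ξ) + differential b p x (R ρ x ξ) = 0
  annihilates : AnnihilatesChains ρ b a q

variable {ρ b a}

/-- Evaluate the equation on `w (n + 1)`: the `p` term vanishes by hypothesis, and `R_a w_{n+1} =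
-R_x w_n` turns the other into the claim for `q`. -/
theorem AnnihilatesChains.next {p q : MvPolynomial ι ℂ} (hp : AnnihilatesChains ρ b a p)
    (h : ∀ x ξ, differential b q x (R ρ a ξ) + differential b p x (R ρ x ξ) = 0) :
    AnnihilatesChains ρ b a q := by
  intro x w h0 hw n
  have h1 := h x (w (n + 1))
  rw [hp x w h0 hw, add_zero, hw, map_neg, neg_eq_zero] at h1
  exact h1

theorem AreConsecutive.dirDeriv_eq {j : ℕ} {p q : MvPolynomial ι ℂ}
    (h : AreConsecutive ρ b a j p q) (ξ : 𝔤) :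
    dirDeriv b (ρ ξ a) q = -linDeriv b (ρ ξ) p := by
  refine evalAt_ext b fun x => ?_
  rw [evalAt_dirDeriv, evalAt, map_neg, ← evalAt, evalAt_linDeriv]
  exact eq_neg_of_add_eq_zero_left (h.eq x ξ)

/-- Closedness of the form to be integrated. The failure of symmetry is `∂_{[ρ(η), ρ(ξ)] a} q` plus
a bracket of linear fields applied to `p`, and the two cancel by the recursion for the element `⁅η,
ξ⁆`. -/
theorem AreConsecutive.dirDeriv_linDeriv_comm {j : ℕ} {p q : MvPolynomial ι ℂ}
    (h : AreConsecutive ρ b a j p q) (ξ η : 𝔤) :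
    dirDeriv b (ρ ξ a) (linDeriv b (ρ η) q) = dirDeriv b (ρ η a) (linDeriv b (ρ ξ) q) := by
  rw [dirDeriv_linDeriv, dirDeriv_linDeriv, h.dirDeriv_eq, h.dirDeriv_eq, map_neg, map_neg]
  have h1 := linDeriv_linDeriv b (ρ ξ) (ρ η) p
  have h2 := h.dirDeriv_eq ⁅η, ξ⁆
  have h3 : ρ ⁅η, ξ⁆ = ρ η * ρ ξ - ρ ξ * ρ η := by
    rw [LieHom.map_lie]; rfl
  rw [h3] at h2
  have h4 : dirDeriv b (ρ η (ρ ξ a)) q =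
      dirDeriv b ((ρ η * ρ ξ - ρ ξ * ρ η) a) q + dirDeriv b (ρ ξ (ρ η a)) q := by
    rw [← dirDeriv_add]
    simp
  rw [h4, h2, ← h1]
  ring

/-- The derivatives of `r` along `range R_a` are prescribed on a basis through a section `σ` and
integrated. The annihilation condition shows that the choice of `σ` is immaterial. -/
theorem AreConsecutive.exists_next [FiniteDimensional ℂ 𝔤] [FiniteDimensional ℂ V]
    (ha : IsRegularPoint ρ a) {j : ℕ} {p q : MvPolynomial ι ℂ} (h : AreConsecutive ρ b a j p q) :
    ∃ r, AreConsecutive ρ b a (j + 1) q r := by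
  set B := R ρ a with hB
  let w := Module.finBasis ℂ (LinearMap.range B)
  obtain ⟨σ, hσ⟩ := B.rangeRestrict.exists_rightInverse_of_surjective B.range_rangeRestrict
  have hσ' : ∀ v, B (σ v) = v := fun v => congrArg Subtype.val (LinearMap.congr_fun hσ v)
  choose φ hφ using fun i => LinearMap.exists_extend (w.coord i)
  have hφ' : ∀ i (v : LinearMap.range B), φ i v = w.coord i v := fun i v =>
    LinearMap.congr_fun (hφ i) v
  obtain ⟨r, hr, hr'⟩ := exists_potential b (fun i => (w i : V)) φ
    (fun i k => by
      rw [hφ', Module.Basis.coord_apply, Module.Basis.repr_self, Finsupp.single_apply]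
      simp [eq_comm])
    (fun i => -linDeriv b (ρ (σ (w i))) q)
    (fun i => (isHomogeneous_linDeriv b _ h.right).neg)
    (fun i k => by
      rw [map_neg, map_neg, ← hσ' (w i), ← hσ' (w k)]
      exact congrArg _ (h.dirDeriv_linDeriv_comm _ _))
  have hmain : ∀ x ξ, differential b r x (R ρ a ξ) + differential b q x (R ρ x ξ) = 0 := by
    intro x
    set F : 𝔤 →ₗ[ℂ] ℂ := (differential b r x).comp (R ρ a) + (differential b q x).comp (R ρ x)
      with hF
    have h1 : F.comp σ = 0 := by
      refine w.ext fun i => ?_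
      have := congrArg (evalAt b x) (hr' i)
      rw [evalAt_dirDeriv, evalAt, map_neg, ← evalAt, evalAt_linDeriv] at this
      simp only [hF, LinearMap.comp_apply, LinearMap.add_apply, LinearMap.zero_apply, ← hB, hσ',
        this]
      rw [R_apply, neg_add_cancel]
    -- Regularity of `a` extends `ζ` to an infinite chain; the direction is `-x` because the sign in
    -- the chain relation is negative.
    have h2 : ∀ ζ, B ζ = 0 → F ζ = 0 := by
      intro ζ hζ
      obtain ⟨z, hz0, hz⟩ := ha.hasKerChains (-x) ζ hζ
      have := h.annihilates x z (by rw [hz0]; exact hζ)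
        (fun n => by rw [hz, R_neg, LinearMap.neg_apply]) 0
      rw [hz0] at this
      simp only [hF, LinearMap.comp_apply, LinearMap.add_apply, ← hB, hζ, map_zero, this, add_zero]
    intro ξ
    have h3 : F (ξ - σ (B.rangeRestrict ξ)) = 0 := h2 _ (by
      rw [map_sub, hσ']
      exact sub_self _)
    rw [map_sub, ← LinearMap.comp_apply F, h1, LinearMap.zero_apply, sub_zero] at h3
    exact h3
  exact ⟨r, h.right, hr, hmain, h.annihilates.next hmain⟩

/-- The recursion starts from the constant term `0` and the linear form `φ`, whose annihilation
condition follows from that of `0`. -/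
theorem exists_isFormalInvariant [FiniteDimensional ℂ 𝔤] [FiniteDimensional ℂ V]
    (ha : IsRegularPoint ρ a) (φ : Module.Dual ℂ V) (hφ : (R ρ a).dualMap φ = 0) :
    ∃ G, IsFormalInvariant ρ b a G ∧ PowerSeries.coeff 1 G = linForm b φ := by
  have h0 : AnnihilatesChains ρ b a 0 := fun x w _ _ n => by
    rw [← C_0, differential_const, LinearMap.zero_apply]
  have heq : ∀ x ξ, differential b (linForm b φ) x (R ρ a ξ) + differential b 0 x (R ρ x ξ) = 0 := by
    intro x ξ
    rw [← C_0, differential_const, differential_linForm, LinearMap.zero_apply, add_zero]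
    exact LinearMap.congr_fun hφ ξ
  obtain ⟨g, hg0, hg1, hg⟩ := exists_seq_of_step (AreConsecutive ρ b a)
    (fun j p q h => h.exists_next ha)
    ⟨isHomogeneous_zero _ _ _, isHomogeneous_linForm b φ, heq, h0.next heq⟩
  refine ⟨PowerSeries.mk g, ⟨fun j => ?_, fun x => ?_, fun x j => ?_⟩, ?_⟩
  · rw [PowerSeries.coeff_mk]
    exact (hg j).left
  · rw [PowerSeries.coeff_mk, hg0, ← C_0, differential_const, map_zero]
  · rw [PowerSeries.coeff_mk, PowerSeries.coeff_mk]
    ext ξ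
    exact (hg j).eq x ξ
  · rw [PowerSeries.coeff_mk, hg1]

theorem exists_isCompleteSet [FiniteDimensional ℂ 𝔤] [FiniteDimensional ℂ V]
    (ha : IsRegularPoint ρ a) :
    ∃ (q : ℕ) (G : Fin q → PowerSeries (MvPolynomial ι ℂ)), IsCompleteSet ρ b a G := by
  let φ := Module.finBasis ℂ (LinearMap.ker (R ρ a).dualMap)
  choose G hG hG1 using fun i => exists_isFormalInvariant (b := b) ha (φ i).1 (φ i).2
  have h : (fun i => differential b (PowerSeries.coeff 1 (G i)) 0) =
      (LinearMap.ker (R ρ a).dualMap).subtype ∘ φ := by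
    funext i
    rw [hG1, differential_linForm]
    rfl
  refine ⟨_, G, hG, ?_, ?_⟩
  · rw [h]
    exact φ.linearIndependent.map' _ (Submodule.ker_subtype _)
  · rw [h, Set.range_comp, ← Submodule.map_span, φ.span_eq, Submodule.map_subtype_top]

theorem differential_add (p q : MvPolynomial ι ℂ) (x : V) :
    differential b (p + q) x = differential b p x + differential b q x := by
  ext v
  rw [LinearMap.add_apply, ← evalAt_dirDeriv, ← evalAt_dirDeriv, ← evalAt_dirDeriv, map_add]
  exact map_add _ _ _

theorem differential_mul (p q : MvPolynomial ι ℂ) (x : V) :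
    differential b (p * q) x = evalAt b x p • differential b q x + evalAt b x q • differential b p x
    := by
  ext v
  rw [LinearMap.add_apply, LinearMap.smul_apply, LinearMap.smul_apply, ← evalAt_dirDeriv,
    ← evalAt_dirDeriv, ← evalAt_dirDeriv, Derivation.leibniz]
  simp [evalAt]

theorem spanDifferentials_adjoin (s : Set (MvPolynomial ι ℂ)) (x : V) :
    spanDifferentials b (Algebra.adjoin ℂ s) x =
      Submodule.span ℂ {φ | ∃ g ∈ s, φ = differential b g x} := by
  refine le_antisymm (Submodule.span_le.2 ?_) (Submodule.span_mono ?_)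
  · rintro _ ⟨g, hg, rfl⟩
    rw [SetLike.mem_coe]
    induction hg using Algebra.adjoin_induction with
    | mem g hg => exact Submodule.subset_span ⟨g, hg, rfl⟩
    | algebraMap c =>
      rw [algebraMap_eq, differential_const]
      exact zero_mem _
    | add p q _ _ hp hq =>
      rw [differential_add]
      exact add_mem hp hq
    | mul p q _ _ hp hq =>
      rw [differential_mul]
      exact add_mem (Submodule.smul_mem _ _ hq) (Submodule.smul_mem _ _ hp)
  · rintro _ ⟨g, hg, rfl⟩
    exact ⟨g, Algebra.subset_adjoin hg, rfl⟩

theorem differential_eq_of_isHomogeneous_one {g : MvPolynomial ι ℂ} (h : g.IsHomogeneous 1)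
    (x y : V) : differential b g x = differential b g y := by
  ext v
  rw [← evalAt_dirDeriv, ← evalAt_dirDeriv]
  obtain ⟨c, hc⟩ := eq_C_of_isHomogeneous_zero (isHomogeneous_dirDeriv b v h)
  rw [hc, evalAt, evalAt, eval_C, eval_C]

/-- By the Leibniz rule only the generators matter. Their differentials at `x` are chains of the
dual pencil up to sign. Conversely their span contains `Ker R_a^*` and can solve `R_a^* u' = R_x^*
v` inside itself, so it absorbs every chain. -/
theorem IsCompleteSet.spanDifferentials_eq {q : ℕ} {G : Fin q → PowerSeries (MvPolynomial ι ℂ)}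
    (hG : IsCompleteSet ρ b a G) (x : V) :
    spanDifferentials b (componentAlgebra G) x = chainSpan (R ρ x).dualMap (R ρ a).dualMap := by
  rw [componentAlgebra, spanDifferentials_adjoin]
  set N := Submodule.span ℂ {φ | ∃ g ∈ {g | ∃ α j, g = PowerSeries.coeff j (G α)},
    φ = differential b g x} with hN
  have hmem : ∀ α j, differential b (PowerSeries.coeff j (G α)) x ∈ N := fun α j =>
    Submodule.subset_span ⟨_, ⟨α, j, rfl⟩, rfl⟩
  have hker : LinearMap.ker (R ρ a).dualMap ≤ N := by
    rw [← hG.span_eq, Submodule.span_le]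
    rintro _ ⟨α, rfl⟩
    change differential b (PowerSeries.coeff 1 (G α)) 0 ∈ N
    rw [differential_eq_of_isHomogeneous_one ((hG.formalInvariant α).homogeneous 1) 0 x]
    exact hmem α 1
  have hB : ∀ α j, (R ρ a).dualMap (differential b (PowerSeries.coeff (j + 1) (G α)) x) =
      (R ρ x).dualMap (-differential b (PowerSeries.coeff j (G α)) x) := fun α j => by
    rw [map_neg]
    exact eq_neg_of_add_eq_zero_left ((hG.formalInvariant α).coeff_succ x j)
  apply le_antisymm
  · rw [hN, Submodule.span_le]
    rintro _ ⟨_, ⟨α, j, rfl⟩, rfl⟩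
    rw [SetLike.mem_coe]
    induction j with
    | zero => exact mem_chainSpan_of_ker ((hG.formalInvariant α).coeff_zero x)
    | succ j ih => exact mem_chainSpan_of_eq (neg_mem ih) (hB α j)
  · refine chainSpan_le (fun u hu => hker hu) fun u v hv huv => ?_
    have hex : ∀ v ∈ N, ∃ u' ∈ N, (R ρ a).dualMap u' = (R ρ x).dualMap v := by
      intro v hv
      induction hv using Submodule.span_induction with
      | mem v hv =>
        obtain ⟨_, ⟨α, j, rfl⟩, rfl⟩ := hv
        exact ⟨_, neg_mem (hmem α (j + 1)), by rw [map_neg, hB, map_neg, neg_neg]⟩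
      | zero => exact ⟨0, zero_mem _, by simp⟩
      | add v w _ _ hv hw =>
        obtain ⟨v', hv', hv''⟩ := hv
        obtain ⟨w', hw', hw''⟩ := hw
        exact ⟨v' + w', add_mem hv' hw', by rw [map_add, map_add, hv'', hw'']⟩
      | smul c v _ hv =>
        obtain ⟨v', hv', hv''⟩ := hv
        exact ⟨c • v', N.smul_mem c hv', by rw [map_smul, map_smul, hv'']⟩
    obtain ⟨u', hu', hu''⟩ := hex v hv
    have : u - u' ∈ N := hker (by rw [LinearMap.mem_ker, map_sub, hu'', huv, sub_self])
    simpa using add_mem this hu'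

end FormalInvariants


/-! ### Lower semicontinuity in a parameter -/

section Semicontinuity

open MvPolynomial

variable {E X Y σ : Type*} [AddCommGroup E] [Module ℂ E] [Fintype σ] (β : Module.Basis σ ℂ E)
  [AddCommGroup X] [Module ℂ X] [AddCommGroup Y] [Module ℂ Y]

theorem evalAt_linForm (φ : Module.Dual ℂ E) (e : E) : evalAt β e (linForm β φ) = φ e := by
  conv_rhs => rw [← β.sum_repr e, map_sum]
  simp [evalAt, linForm, mul_comm]

omit [Fintype σ] in
theorem evalAt_mul (e : E) (f g : MvPolynomial σ ℂ) :
    evalAt β e (f * g) = evalAt β e f * evalAt β e g := map_mul _ _ _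

theorem exists_evalAt_ne_zero {f : MvPolynomial σ ℂ} (hf : f ≠ 0) : ∃ e, evalAt β e f ≠ 0 := by
  by_contra! h
  exact hf (evalAt_ext β fun e => by rw [h, evalAt, map_zero])

/-- The rank of a linear map depending linearly on a parameter is lower semicontinuous. -/
theorem exists_finrank_range_le [FiniteDimensional ℂ Y] (l : E →ₗ[ℂ] X →ₗ[ℂ] Y) (e₀ : E) :
    ∃ f : MvPolynomial σ ℂ, evalAt β e₀ f ≠ 0 ∧ ∀ e, evalAt β e f ≠ 0 →
      Module.finrank ℂ (LinearMap.range (l e₀)) ≤ Module.finrank ℂ (LinearMap.range (l e)) := by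
  let w := Module.finBasis ℂ (LinearMap.range (l e₀))
  choose u hu using fun i => (w i).2
  choose φ hφ using fun i => LinearMap.exists_extend (w.coord i)
  have hφ' : ∀ i (v : LinearMap.range (l e₀)), φ i v = w.coord i v := fun i v =>
    LinearMap.congr_fun (hφ i) v
  let M : Matrix _ _ (MvPolynomial σ ℂ) :=
    Matrix.of fun i j => linForm β ((φ i).comp (l.flip (u j)))
  have hM : ∀ e, evalAt β e M.det = (Matrix.of fun i j => φ i (l e (u j))).det := by
    intro e
    rw [evalAt, RingHom.map_det]
    congr 1
    ext i j
    exact evalAt_linForm β _ e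
  refine ⟨M.det, ?_, fun e he => ?_⟩
  · have h1 : (Matrix.of fun i j => φ i (l e₀ (u j))) = 1 := by
      ext i j
      rw [Matrix.of_apply, hu, hφ', Module.Basis.coord_apply, Module.Basis.repr_self,
        Finsupp.single_apply, Matrix.one_apply]
      simp [eq_comm]
    rw [hM, h1, Matrix.det_one]
    exact one_ne_zero
  · rw [hM] at he
    have hli : LinearIndependent ℂ fun j => l e (u j) := by
      have h2 := Matrix.linearIndependent_cols_of_det_ne_zero he
      refine LinearIndependent.of_comp (LinearMap.pi φ) ?_
      exact h2
    have h3 := (hli.of_comp (LinearMap.range (l e)).subtype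
      (v := fun j => ⟨l e (u j), LinearMap.mem_range_self _ _⟩)).fintype_card_le_finrank
    simpa using h3

/-- The chain span is reached at a finite stage `n`. There its dimension is the rank of `toeplitz n`
plus a constant depending only on `n`, `dim ker B` and `dim X`, so semicontinuity of rank applies.
-/
theorem exists_finrank_chainSpan_le [FiniteDimensional ℂ X] [FiniteDimensional ℂ Y]
    (lA lB : E →ₗ[ℂ] X →ₗ[ℂ] Y) (e₀ : E) (h₀ : HasKerChains (lA e₀) (lB e₀)) :
    ∃ f : MvPolynomial σ ℂ, evalAt β e₀ f ≠ 0 ∧ ∀ e, evalAt β e f ≠ 0 →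
      HasKerChains (lA e) (lB e) →
      Module.finrank ℂ (LinearMap.ker (lB e)) = Module.finrank ℂ (LinearMap.ker (lB e₀)) →
      Module.finrank ℂ (chainSpan (lA e₀) (lB e₀)) ≤ Module.finrank ℂ (chainSpan (lA e) (lB e)) := by
  obtain ⟨n, hn⟩ := monotone_stabilizes_iff_noetherian.2
    (inferInstance : IsNoetherian ℂ X) ⟨kerChain (lA e₀) (lB e₀), kerChain_mono⟩
  have hn' : chainSpan (lA e₀) (lB e₀) = kerChain (lA e₀) (lB e₀) n := by
    refine le_antisymm (iSup_le fun m => ?_) (kerChain_le_chainSpan n)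
    rcases le_total n m with h | h
    · exact (hn m h).ge
    · exact kerChain_mono h
  obtain ⟨f, hf, hf'⟩ := exists_finrank_range_le β ((toeplitz n).comp (lA.prod lB)) e₀
  refine ⟨f, hf, fun e he hc hd => ?_⟩
  have h1 := hf' e he
  have h2 := h₀.finrank_kerChain_add n
  have h3 := hc.finrank_kerChain_add n
  have h4 := LinearMap.finrank_range_add_finrank_ker (toeplitz n (lA e₀, lB e₀))
  have h5 := LinearMap.finrank_range_add_finrank_ker (toeplitz n (lA e, lB e))
  have h6 : Module.finrank ℂ (LinearMap.range (toeplitz n (lA e₀, lB e₀))) ≤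
    Module.finrank ℂ (LinearMap.range (toeplitz n (lA e, lB e))) := h1
  have h7 := Submodule.finrank_mono (kerChain_le_chainSpan (A := lA e) (B := lB e) n)
  rw [hd] at h3
  rw [hn']
  omega

omit [Fintype σ] in
/-- A bounded lower semicontinuous function takes its maximal value generically. -/
theorem exists_generic_value (P : E → Prop) (F : E → ℕ) (hex : ∃ e, P e) (N : ℕ)
    (hN : ∀ e, F e ≤ N)
    (hP : ∀ e₀, P e₀ → ∃ f : MvPolynomial σ ℂ, evalAt β e₀ f ≠ 0 ∧ ∀ e, evalAt β e f ≠ 0 → P e)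
    (hF : ∀ e₀, P e₀ → ∃ f : MvPolynomial σ ℂ, evalAt β e₀ f ≠ 0 ∧
      ∀ e, evalAt β e f ≠ 0 → P e → F e₀ ≤ F e) :
    ∃ k, (∀ e, P e → F e ≤ k) ∧ ∃ f : MvPolynomial σ ℂ, f ≠ 0 ∧
      ∀ e, evalAt β e f ≠ 0 → P e ∧ F e = k := by
  classical
  obtain ⟨e, he⟩ := hex
  have hQ : ∃ k, ∃ e, P e ∧ F e = k := ⟨_, e, he, rfl⟩
  have hb : ∀ k, (∃ e, P e ∧ F e = k) → k ≤ N := by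
    rintro _ ⟨e, _, rfl⟩
    exact hN e
  obtain ⟨k, hk⟩ := hQ
  obtain ⟨e₀, he₀, hk₀⟩ := Nat.findGreatest_spec (P := fun k => ∃ e, P e ∧ F e = k) (hb k hk) hk
  have hmax : ∀ e, P e → F e ≤ F e₀ := fun e he => by
    rw [hk₀]
    exact Nat.le_findGreatest (hN e) ⟨e, he, rfl⟩
  obtain ⟨f, hf, hf'⟩ := hP e₀ he₀
  obtain ⟨g, hg, hg'⟩ := hF e₀ he₀
  refine ⟨F e₀, hmax, f * g, ?_, fun e he => ?_⟩
  · rintro h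
    apply mul_ne_zero hf hg
    rw [← evalAt_mul, h, evalAt, map_zero]
  · rw [evalAt_mul] at he
    have h1 := hf' e (left_ne_zero_of_mul he)
    exact ⟨h1, le_antisymm (hmax e h1) (hg' e (right_ne_zero_of_mul he) h1)⟩

end Semicontinuity

/-! ### Generic values on pairs of points -/

section GenericValues

open MvPolynomial

variable {𝔤 V ι : Type*} [LieRing 𝔤] [LieAlgebra ℂ 𝔤] [AddCommGroup V] [Module ℂ V] [Fintype ι]
  {ρ : 𝔤 →ₗ⁅ℂ⁆ Module.End ℂ V} (b : Module.Basis ι ℂ V)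

omit [Fintype ι] in
theorem evalAt_prod (p : V × V) (f : MvPolynomial (ι ⊕ ι) ℂ) : evalAt (b.prod b) p f =
    MvPolynomial.eval (Sum.elim (fun i => b.repr p.1 i) (fun i => b.repr p.2 i)) f := by
  rw [evalAt]
  congr 2

variable (ρ) in
/-- `R_x` as a linear function of `x`. -/
def linearR : V →ₗ[ℂ] 𝔤 →ₗ[ℂ] V where
  toFun := R ρ
  map_add' := R_add
  map_smul' := R_smul

variable [FiniteDimensional ℂ 𝔤] [FiniteDimensional ℂ V]

omit [FiniteDimensional ℂ V] in
theorem isRegularPoint_of_finrank_range_le {a y : V} (ha : IsRegularPoint ρ a)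
    (h : Module.finrank ℂ (LinearMap.range (R ρ a)) ≤ Module.finrank ℂ (LinearMap.range (R ρ y))) :
    IsRegularPoint ρ y := by
  intro x
  have h1 := LinearMap.finrank_range_add_finrank_ker (R ρ y)
  have h2 := LinearMap.finrank_range_add_finrank_ker (R ρ a)
  have h3 := ha x
  omega

omit [FiniteDimensional ℂ 𝔤] [FiniteDimensional ℂ V] in
theorem IsRegularPoint.finrank_ker_eq {a y : V} (ha : IsRegularPoint ρ a)
    (hy : IsRegularPoint ρ y) : Module.finrank ℂ (LinearMap.ker (R ρ a)) =
      Module.finrank ℂ (LinearMap.ker (R ρ y)) :=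
  le_antisymm (ha y) (hy a)

theorem IsRegularPoint.finrank_ker_dualMap_eq {a y : V} (ha : IsRegularPoint ρ a)
    (hy : IsRegularPoint ρ y) : Module.finrank ℂ (LinearMap.ker (R ρ a).dualMap) =
      Module.finrank ℂ (LinearMap.ker (R ρ y).dualMap) := by
  have h1 := LinearMap.finrank_range_add_finrank_ker (R ρ a).dualMap
  have h2 := LinearMap.finrank_range_add_finrank_ker (R ρ y).dualMap
  have h3 := ha.finrank_range_le y
  have h4 := hy.finrank_range_le a
  rw [LinearMap.finrank_range_dualMap_eq_finrank_range] at h1 h2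
  omega

theorem exists_isRegularPoint_of_ne_zero (p : V × V) (hp : IsRegularPoint ρ p.2) :
    ∃ f : MvPolynomial (ι ⊕ ι) ℂ, evalAt (b.prod b) p f ≠ 0 ∧
      ∀ e, evalAt (b.prod b) e f ≠ 0 → IsRegularPoint ρ e.2 := by
  obtain ⟨f, hf, hf'⟩ := exists_finrank_range_le (b.prod b)
    ((linearR ρ).comp (LinearMap.snd ℂ V V)) p
  exact ⟨f, hf, fun e he => isRegularPoint_of_finrank_range_le hp (hf' e he)⟩

/-- The generic value of the dimension of the chain span of the pencil `R_x + μ R_a`. -/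
theorem exists_generic_chainSpan {a : V} (ha : IsRegularPoint ρ a) :
    ∃ k, (∀ x a, IsRegularPoint ρ a → Module.finrank ℂ (chainSpan (R ρ x) (R ρ a)) ≤ k) ∧
      ∃ f : MvPolynomial (ι ⊕ ι) ℂ, f ≠ 0 ∧ ∀ e, evalAt (b.prod b) e f ≠ 0 →
        IsRegularPoint ρ e.2 ∧ Module.finrank ℂ (chainSpan (R ρ e.1) (R ρ e.2)) = k := by
  obtain ⟨k, hk, hf⟩ := exists_generic_value (b.prod b) (fun e => IsRegularPoint ρ e.2)
    (fun e => Module.finrank ℂ (chainSpan (R ρ e.1) (R ρ e.2))) ⟨(0, a), ha⟩ _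
    (fun e => Submodule.finrank_le _) (exists_isRegularPoint_of_ne_zero b) fun e he => by
      obtain ⟨f, hf, hf'⟩ := exists_finrank_chainSpan_le (b.prod b)
        ((linearR ρ).comp (LinearMap.fst ℂ V V)) ((linearR ρ).comp (LinearMap.snd ℂ V V)) e
        (he.hasKerChains _)
      exact ⟨f, hf, fun e' h1 h2 => hf' e' h1 (h2.hasKerChains _) (h2.finrank_ker_eq he)⟩
  exact ⟨k, fun x a h => hk (x, a) h, hf⟩

/-- The generic value of the dimension of the chain span of the dual pencil. -/
theorem exists_generic_chainSpan_dualMap {a : V} (ha : IsRegularPoint ρ a) :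
    ∃ k, (∀ x a, IsRegularPoint ρ a →
        Module.finrank ℂ (chainSpan (R ρ x).dualMap (R ρ a).dualMap) ≤ k) ∧
      ∃ f : MvPolynomial (ι ⊕ ι) ℂ, f ≠ 0 ∧ ∀ e, evalAt (b.prod b) e f ≠ 0 →
        IsRegularPoint ρ e.2 ∧
          Module.finrank ℂ (chainSpan (R ρ e.1).dualMap (R ρ e.2).dualMap) = k := by
  obtain ⟨k, hk, hf⟩ := exists_generic_value (b.prod b) (fun e => IsRegularPoint ρ e.2)
    (fun e => Module.finrank ℂ (chainSpan (R ρ e.1).dualMap (R ρ e.2).dualMap)) ⟨(0, a), ha⟩ _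
    (fun e => Submodule.finrank_le _) (exists_isRegularPoint_of_ne_zero b) fun e he => by
      obtain ⟨f, hf, hf'⟩ := exists_finrank_chainSpan_le (b.prod b)
        (Module.Dual.transpose.comp ((linearR ρ).comp (LinearMap.fst ℂ V V)))
        (Module.Dual.transpose.comp ((linearR ρ).comp (LinearMap.snd ℂ V V))) e
        (he.hasKerChains_dualMap _)
      exact ⟨f, hf, fun e' h1 h2 => hf' e' h1 (h2.hasKerChains_dualMap _)
        (h2.finrank_ker_dualMap_eq he)⟩
  exact ⟨k, fun x a h => hk (x, a) h, hf⟩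

theorem kVert_R {a : V} (ha : IsRegularPoint ρ a) (x : V) : kVert (R ρ x) (R ρ a) =
    Module.finrank ℂ (chainSpan (R ρ x).dualMap (R ρ a).dualMap) :=
  kVert_eq_finrank_chainSpan (ha.hasKerChains x)

omit [FiniteDimensional ℂ V] [Fintype ι] in
theorem exists_mem_of_isZariskiOpen {W : Set (V × V)} (hW : IsZariskiOpen b W) {p : V × V}
    (hp : p ∈ W) : ∃ g : MvPolynomial (ι ⊕ ι) ℂ, evalAt (b.prod b) p g ≠ 0 ∧
      ∀ e, evalAt (b.prod b) e g ≠ 0 → e ∈ W := by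
  obtain ⟨S, rfl⟩ := hW
  obtain ⟨g, hgS, hg⟩ := hp
  exact ⟨g, by rwa [evalAt_prod], fun e he => ⟨g, hgS, by rwa [evalAt_prod] at he⟩⟩

omit [FiniteDimensional ℂ V] in
theorem exists_mem_and_evalAt_ne_zero {W : Set (V × V)} (hW : IsZariskiOpen b W)
    (hne : W.Nonempty) {f : MvPolynomial (ι ⊕ ι) ℂ} (hf : f ≠ 0) :
    ∃ e ∈ W, evalAt (b.prod b) e f ≠ 0 := by
  obtain ⟨p, hp⟩ := hne
  obtain ⟨g, hg, hg'⟩ := exists_mem_of_isZariskiOpen b hW hp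
  have hg0 : g ≠ 0 := by
    rintro rfl
    exact hg (by rw [evalAt, map_zero])
  obtain ⟨e, he⟩ := exists_evalAt_ne_zero (b.prod b) (mul_ne_zero hf hg0)
  rw [evalAt_mul] at he
  exact ⟨e, hg' e (right_ne_zero_of_mul he), left_ne_zero_of_mul he⟩

/-- Nonempty Zariski open subsets of `V × V` intersect, so `k` is the only candidate and the `sInf`
is over a singleton. -/
theorem kVertRep_eq {k : ℕ} {f : MvPolynomial (ι ⊕ ι) ℂ} (hf : f ≠ 0)
    (hk : ∀ e, evalAt (b.prod b) e f ≠ 0 → IsRegularPoint ρ e.2 ∧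
      Module.finrank ℂ (chainSpan (R ρ e.1).dualMap (R ρ e.2).dualMap) = k) :
    kVertRep ρ b = k := by
  have hk' : ∀ e : V × V, evalAt (b.prod b) e f ≠ 0 → kVert (R ρ e.1) (R ρ e.2) = k := fun e he => by
    rw [kVert_R (hk e he).1, (hk e he).2]
  have hset : {k | ∃ W, IsZariskiOpen b W ∧ W.Nonempty ∧ ∀ p ∈ W, kVert (R ρ p.1) (R ρ p.2) = k} =
      {k} := by
    refine Set.eq_singleton_iff_unique_mem.2 ⟨?_, ?_⟩
    · obtain ⟨e, he⟩ := exists_evalAt_ne_zero (b.prod b) hf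
      refine ⟨{p | evalAt (b.prod b) p f ≠ 0}, ⟨{f}, ?_⟩, ⟨e, he⟩, hk'⟩
      ext p
      simp [evalAt_prod]
    · rintro l ⟨W, hW, hne, hl⟩
      obtain ⟨e, he, he'⟩ := exists_mem_and_evalAt_ne_zero b hW hne hf
      rw [← hl e he, hk' e he']
  rw [kVertRep, hset, csInf_singleton]

end GenericValues


/-! ### Gauss's lemma: coprime families contain a nonzero constant -/

section Gauss

open Polynomial
open scoped nonZeroDivisors

/-- A set of polynomials in one variable without common factors has a nonzero constant in its
ideal. -/
theorem exists_C_mem_span {P : Type*} [CommRing P] [IsDomain P] [UniqueFactorizationMonoid P]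
    {S : Set P[X]} (hS : ∃ h ∈ S, h ≠ 0) (hcop : ∀ G : P[X], (∀ h ∈ S, G ∣ h) → IsUnit G) :
    ∃ d : P, d ≠ 0 ∧ C d ∈ Ideal.span S := by
  let : NormalizedGCDMonoid P := Nonempty.some inferInstance
  -- Over the fraction field the ideal is principal. By Gauss's lemma the primitive part of a
  -- generator, after clearing denominators, divides all of `S`, so it is a unit.
  have key : (Ideal.span S).map (mapRingHom (algebraMap P (FractionRing P))) = ⊤ := by
    by_contra hI
    set J := (Ideal.span S).map (mapRingHom (algebraMap P (FractionRing P))) with hJ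
    obtain ⟨g, hg⟩ := (IsPrincipalIdealRing.principal J).principal
    have hgd : ∀ h ∈ S, g ∣ h.map (algebraMap P (FractionRing P)) := fun h hh => by
      rw [← Ideal.mem_span_singleton]
      have : h.map (algebraMap P (FractionRing P)) ∈ J :=
        Ideal.mem_map_of_mem (mapRingHom _) (Ideal.subset_span hh)
      rwa [hg] at this
    have hg0 : g ≠ 0 := by
      obtain ⟨h, hh, h0⟩ := hS
      rintro rfl
      have h1 := hgd h hh
      rw [zero_dvd_iff, Polynomial.map_eq_zero_iff (IsFractionRing.injective P _)] at h1
      exact h0 h1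
    have hgu : ¬ IsUnit g := fun hu => hI (by
      rw [hg]
      exact Ideal.span_singleton_eq_top.2 hu)
    refine hgu (isUnit_or_eq_zero_of_isUnit_integerNormalization_primPart (R := P) hg0
      (hcop _ fun h hh => ?_))
    refine (isPrimitive_primPart _).dvd_of_fraction_map_dvd_fraction_map (K := FractionRing P) ?_
    refine dvd_trans ?_ (hgd h hh)
    obtain ⟨c, hc, hc'⟩ := IsLocalization.integerNormalization_spec P⁰ g
    have h1 := Polynomial.map_dvd (algebraMap P (FractionRing P))
      (primPart_dvd (IsLocalization.integerNormalization P⁰ g))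
    rw [hc', Algebra.smul_def, Polynomial.algebraMap_apply] at h1
    have hu : IsUnit (C (algebraMap P (FractionRing P) c)) :=
      isUnit_C.2 (IsLocalization.map_units (FractionRing P) ⟨c, hc⟩)
    exact (hu.dvd_mul_left).1 h1
  let := Polynomial.algebra P (FractionRing P)
  have := Polynomial.isLocalization P⁰ (FractionRing P)
  have h1 := (IsLocalization.map_algebraMap_ne_top_iff_disjoint
    (Submonoid.map C P⁰) (FractionRing P)[X] (Ideal.span S)).not
  rw [not_not] at h1
  obtain ⟨_, ⟨d, hd, rfl⟩, hdI⟩ := Set.not_disjoint_iff.1 (h1.1 key)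
  exact ⟨d, nonZeroDivisors.ne_zero hd, hdI⟩

end Gauss

/-! ### Restriction to lines and coprime families -/

section Lines

open MvPolynomial

variable {V ι : Type*} [AddCommGroup V] [Module ℂ V] (b : Module.Basis ι ℂ V)

/-- The restriction of polynomials to the line through `x` in the direction of `a`. -/
def lineHom (x a : V) : MvPolynomial ι ℂ →ₐ[ℂ] Polynomial ℂ :=
  aeval fun i => Polynomial.C (b.repr x i) + Polynomial.X * Polynomial.C (b.repr a i)

theorem eval_lineHom (x a : V) (t : ℂ) (g : MvPolynomial ι ℂ) :
    (lineHom b x a g).eval t = evalAt b (x + t • a) g := by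
  have h : ((Polynomial.aeval t).comp (lineHom b x a) : MvPolynomial ι ℂ →ₐ[ℂ] ℂ) =
      aeval fun i => b.repr (x + t • a) i := by
    refine MvPolynomial.algHom_ext fun i => ?_
    simp [lineHom, mul_comm t]
  have h1 := DFunLike.congr_fun h g
  rw [AlgHom.comp_apply, Polynomial.coe_aeval_eq_eval] at h1
  rw [h1, aeval_eq_eval, evalAt]

theorem natDegree_lineHom_le (x a : V) (g : MvPolynomial ι ℂ) :
    (lineHom b x a g).natDegree ≤ g.totalDegree := by
  rw [lineHom, aeval_def, eval₂_eq]
  refine Polynomial.natDegree_sum_le_of_forall_le _ _ fun d hd => ?_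
  refine Polynomial.natDegree_C_mul_le _ _ |>.trans ?_
  refine (Polynomial.natDegree_prod_le _ _).trans ?_
  refine le_trans (Finset.sum_le_sum fun i _ => ?_) (le_totalDegree hd)
  refine Polynomial.natDegree_pow_le.trans ?_
  refine (Nat.mul_le_mul_left _ ?_).trans (mul_one _).le
  refine Polynomial.natDegree_add_le_of_degree_le (by simp) ?_
  exact (Polynomial.natDegree_mul_C_le _ _).trans Polynomial.natDegree_X_le

/-- The translates of a polynomial in a given direction, as a polynomial in one more variable. -/
def translateHom (a : V) : MvPolynomial ι ℂ →ₐ[ℂ] Polynomial (MvPolynomial ι ℂ) :=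
  aeval fun i => Polynomial.C (X i) + Polynomial.X * Polynomial.C (C (b.repr a i))

/-- Translation of polynomials. -/
def shiftHom (a : V) : MvPolynomial ι ℂ →ₐ[ℂ] MvPolynomial ι ℂ :=
  aeval fun i => X i + C (b.repr a i)

theorem shiftHom_neg_shiftHom (a : V) (g : MvPolynomial ι ℂ) :
    shiftHom b (-a) (shiftHom b a g) = g := by
  have h : (shiftHom b (-a)).comp (shiftHom b a) = AlgHom.id ℂ _ := by
    refine MvPolynomial.algHom_ext fun i => ?_
    simp [shiftHom]
  exact DFunLike.congr_fun h g

theorem eval_translateHom (a : V) (s : ℂ) (g : MvPolynomial ι ℂ) :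
    (translateHom b a g).eval (C s) = shiftHom b (s • a) g := by
  have h : ((Polynomial.aeval (C s : MvPolynomial ι ℂ)).restrictScalars ℂ).comp (translateHom b a) =
      shiftHom b (s • a) := by
    refine MvPolynomial.algHom_ext fun i => ?_
    simp [shiftHom, translateHom, mul_comm (C s)]
  have h1 := DFunLike.congr_fun h g
  rwa [AlgHom.comp_apply, AlgHom.restrictScalars_apply, Polynomial.coe_aeval_eq_eval] at h1

theorem eval_eval_translateHom (a x : V) (s : ℂ) (g : MvPolynomial ι ℂ) :
    evalAt b x ((translateHom b a g).eval (C s)) = evalAt b (x + s • a) g := by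
  rw [eval_translateHom]
  have h : (aeval (fun i => b.repr x i) : MvPolynomial ι ℂ →ₐ[ℂ] ℂ).comp (shiftHom b (s • a)) =
      aeval fun i => b.repr (x + s • a) i := by
    refine MvPolynomial.algHom_ext fun i => ?_
    simp [shiftHom]
  have h1 := DFunLike.congr_fun h g
  rwa [AlgHom.comp_apply, aeval_eq_eval, aeval_eq_eval] at h1

/-- The constants `G(s)` are the values of one polynomial `γ` in `s`. It has no roots, so it is
constant, and `G` agrees with that constant at infinitely many points. -/
theorem isUnit_of_isUnit_eval_C {G : Polynomial (MvPolynomial ι ℂ)}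
    (h : ∀ s : ℂ, IsUnit (G.eval (C s))) : IsUnit G := by
  have h1 : ∀ s : ℂ, ∃ c : ℂ, IsUnit c ∧ G.eval (C s) = C c := fun s => by
    obtain ⟨c, hc, hc'⟩ := MvPolynomial.isUnit_iff_eq_C_of_isReduced.1 (h s)
    exact ⟨c, hc, hc'⟩
  choose c hc hc' using h1
  set γ : Polynomial ℂ := G.map (MvPolynomial.eval 0) with hγ
  have hγ' : ∀ s, γ.eval s = c s := fun s => by
    have h2 := congrArg (MvPolynomial.eval (0 : ι → ℂ)) (hc' s)
    rw [eval_C, ← Polynomial.eval_map_apply, eval_C] at h2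
    exact h2
  have hdeg : γ.degree = 0 := by
    by_contra hd
    obtain ⟨s, hs⟩ := IsAlgClosed.exists_root γ hd
    rw [Polynomial.IsRoot, hγ'] at hs
    exact (hc s).ne_zero hs
  obtain ⟨d, hd⟩ : ∃ d, γ = Polynomial.C d := ⟨_, Polynomial.eq_C_of_degree_eq_zero hdeg⟩
  have hG : G = Polynomial.C (C d) := by
    refine Polynomial.eq_of_infinite_eval_eq _ _ ?_
    refine (Set.infinite_range_of_injective (C_injective ι ℂ)).mono ?_
    rintro _ ⟨s, rfl⟩
    rw [Set.mem_ofPred_eq, hc', Polynomial.eval_C, ← hγ', hd, Polynomial.eval_C]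
  have h0 := hc 0
  rw [← hγ', hd, Polynomial.eval_C] at h0
  rw [hG]
  exact (h0.map C).map Polynomial.C

/-- A coprime family of polynomials has no common zeros on a generic line with a given direction. -/
theorem exists_line_of_coprime [Fintype ι] (a : V) (H : Set (MvPolynomial ι ℂ)) (hne : ∃ h ∈ H, h ≠ 0)
    (hcop : ∀ d, (∀ h ∈ H, d ∣ h) → IsUnit d) :
    ∃ x, ∀ t : ℂ, ∃ h ∈ H, evalAt b (x + t • a) h ≠ 0 := by
  have hS : ∃ h ∈ translateHom b a '' H, h ≠ 0 := by
    obtain ⟨h, hh, h0⟩ := hne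
    refine ⟨_, ⟨h, hh, rfl⟩, fun h1 => h0 ?_⟩
    have h2 := eval_translateHom b a 0 h
    rw [h1, Polynomial.eval_zero] at h2
    rw [← shiftHom_neg_shiftHom b ((0 : ℂ) • a) h, ← h2, map_zero]
  -- A common factor of the translates specialises at each `s` to a common factor of a shifted copy
  -- of `H`, hence to a unit. The resulting `d` is free of the line parameter, so `d(x) ≠ 0`
  -- excludes common zeros at every point of the line through `x`.
  obtain ⟨d, hd, hdI⟩ := exists_C_mem_span hS fun G hGdvd => isUnit_of_isUnit_eval_C fun s => by
    have h1 : IsUnit (shiftHom b (-(s • a)) (G.eval (C s))) := hcop _ fun h hh => by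
      have h2 := map_dvd (shiftHom b (-(s • a)))
        (map_dvd (Polynomial.evalRingHom (C s)) (hGdvd _ ⟨h, hh, rfl⟩))
      rw [Polynomial.coe_evalRingHom, eval_translateHom, shiftHom_neg_shiftHom] at h2
      exact h2
    have h2 := h1.map (shiftHom b (-(-(s • a))))
    rwa [shiftHom_neg_shiftHom] at h2
  obtain ⟨x, hx⟩ := exists_evalAt_ne_zero b hd
  refine ⟨x, fun t => ?_⟩
  by_contra! hzero
  let Φ : Polynomial (MvPolynomial ι ℂ) →+* ℂ := (MvPolynomial.eval fun i => b.repr x i).comp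
    (Polynomial.evalRingHom (C t))
  have hI : Ideal.span (translateHom b a '' H) ≤ RingHom.ker Φ := by
    rw [Ideal.span_le]
    rintro _ ⟨h, hh, rfl⟩
    have h1 := eval_eval_translateHom b a x t h
    rw [hzero h hh] at h1
    exact h1
  have := hI hdI
  rw [RingHom.mem_ker] at this
  apply hx
  simpa [Φ, evalAt] using this

end Lines


/-! ### Minors of the representation on a line, and `Sing₁` -/

section Minors

open MvPolynomial

variable {𝔤 V ι κ : Type*} [LieRing 𝔤] [LieAlgebra ℂ 𝔤] [FiniteDimensional ℂ 𝔤] [AddCommGroup V]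
  [Module ℂ V] [FiniteDimensional ℂ V] [Fintype ι] [Fintype κ]
  {ρ : 𝔤 →ₗ⁅ℂ⁆ Module.End ℂ V} (b : Module.Basis ι ℂ V) (c : Module.Basis κ ℂ 𝔤)

omit [FiniteDimensional ℂ V] in
theorem IsRegularPoint.regularRank_eq {a : V} (ha : IsRegularPoint ρ a) :
    regularRank ρ = Module.finrank ℂ (LinearMap.range (R ρ a)) :=
  IsGreatest.csSup_eq ⟨⟨a, rfl⟩, by rintro _ ⟨x, rfl⟩; exact ha.finrank_range_le x⟩

omit [FiniteDimensional ℂ V] in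
theorem lineHom_sum (T : Module.End ℂ V) (x a : V) (i : ι) :
    lineHom b x a (∑ k, C (b.repr (T (b k)) i) * X k) =
      Polynomial.X * Polynomial.C (b.repr (T a) i) + Polynomial.C (b.repr (T x) i) := by
  rw [repr_apply_eq_sum b T x, repr_apply_eq_sum b T a, map_sum, map_sum, map_sum, Finset.mul_sum,
    ← Finset.sum_add_distrib]
  refine Finset.sum_congr rfl fun k _ => ?_
  rw [map_mul, lineHom, aeval_X, algHom_C, Polynomial.algebraMap_eq, map_mul, map_mul]
  ring

omit [FiniteDimensional ℂ 𝔤] [FiniteDimensional ℂ V] in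
theorem lineHom_genericMatrix [DecidableEq κ] (x a : V) {q : Type*} [Fintype q] [DecidableEq q]
    (f : q → ι) (g : q → κ) :
    lineHom b x a ((genericMatrix ρ b c).submatrix f g).det =
      ((pencilMatrix (LinearMap.toMatrix c b (R ρ x)) (LinearMap.toMatrix c b (R ρ a))).submatrix
        f g).det := by
  rw [AlgHom.map_det]
  congr 1
  ext1 i j
  refine (lineHom_sum b (ρ (c (g j))) x a (f i)).trans ?_
  rw [Matrix.submatrix_apply, pencilMatrix, Matrix.add_apply, Matrix.smul_apply, Matrix.map_apply,
    Matrix.map_apply, LinearMap.toMatrix_apply, LinearMap.toMatrix_apply, smul_eq_mul]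
  rfl

omit [FiniteDimensional ℂ 𝔤] [FiniteDimensional ℂ V] in
-- The top coefficient in the line parameter is the minor of `R_a` alone, independent of `x`.
theorem coeff_lineHom_genericMatrix [DecidableEq κ] (x a : V) {q : Type*} [Fintype q]
    [DecidableEq q] (f : q → ι) (g : q → κ) :
    (lineHom b x a ((genericMatrix ρ b c).submatrix f g).det).coeff (Fintype.card q) =
      ((LinearMap.toMatrix c b (R ρ a)).submatrix f g).det := by
  rw [lineHom_genericMatrix]
  exact Polynomial.coeff_det_X_add_C_card ((LinearMap.toMatrix c b (R ρ a)).submatrix f g)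
    ((LinearMap.toMatrix c b (R ρ x)).submatrix f g)

omit [FiniteDimensional ℂ 𝔤] [FiniteDimensional ℂ V] [Fintype κ] in
theorem totalDegree_genericMatrix_le {q : Type*} [Fintype q] [DecidableEq q]
    (f : q → ι) (g : q → κ) :
    ((genericMatrix ρ b c).submatrix f g).det.totalDegree ≤ Fintype.card q := by
  refine IsHomogeneous.totalDegree_le ?_
  rw [Matrix.det_apply]
  refine IsHomogeneous.sum _ _ _ fun σ _ => ?_
  have h : (∏ i, (genericMatrix ρ b c).submatrix f g (σ i) i).IsHomogeneous (Fintype.card q) := by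
    have := IsHomogeneous.prod Finset.univ
      (fun i => (genericMatrix ρ b c).submatrix f g (σ i) i) (fun _ => 1) fun i _ =>
        IsHomogeneous.sum _ _ _ fun k _ => by
          simpa using (isHomogeneous_C _ (b.repr (ρ (c (g i)) (b k)) (f (σ i)))).mul
            (isHomogeneous_X ℂ k)
    simpa using this
  rcases Int.units_eq_one_or (Equiv.Perm.sign σ) with h1 | h1
  · rwa [h1, one_smul]
  · rw [h1, Units.neg_smul, one_smul]
    exact h.neg

omit [FiniteDimensional ℂ 𝔤] [FiniteDimensional ℂ V] [Fintype κ] in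
theorem mem_maximalMinors {f : Fin (regularRank ρ) → ι} {g : Fin (regularRank ρ) → κ}
    (h : ((genericMatrix ρ b c).submatrix f g).det ≠ 0) :
    ((genericMatrix ρ b c).submatrix f g).det ∈ maximalMinors ρ b c := by
  have hf : Function.Injective f := fun i j hij => by
    by_contra hne
    exact h (Matrix.det_zero_of_row_eq hne (by ext k; simp [hij]))
  have hg : Function.Injective g := fun i j hij => by
    by_contra hne
    exact h (Matrix.det_zero_of_column_eq hne (by simp [hij]))
  exact ⟨h, ⟨f, hf⟩, ⟨g, hg⟩, rfl⟩

omit [FiniteDimensional ℂ 𝔤] [FiniteDimensional ℂ V] in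
theorem finite_maximalMinors : (maximalMinors ρ b c).Finite := by
  refine (Set.finite_range fun s : (Fin (regularRank ρ) ↪ ι) × (Fin (regularRank ρ) ↪ κ) =>
    ((genericMatrix ρ b c).submatrix s.1 s.2).det).subset ?_
  rintro _ ⟨_, f, g, rfl⟩
  exact ⟨(f, g), rfl⟩

/-- The total core size is at least the rank of `R_a`, and it is reached by some `R_{x + ta}`, whose
rank cannot exceed that of `R_a`. -/
theorem sum_core_eq {a x : V} (ha : IsRegularPoint ρ a) (F : CanonicalForm (R ρ x) (R ρ a)) :
    ∑ i, (F.block i).core = regularRank ρ := by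
  have hF := F.not_isInfinite (ha.hasKerChains x)
  rw [ha.regularRank_eq]
  refine le_antisymm ?_ (F.finrank_range_le hF)
  obtain ⟨t, ht⟩ := F.exists_le_finrank_range hF
  rw [← R_smul, ← R_add] at ht
  exact ht.trans (ha.finrank_range_le _)

theorem elementaryProduct_mem_span {a x : V} (ha : IsRegularPoint ρ a)
    (F : CanonicalForm (R ρ x) (R ρ a)) :
    F.elementaryProduct ∈ Ideal.span (lineHom b x a '' maximalMinors ρ b c) := by
  classical
  have h := F.elementaryProduct_mem c b (q := Fin (regularRank ρ))
    (by rw [Fintype.card_fin, sum_core_eq ha F])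
  refine Ideal.span_le.2 ?_ h
  rintro _ ⟨f, g, rfl⟩
  rw [← lineHom_genericMatrix]
  by_cases h0 : ((genericMatrix ρ b c).submatrix f g).det = 0
  · rw [h0, map_zero]
    exact zero_mem _
  · exact Ideal.subset_span ⟨_, mem_maximalMinors b c h0, rfl⟩

theorem elementaryProduct_dvd_lineHom {a x : V} (ha : IsRegularPoint ρ a)
    (F : CanonicalForm (R ρ x) (R ρ a)) {m : MvPolynomial ι ℂ} (hm : m ∈ maximalMinors ρ b c) :
    F.elementaryProduct ∣ lineHom b x a m := by
  classical
  obtain ⟨_, f, g, rfl⟩ := hm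
  rw [lineHom_genericMatrix]
  exact F.elementaryProduct_dvd c b (by rw [Fintype.card_fin, sum_core_eq ha F]) f g

/-- Some maximal minor has the largest possible degree on all lines in a regular direction. -/
theorem exists_maximalMinor_natDegree {a : V} (ha : IsRegularPoint ρ a) :
    ∃ m ∈ maximalMinors ρ b c, ∀ x, (lineHom b x a m).natDegree = m.totalDegree := by
  classical
  have hex : ∃ (f : Fin (regularRank ρ) → ι) (g : Fin (regularRank ρ) → κ),
      ((LinearMap.toMatrix c b (R ρ a)).submatrix f g).det ≠ 0 := by
    by_contra! h
    -- Take the pencil with `x = 0`: its minors are powers of the variable times those of `R_a`. If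
    -- these all vanished, the monic elementary product would lie in the zero ideal.
    obtain ⟨F⟩ := (ha.hasKerChains 0).nonempty_canonicalForm
    refine (F.elementaryProduct_monic (F.not_isInfinite (ha.hasKerChains 0))).ne_zero ?_
    have h1 := F.elementaryProduct_mem c b (q := Fin (regularRank ρ))
      (by rw [Fintype.card_fin, sum_core_eq ha F])
    rw [← Ideal.mem_bot]
    refine Ideal.span_le.2 ?_ h1
    rintro _ ⟨f, g, rfl⟩
    have h2 : R ρ (0 : V) = 0 := by ext ξ; simp [R_apply]
    have h3 : (pencilMatrix (LinearMap.toMatrix c b (R ρ (0 : V)))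
        (LinearMap.toMatrix c b (R ρ a))).submatrix f g =
        (Polynomial.X : Polynomial ℂ) •
          ((LinearMap.toMatrix c b (R ρ a)).submatrix f g).map Polynomial.C := by
      ext1 i j
      simp [pencilMatrix, h2]
    rw [h3, Matrix.det_smul, SetLike.mem_coe, Ideal.mem_bot]
    have h4 := RingHom.map_det (Polynomial.C : ℂ →+* Polynomial ℂ)
      ((LinearMap.toMatrix c b (R ρ a)).submatrix f g)
    rw [h, map_zero] at h4
    rw [← RingHom.mapMatrix_apply, ← h4, mul_zero]
  obtain ⟨f, g, hfg⟩ := hex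
  have hdeg : ∀ x, regularRank ρ ≤
      (lineHom b x a ((genericMatrix ρ b c).submatrix f g).det).natDegree := fun x => by
    refine Polynomial.le_natDegree_of_ne_zero ?_
    have := coeff_lineHom_genericMatrix (ρ := ρ) b c x a f g
    rw [Fintype.card_fin] at this
    rwa [this]
  refine ⟨_, mem_maximalMinors b c (f := f) (g := g) fun h0 => ?_, fun x => ?_⟩
  · have := coeff_lineHom_genericMatrix (ρ := ρ) b c a a f g
    rw [h0, map_zero, Polynomial.coeff_zero] at this
    exact hfg this.symm
  · refine le_antisymm (natDegree_lineHom_le b x a _) (le_trans ?_ (hdeg x))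
    simpa using totalDegree_genericMatrix_le (ρ := ρ) b c f g

omit [FiniteDimensional ℂ 𝔤] [FiniteDimensional ℂ V] in
variable (ρ) in
theorem exists_isFundamentalSemiInvariant : ∃ p, IsFundamentalSemiInvariant ρ b c p := by
  let : NormalizedGCDMonoid (MvPolynomial ι ℂ) := Nonempty.some inferInstance
  refine ⟨(finite_maximalMinors (ρ := ρ) b c).toFinset.gcd id, fun m hm => ?_, fun d hd => ?_⟩
  · exact Finset.gcd_dvd (f := id) ((Set.Finite.mem_toFinset _).2 hm)
  · exact Finset.dvd_gcd fun m hm => hd m ((Set.Finite.mem_toFinset _).1 hm)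

variable (ρ) in
/-- The quotients of the maximal minors by `p`. -/
def cofactors (p : MvPolynomial ι ℂ) : Set (MvPolynomial ι ℂ) :=
  {h | p * h ∈ maximalMinors ρ b c}

variable {b c} {p : MvPolynomial ι ℂ} (hp : IsFundamentalSemiInvariant ρ b c p)

include hp

theorem IsFundamentalSemiInvariant.ne_zero {a : V} (ha : IsRegularPoint ρ a) : p ≠ 0 := by
  rintro rfl
  obtain ⟨m, hm, _⟩ := exists_maximalMinor_natDegree b c ha
  exact hm.1 (zero_dvd_iff.1 (hp.1 m hm))

omit [FiniteDimensional ℂ 𝔤] [FiniteDimensional ℂ V] [Fintype κ] in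
-- Greatest common divisors differ by units, so a single choice of `p` decides membership in
-- `Sing₁`.
theorem IsFundamentalSemiInvariant.notMem_singOne_iff (x : V) :
    x ∉ singOne ρ b c ↔ ∃ h ∈ cofactors ρ b c p, evalAt b x h ≠ 0 := by
  constructor
  · intro hx
    simp only [singOne, Set.mem_ofPred_eq, not_forall] at hx
    obtain ⟨p', h', hp', hm', hne⟩ := hx
    obtain ⟨u, hu⟩ := associated_of_dvd_dvd (hp'.2 p hp.1) (hp.2 p' hp'.1)
    have hh : p * ((u : MvPolynomial ι ℂ) * h') = p' * h' := by
      rw [← mul_assoc, hu]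
    refine ⟨(u : MvPolynomial ι ℂ) * h', by rwa [cofactors, Set.mem_ofPred_eq, hh], ?_⟩
    rw [evalAt_mul]
    exact mul_ne_zero ((u.isUnit.map (MvPolynomial.eval fun i => b.repr x i)).ne_zero) hne
  · rintro ⟨h, hh, hne⟩ hx
    exact hne (hx p h hp hh)

/-- A factor of a minor that keeps its degree on the line must keep its degree as well. -/
theorem IsFundamentalSemiInvariant.natDegree_lineHom {a : V} (ha : IsRegularPoint ρ a) (x : V) :
    (lineHom b x a p).natDegree = p.totalDegree := by
  obtain ⟨m, hm, hdeg⟩ := exists_maximalMinor_natDegree b c ha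
  obtain ⟨h, rfl⟩ := hp.1 m hm
  have h0 : p ≠ 0 ∧ h ≠ 0 := mul_ne_zero_iff.1 hm.1
  have h1 := natDegree_lineHom_le b x a p
  have h2 := natDegree_lineHom_le b x a h
  have h3 := hdeg x
  rw [totalDegree_mul_of_isDomain h0.1 h0.2, map_mul] at h3
  have h4 := Polynomial.natDegree_mul_le (p := lineHom b x a p) (q := lineHom b x a h)
  omega

theorem IsFundamentalSemiInvariant.exists_mul_eq {a x : V} (ha : IsRegularPoint ρ a)
    (F : CanonicalForm (R ρ x) (R ρ a)) : ∃ q ∈ Ideal.span (lineHom b x a '' cofactors ρ b c p),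
      lineHom b x a p * q = F.elementaryProduct := by
  rw [← Ideal.mem_span_singleton_mul]
  refine Ideal.span_le.2 ?_ (elementaryProduct_mem_span b c ha F)
  rintro _ ⟨m, hm, rfl⟩
  obtain ⟨h, rfl⟩ := hp.1 m hm
  rw [map_mul]
  exact Ideal.mul_mem_mul (Ideal.mem_span_singleton_self _) (Ideal.subset_span ⟨h, hm, rfl⟩)

/-- The elementary product is `p` restricted to the line times some `q` in the ideal of the
restricted cofactors, so its degree `J` is `deg p + deg q`. Equality means that `q` is a nonzero
constant; the statement is that this happens exactly when the cofactors have no common zero on the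
line. -/
theorem IsFundamentalSemiInvariant.totalDegree_le_and_iff {a x : V} (ha : IsRegularPoint ρ a)
    (F : CanonicalForm (R ρ x) (R ρ a)) : p.totalDegree ≤ ∑ i, (F.block i).jordanDim ∧
      ((∀ t : ℂ, x + t • a ∉ singOne ρ b c) ↔ p.totalDegree = ∑ i, (F.block i).jordanDim) := by
  obtain ⟨q, hq, hpq⟩ := hp.exists_mul_eq ha F
  have hF := F.not_isInfinite (ha.hasKerChains x)
  have hδ := (F.elementaryProduct_monic hF).ne_zero
  have hd := F.natDegree_elementaryProduct hF
  have h0 := hδ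
  rw [← hpq] at h0
  have hp0 := left_ne_zero_of_mul h0
  have hq0 := right_ne_zero_of_mul h0
  have hd' := hd
  rw [← hpq, Polynomial.natDegree_mul hp0 hq0, hp.natDegree_lineHom ha] at hd'
  refine ⟨by omega, fun hmiss => le_antisymm (by omega) ?_, fun heq t => ?_⟩
  · set I := Ideal.span (lineHom b x a '' cofactors ρ b c p) with hI
    have hItop : I = ⊤ := by
      by_contra hne
      obtain ⟨g, hg⟩ := (IsPrincipalIdealRing.principal I).principal
      have hg' : I = Ideal.span {g} := hg
      have hgdeg : g.degree ≠ 0 := fun h => hne (by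
        rw [hg', Ideal.span_singleton_eq_top]
        exact Polynomial.isUnit_iff_degree_eq_zero.2 h)
      obtain ⟨t, ht⟩ := IsAlgClosed.exists_root g hgdeg
      obtain ⟨h, hh, hne'⟩ := (hp.notMem_singOne_iff (x + t • a)).1 (hmiss t)
      have h1 : lineHom b x a h ∈ I := Ideal.subset_span ⟨h, hh, rfl⟩
      rw [hg', Ideal.mem_span_singleton] at h1
      rw [← eval_lineHom] at hne'
      exact hne' (Polynomial.eval_eq_zero_of_dvd_of_eval_eq_zero h1 ht)
    -- Once `I` is the unit ideal, `z = 1` gives that the elementary product divides the restriction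
    -- of `p`, which bounds its degree from above.
    have hdvd : ∀ z ∈ I, F.elementaryProduct ∣ lineHom b x a p * z := by
      intro z hz
      induction hz using Submodule.span_induction with
      | mem z hz =>
        obtain ⟨h, hh, rfl⟩ := hz
        rw [← map_mul]
        exact elementaryProduct_dvd_lineHom b c ha F hh
      | zero => simp
      | add y z _ _ hy hz =>
        rw [mul_add]
        exact dvd_add hy hz
      | smul w z _ hz =>
        rw [smul_eq_mul, mul_left_comm]
        exact hz.mul_left _
    have h1 := hdvd 1 (by rw [hItop]; trivial)
    rw [mul_one] at h1
    have h2 := Polynomial.natDegree_le_of_dvd h1 hp0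
    rwa [hd, hp.natDegree_lineHom ha] at h2
  · rw [hp.notMem_singOne_iff]
    by_contra! hzero
    have hqd : q.natDegree = 0 := by omega
    have hle : Ideal.span (lineHom b x a '' cofactors ρ b c p) ≤
        RingHom.ker (Polynomial.evalRingHom t) := by
      rw [Ideal.span_le]
      rintro _ ⟨h, hh, rfl⟩
      rw [SetLike.mem_coe, RingHom.mem_ker, Polynomial.coe_evalRingHom, eval_lineHom]
      exact hzero h hh
    have h1 := hle hq
    rw [Polynomial.eq_C_of_natDegree_eq_zero hqd, RingHom.mem_ker, Polynomial.coe_evalRingHom,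
      Polynomial.eval_C] at h1
    apply hq0
    rw [Polynomial.eq_C_of_natDegree_eq_zero hqd, h1, map_zero]

omit hp

variable (ρ b c) in
/-- The dimensions of the two chain spans add up to the generic value exactly when the line
misses `Sing₁`. -/
theorem exists_chainSpan_add_eq_iff : ∃ N : ℕ, ∀ a x : V, IsRegularPoint ρ a →
    Module.finrank ℂ (chainSpan (R ρ x).dualMap (R ρ a).dualMap) +
      Module.finrank ℂ (chainSpan (R ρ x) (R ρ a)) ≤ N ∧
    ((∀ t : ℂ, x + t • a ∉ singOne ρ b c) ↔
      Module.finrank ℂ (chainSpan (R ρ x).dualMap (R ρ a).dualMap) +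
        Module.finrank ℂ (chainSpan (R ρ x) (R ρ a)) = N) := by
  obtain ⟨p, hp⟩ := exists_isFundamentalSemiInvariant ρ b c
  -- This is the block count with the total Jordan size replaced by its minimum `deg p`.
  refine ⟨Module.finrank ℂ 𝔤 + Module.finrank ℂ V - p.totalDegree - regularRank ρ,
    fun a x ha => ?_⟩
  obtain ⟨F⟩ := (ha.hasKerChains x).nonempty_canonicalForm
  have hF := F.not_isInfinite (ha.hasKerChains x)
  obtain ⟨h1, h2⟩ := hp.totalDegree_le_and_iff ha F
  have h3 := F.sum_jordanDim_add
  rw [sum_core_eq ha F] at h3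
  rw [h2, F.finrank_chainSpan_dualMap hF, F.finrank_chainSpan hF]
  omega

theorem exists_line_notMem_singOne {a : V} (ha : IsRegularPoint ρ a) :
    ∃ x, ∀ t : ℂ, x + t • a ∉ singOne ρ b c := by
  obtain ⟨p, hp⟩ := exists_isFundamentalSemiInvariant ρ b c
  have hp0 := hp.ne_zero ha
  obtain ⟨x, hx⟩ := exists_line_of_coprime b a (cofactors ρ b c p) (by
    obtain ⟨m, hm, _⟩ := exists_maximalMinor_natDegree b c ha
    obtain ⟨h, rfl⟩ := hp.1 m hm
    exact ⟨h, hm, right_ne_zero_of_mul hm.1⟩) fun d hd => by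
      have h1 := hp.2 (p * d) fun m hm => by
        obtain ⟨h, rfl⟩ := hp.1 m hm
        exact mul_dvd_mul_left p (hd h hm)
      rw [← mul_one p, mul_assoc, one_mul] at h1
      exact isUnit_of_dvd_one ((mul_dvd_mul_iff_left hp0).1 h1)
  exact ⟨x, fun t => (hp.notMem_singOne_iff _).2 (hx t)⟩

end Minors


/-! ### The Jacobian criterion for the transcendence degree -/

section TranscendenceDegree

open MvPolynomial

variable {V ι : Type*} [AddCommGroup V] [Module ℂ V] [Fintype ι] {b : Module.Basis ι ℂ V}

omit [Fintype ι] in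
theorem evalAt_add (x : V) (f g : MvPolynomial ι ℂ) :
    evalAt b x (f + g) = evalAt b x f + evalAt b x g := map_add _ _ _

/-- The chain rule for derivations. -/
theorem derivation_aeval {s : Type*} [Fintype s] {P : Type*} [CommRing P] [Algebra ℂ P]
    (D : Derivation ℂ P P) (g : s → P) (Q : MvPolynomial s ℂ) :
    D (aeval g Q) = ∑ j, aeval g (pderiv j Q) * D (g j) := by
  classical
  induction Q using MvPolynomial.induction_on with
  | C c => simp
  | add p q hp hq => simp only [map_add, hp, hq, add_mul, Finset.sum_add_distrib]
  | mul_X p i hp =>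
    have h1 : ∑ j, aeval g (pderiv j (X i : MvPolynomial s ℂ)) * D (g j) = D (g i) := by
      rw [Finset.sum_eq_single_of_mem i (Finset.mem_univ _) fun j _ hj => by
        rw [pderiv_X_of_ne hj.symm, map_zero, zero_mul]]
      rw [pderiv_X_self, map_one, one_mul]
    rw [map_mul, aeval_X, Derivation.leibniz, hp, ← h1, smul_eq_mul, smul_eq_mul, Finset.mul_sum,
      Finset.mul_sum, ← Finset.sum_add_distrib]
    refine Finset.sum_congr rfl fun j _ => ?_
    rw [Derivation.leibniz, smul_eq_mul, smul_eq_mul, map_add, map_mul, map_mul, aeval_X]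
    ring

/-- Differentiating a relation lowers its degree, so by induction all partial derivatives are zero.
In characteristic zero the relation is then a constant, which must be zero. -/
theorem algebraicIndependent_of_pderiv {s : Type*} {P : Type*} [CommRing P] [IsDomain P]
    [Algebra ℂ P] (g : s → P)
    (h : ∀ Q : MvPolynomial s ℂ, aeval g Q = 0 → ∀ j, aeval g (pderiv j Q) = 0) :
    AlgebraicIndependent ℂ g := by
  have hconst : ∀ Q : MvPolynomial s ℂ, (∀ d, d ≠ 0 → coeff d Q = 0) → aeval g Q = 0 → Q = 0 := by
    classical
    intro Q hQ h0
    have h1 : Q = C (coeff 0 Q) := by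
      ext d
      rw [coeff_C]
      split_ifs with hd
      · rw [hd]
      · exact hQ d (Ne.symm hd)
    rw [h1, aeval_C, FaithfulSMul.algebraMap_eq_zero_iff] at h0
    rw [h1, h0, map_zero]
  have key : ∀ n : ℕ, ∀ Q : MvPolynomial s ℂ, (∀ d, n < d.degree → coeff d Q = 0) →
      aeval g Q = 0 → Q = 0 := by
    intro n
    induction n with
    | zero =>
      intro Q hQ
      exact hconst Q fun d hd => hQ d (Nat.pos_of_ne_zero fun h0 => hd ((Finsupp.degree_eq_zero_iff d).1 h0))
    | succ n ih =>
      intro Q hQ h0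
      refine hconst Q (fun d hd => ?_) h0
      obtain ⟨i, hi⟩ := Finsupp.ne_iff.1 hd
      obtain ⟨m, rfl⟩ : ∃ m, d = m + Finsupp.single i 1 := by
        refine ⟨d - Finsupp.single i 1, (tsub_add_cancel_of_le ?_).symm⟩
        rw [Finsupp.single_le_iff]
        exact Nat.one_le_iff_ne_zero.2 hi
      have h1 : pderiv i Q = 0 := by
        refine ih _ (fun d' hd' => ?_) (h Q h0 i)
        rw [coeff_pderiv, hQ, zero_mul]
        rw [map_add, Finsupp.degree_single]
        omega
      have h2 := coeff_pderiv (i := i) Q m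
      rw [h1, coeff_zero, eq_comm, mul_eq_zero] at h2
      exact h2.resolve_right (by exact_mod_cast Nat.succ_ne_zero (m i))
  refine (injective_iff_map_eq_zero _).2 fun Q hQ => ?_
  refine key Q.totalDegree Q (fun d hd => ?_) hQ
  by_contra hne
  have := le_totalDegree (mem_support_iff.2 hne)
  rw [Finsupp.degree_apply] at hd
  exact absurd this (not_le.2 hd)

theorem exists_dual_vectors [FiniteDimensional ℂ V] {s : Type*} [Fintype s] [DecidableEq s]
    {φ : s → Module.Dual ℂ V} (h : LinearIndependent ℂ φ) :
    ∃ v : s → V, ∀ i j, φ i (v j) = if i = j then 1 else 0 := by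
  choose ψ hψ using fun j => LinearMap.exists_extend ((Module.Basis.span h).coord j)
  refine ⟨fun j => (Module.evalEquiv ℂ V).symm (ψ j), fun i j => ?_⟩
  have h1 := LinearMap.congr_fun (hψ j) (Module.Basis.span h i)
  rw [LinearMap.comp_apply, Module.Basis.coord_apply, Module.Basis.repr_self, Finsupp.single_apply,
    Submodule.subtype_apply, Module.Basis.span_apply] at h1
  rw [Module.apply_evalEquiv_symm_apply, h1]

/-- Along directions dual to the differentials at `x`, the matrix of derivatives of the `g i` is the
identity at `x`, so its determinant is a nonzero polynomial. By the chain rule the partial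
derivatives of any relation are again relations. -/
theorem algebraicIndependent_of_linearIndependent_differential [FiniteDimensional ℂ V] {s : Type*}
    [Fintype s] (g : s → MvPolynomial ι ℂ) (x : V)
    (h : LinearIndependent ℂ fun i => differential b (g i) x) : AlgebraicIndependent ℂ g := by
  classical
  obtain ⟨v, hv⟩ := exists_dual_vectors h
  let M : Matrix s s (MvPolynomial ι ℂ) := Matrix.of fun j k => dirDeriv b (v k) (g j)
  have hM : M.det ≠ 0 := by
    intro h0
    have h1 : evalAt b x M.det = 0 := by rw [h0, evalAt, map_zero]
    rw [evalAt, RingHom.map_det] at h1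
    have h2 : (MvPolynomial.eval fun i => b.repr x i).mapMatrix M = 1 := by
      ext1 i j
      rw [Matrix.one_apply, ← hv, ← evalAt_dirDeriv]
      rfl
    rw [h2, Matrix.det_one] at h1
    exact one_ne_zero h1
  refine algebraicIndependent_of_pderiv g fun Q hQ => congrFun
    (Matrix.eq_zero_of_vecMul_eq_zero hM (v := fun j => aeval g (pderiv j Q)) ?_)
  ext1 k
  have := derivation_aeval (dirDeriv b (v k)) g Q
  rw [hQ, map_zero] at this
  exact this.symm

/-- Replace a relation by its derivative while the derivative still vanishes at `y`. The degree
drops, and a nonzero constant never vanishes. -/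
theorem exists_separable_relation {A P : Type*} [CommRing A] [CommRing P] [IsDomain P] [Algebra A P]
    [FaithfulSMul A P] [CharZero A] {y : P} (hy : IsAlgebraic A y) :
    ∃ q : Polynomial A, Polynomial.aeval y q = 0 ∧ Polynomial.aeval y q.derivative ≠ 0 := by
  obtain ⟨p, hp, hpy⟩ := hy
  have : IsDomain A := (FaithfulSMul.algebraMap_injective A P).isDomain
  induction hn : p.natDegree using Nat.strong_induction_on generalizing p with
  | _ n ih =>
    by_cases h : Polynomial.aeval y p.derivative = 0
    · have hpos : p.natDegree ≠ 0 := fun h0 => by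
        rw [Polynomial.eq_C_of_natDegree_eq_zero h0, Polynomial.aeval_C,
          FaithfulSMul.algebraMap_eq_zero_iff] at hpy
        apply hp
        rw [Polynomial.eq_C_of_natDegree_eq_zero h0, hpy, map_zero]
      refine ih _ ?_ p.derivative (fun h0 => hpos ?_) h rfl
      · rw [← hn]
        exact Polynomial.natDegree_derivative_lt hpos
      · exact Polynomial.derivative_eq_zero.1 h0
    · exact ⟨p, hpy, h⟩

/-- The chain rule modulo differentials of the coefficients: `d(q(y)) ≡ q'(y) dy`. For `q(y) = 0`
and `q'(y)(x) ≠ 0` it puts `dy` in the span. -/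
theorem differential_aeval_sub_mem (A : Subalgebra ℂ (MvPolynomial ι ℂ)) (x : V)
    (y : MvPolynomial ι ℂ) (q : Polynomial A) :
    differential b (Polynomial.aeval y q) x -
      evalAt b x (Polynomial.aeval y q.derivative) • differential b y x ∈
        spanDifferentials b A x := by
  induction q using Polynomial.induction_on with
  | C a =>
    rw [Polynomial.derivative_C, map_zero, evalAt, map_zero, zero_smul, sub_zero, Polynomial.aeval_C]
    exact Submodule.subset_span ⟨a, a.2, rfl⟩
  | add p q hp hq =>
    rw [Polynomial.derivative_add, map_add, map_add, differential_add, evalAt_add, add_smul, add_sub_add_comm]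
    exact add_mem hp hq
  | monomial n a h =>
    rw [pow_succ, ← mul_assoc]
    generalize Polynomial.C a * Polynomial.X ^ n = p at h
    rw [Polynomial.derivative_mul, Polynomial.derivative_X, mul_one, map_mul, map_add, map_mul,
      Polynomial.aeval_X, differential_mul, evalAt_add, evalAt_mul]
    have := Submodule.smul_mem _ (evalAt b x y) h
    convert this using 1
    module

/-- The differentials of a transcendence basis span the dual space at a generic point. -/
theorem exists_span_differential_eq_top {u : Set (MvPolynomial ι ℂ)}
    (hu : IsTranscendenceBasis ℂ ((↑) : u → MvPolynomial ι ℂ)) :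
    ∃ x : V, Submodule.span ℂ {φ | ∃ g ∈ u, φ = differential b g x} = ⊤ := by
  have halg := hu.isAlgebraic
  rw [Subtype.range_coe] at halg
  choose q hq hq' using fun l : ι => exists_separable_relation
    (halg.isAlgebraic (X l : MvPolynomial ι ℂ))
  obtain ⟨x, hx⟩ := exists_evalAt_ne_zero b (Finset.prod_ne_zero_iff.2 fun l (_ : l ∈ Finset.univ) =>
    hq' l)
  rw [evalAt, map_prod, Finset.prod_ne_zero_iff] at hx
  refine ⟨x, ?_⟩
  rw [← spanDifferentials_adjoin, eq_top_iff]
  have hmem : ∀ l, b.coord l ∈ spanDifferentials b (Algebra.adjoin ℂ u) x := fun l => by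
    have h1 := differential_aeval_sub_mem (b := b) (Algebra.adjoin ℂ u) x (X l) (q l)
    rw [hq, ← C_0, differential_const, zero_sub, neg_mem_iff] at h1
    have h2 : differential b (X l) x = b.coord l := by
      ext v
      rw [← evalAt_dirDeriv, dirDeriv_X, evalAt, eval_C]
      rfl
    rw [h2] at h1
    exact (Submodule.smul_mem_iff _ (hx l (Finset.mem_univ _))).1 h1
  intro φ _
  classical
  have : φ = ∑ l, φ (b l) • b.coord l := by
    refine b.ext fun i => ?_
    simp
  rw [this]
  exact Submodule.sum_mem _ fun l _ => Submodule.smul_mem _ _ (hmem l)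

/-- The transcendence degree is the maximal dimension of the span of differentials. -/
theorem trdeg_eq_of_isGreatest [FiniteDimensional ℂ V] (F : Subalgebra ℂ (MvPolynomial ι ℂ)) {k : ℕ}
    (hle : ∀ x, Module.finrank ℂ (spanDifferentials b F x) ≤ k)
    (hex : ∃ x, Module.finrank ℂ (spanDifferentials b F x) = k) :
    Algebra.trdeg ℂ F = (k : Cardinal) := by
  apply le_antisymm
  · have : FaithfulSMul ℂ F := (faithfulSMul_iff_algebraMap_injective ℂ F).2
      (algebraMap ℂ F).injective
    obtain ⟨s, hs⟩ := exists_isTranscendenceBasis ℂ F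
    rw [← hs.cardinalMk_eq_trdeg]
    have h1 : AlgebraicIndependent ℂ (F.val ∘ ((↑) : s → F)) :=
      (F.val.algebraicIndependent_iff Subtype.val_injective).2 hs.1
    -- Extended to a transcendence basis of all of `ℂ[V]`, the family has `dim V` elements. Their
    -- differentials span `V*` at a suitable point, so they are independent there, and so are those
    -- coming from `F`.
    obtain ⟨u, hsu, hu⟩ := exists_isTranscendenceBasis_superset h1.to_subtype_range
    obtain ⟨x, hx⟩ := exists_span_differential_eq_top (b := b) hu
    have hcard : Cardinal.mk u = Fintype.card ι := by
      have := hu.lift_cardinalMk_eq_trdeg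
      simpa using this
    have hfin : Finite u := Cardinal.lt_aleph0_iff_finite.1 (hcard ▸ Cardinal.natCast_lt_aleph0)
    have : Fintype u := Fintype.ofFinite u
    have hli : LinearIndependent ℂ fun g : u => differential b (g : MvPolynomial ι ℂ) x := by
      refine linearIndependent_of_top_le_span_of_card_eq_finrank ?_ ?_
      · rw [← hx]
        refine Submodule.span_mono ?_
        rintro _ ⟨g, hg, rfl⟩
        exact ⟨⟨g, hg⟩, rfl⟩
      · rw [Subspace.dual_finrank_eq, Module.finrank_eq_card_basis b]
        exact_mod_cast (Cardinal.mk_fintype u).symm.trans hcard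
    let j : s → u := fun g => ⟨((g : F) : MvPolynomial ι ℂ), hsu ⟨g, rfl⟩⟩
    have hj : Function.Injective j := fun g g' h =>
      Subtype.ext (Subtype.ext (congrArg (fun z : u => (z : MvPolynomial ι ℂ)) h))
    have : Finite s := Finite.of_injective j hj
    have : Fintype s := Fintype.ofFinite s
    have hli' : LinearIndependent ℂ fun g : s => (⟨differential b ((g : F) : MvPolynomial ι ℂ) x,
        Submodule.subset_span ⟨_, g.1.2, rfl⟩⟩ : spanDifferentials b F x) :=
      LinearIndependent.of_comp (spanDifferentials b F x).subtype (hli.comp j hj)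
    rw [Cardinal.mk_fintype]
    exact_mod_cast hli'.fintype_card_le_finrank.trans (hle x)
  · obtain ⟨x, hx⟩ := hex
    obtain ⟨φ, hφ, _, hli⟩ := Submodule.exists_fun_fin_finrank_span_eq ℂ
      {φ | ∃ g ∈ F, φ = differential b g x}
    choose g hg hg' using hφ
    have h1 : AlgebraicIndependent ℂ g :=
      algebraicIndependent_of_linearIndependent_differential (b := b) g x (by
        rwa [← funext hg'])
    have h2 : AlgebraicIndependent ℂ fun i => (⟨g i, hg i⟩ : F) :=
      (F.val.algebraicIndependent_iff Subtype.val_injective).1 h1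
    have h3 := h2.lift_cardinalMk_le_trdeg
    rw [Cardinal.mk_fin] at h3
    have h4 : Module.finrank ℂ (Submodule.span ℂ {φ | ∃ g ∈ F, φ = differential b g x}) = k := hx
    rw [h4] at h3
    simpa using h3

end TranscendenceDegree


/-! ### Comparing generic values with lines missing `Sing₁` -/

section GenericPairs

variable {𝔤 V ι κ : Type*} [LieRing 𝔤] [LieAlgebra ℂ 𝔤] [FiniteDimensional ℂ 𝔤] [AddCommGroup V]
  [Module ℂ V] [FiniteDimensional ℂ V] [Fintype ι] [Fintype κ]
  {ρ : 𝔤 →ₗ⁅ℂ⁆ Module.End ℂ V} (b : Module.Basis ι ℂ V) (c : Module.Basis κ ℂ 𝔤)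

theorem finrank_chainSpan_eq_of_hasType {a a' x x' : V} (ha : IsRegularPoint ρ a)
    (ha' : IsRegularPoint ρ a') {t : AlgebraicType} (h : HasType (R ρ x) (R ρ a) t)
    (h' : HasType (R ρ x') (R ρ a') t) :
    Module.finrank ℂ (chainSpan (R ρ x).dualMap (R ρ a).dualMap) =
      Module.finrank ℂ (chainSpan (R ρ x').dualMap (R ρ a').dualMap) ∧
    Module.finrank ℂ (chainSpan (R ρ x) (R ρ a)) =
      Module.finrank ℂ (chainSpan (R ρ x') (R ρ a')) := by
  obtain ⟨F, rfl⟩ := h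
  obtain ⟨F', h'⟩ := h'
  have hF := F.not_isInfinite (ha.hasKerChains x)
  have hF' := F'.not_isInfinite (ha'.hasKerChains x')
  have h1 : F'.rowIndices = F.rowIndices := congrArg AlgebraicType.rowIndices h'
  have h2 : F'.colIndices = F.colIndices := congrArg AlgebraicType.colIndices h'
  rw [F.finrank_chainSpan hF, F'.finrank_chainSpan hF', F.finrank_chainSpan_dualMap hF,
    F'.finrank_chainSpan_dualMap hF', CanonicalForm.kVert, CanonicalForm.kVert,
    CanonicalForm.kHor, CanonicalForm.kHor, h1, h2]
  exact ⟨rfl, rfl⟩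

/-- The dimensions of the chain spans are maximal on lines that miss `Sing₁`, and lines given by
generic pairs do so. -/
theorem exists_generic_values {a : V} (ha : IsRegularPoint ρ a) :
    (∀ x, Module.finrank ℂ (chainSpan (R ρ x).dualMap (R ρ a).dualMap) ≤ kVertRep ρ b) ∧
    (∀ x, (∀ t : ℂ, x + t • a ∉ singOne ρ b c) →
      Module.finrank ℂ (chainSpan (R ρ x).dualMap (R ρ a).dualMap) = kVertRep ρ b) ∧
    ∀ x, IsGenericPair ρ b x a → ∀ t : ℂ, x + t • a ∉ singOne ρ b c := by
  obtain ⟨kv, hkv, f, hf, hf'⟩ := exists_generic_chainSpan_dualMap b ha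
  obtain ⟨kh, hkh, g, hg, hg'⟩ := exists_generic_chainSpan b ha
  obtain ⟨N, hN⟩ := exists_chainSpan_add_eq_iff ρ b c
  obtain ⟨x₀, hx₀⟩ := exists_line_notMem_singOne (b := b) (c := c) ha
  have hfg := mul_ne_zero hf hg
  -- At a generic pair the sum is at most `N`; on a line in direction `a` missing `Sing₁` it equals
  -- `N`, while each summand is at most its generic value.
  have hNeq : kv + kh = N := by
    obtain ⟨e, he⟩ := exists_evalAt_ne_zero (b.prod b) hfg
    rw [evalAt_mul] at he
    have h1 := hf' e (left_ne_zero_of_mul he)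
    have h2 := hg' e (right_ne_zero_of_mul he)
    have h3 := (hN e.2 e.1 h1.1).1
    rw [h1.2, h2.2] at h3
    have h4 := (hN a x₀ ha).2.1 hx₀
    have h5 := hkv x₀ a ha
    have h6 := hkh x₀ a ha
    omega
  rw [kVertRep_eq b hf hf']
  refine ⟨fun x => hkv x a ha, fun x hx => ?_, fun x ⟨W, hW, hxW, t, ht⟩ => ?_⟩
  · have h4 := (hN a x ha).2.1 hx
    have h5 := hkv x a ha
    have h6 := hkh x a ha
    omega
  -- The open set of the generic pair meets the set of generic values. The algebraic type records
  -- both families of indices, so the pair itself has the generic indices with sum `N`.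
  · obtain ⟨e, heW, he⟩ := exists_mem_and_evalAt_ne_zero b hW ⟨_, hxW⟩ hfg
    rw [evalAt_mul] at he
    have h1 := hf' e (left_ne_zero_of_mul he)
    have h2 := hg' e (right_ne_zero_of_mul he)
    obtain ⟨h3, h4⟩ := finrank_chainSpan_eq_of_hasType h1.1 ha (ht e heW) (ht _ hxW)
    refine (hN a x ha).2.2 ?_
    rw [← h3, ← h4, h1.2, h2.2, hNeq]

end GenericPairs

end JordanKronecker

end

theorem mainTheorem3 {𝔤 V ι κ : Type*} [LieRing 𝔤] [LieAlgebra ℂ 𝔤] [FiniteDimensional ℂ 𝔤]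
    [AddCommGroup V] [Module ℂ V] [FiniteDimensional ℂ V] [Fintype ι] [Fintype κ]
    (ρ : 𝔤 →ₗ⁅ℂ⁆ Module.End ℂ V) (b : Module.Basis ι ℂ V) (c : Module.Basis κ ℂ 𝔤)
    (a : V) (ha : JordanKronecker.IsRegularPoint ρ a) :
    (∃ (q : ℕ) (G : Fin q → PowerSeries (MvPolynomial ι ℂ)),
      JordanKronecker.IsCompleteSet ρ b a G) ∧
    (∀ x : V, JordanKronecker.IsGenericPair ρ b x a →
      ∀ t : ℂ, x + t • a ∉ JordanKronecker.singOne ρ b c) ∧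
    ∀ (q : ℕ) (G : Fin q → PowerSeries (MvPolynomial ι ℂ)),
      JordanKronecker.IsCompleteSet ρ b a G →
      (∀ x : V,
        Module.finrank ℂ
            (JordanKronecker.spanDifferentials b (JordanKronecker.componentAlgebra G) x) =
          JordanKronecker.kVert (JordanKronecker.R ρ x) (JordanKronecker.R ρ a)) ∧
      (∀ x : V, (∀ t : ℂ, x + t • a ∉ JordanKronecker.singOne ρ b c) →
        Module.finrank ℂ
            (JordanKronecker.spanDifferentials b (JordanKronecker.componentAlgebra G) x) =
          JordanKronecker.kVertRep ρ b) ∧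
      Algebra.trdeg ℂ (JordanKronecker.componentAlgebra G) =
        (JordanKronecker.kVertRep ρ b : Cardinal) := by
  obtain ⟨hle, heq, hgen⟩ := JordanKronecker.exists_generic_values b c ha
  refine ⟨JordanKronecker.exists_isCompleteSet ha, hgen, fun q G hG => ?_⟩
  have hdim : ∀ x : V, Module.finrank ℂ
      (JordanKronecker.spanDifferentials b (JordanKronecker.componentAlgebra G) x) =
        Module.finrank ℂ (JordanKronecker.chainSpan (JordanKronecker.R ρ x).dualMap
          (JordanKronecker.R ρ a).dualMap) := fun x => by
    rw [hG.spanDifferentials_eq]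
  refine ⟨fun x => ?_, fun x hx => ?_, ?_⟩
  · rw [hdim, JordanKronecker.kVert_R ha]
  · rw [hdim, heq x hx]
  -- The bound `kVertRep` on the span of differentials is attained at a point whose line misses
  -- `Sing₁`.
  · obtain ⟨x, hx⟩ := JordanKronecker.exists_line_notMem_singOne (b := b) (c := c) ha
    refine JordanKronecker.trdeg_eq_of_isGreatest (b := b) _ (fun y => ?_) ⟨x, ?_⟩
    · rw [hdim]
      exact hle y
    · rw [hdim, heq x hx]
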